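/- All manifolds (Hausdorff, second countable, without boundary), maps and tensor fields are smooth. Let $(M^m,g)$ and $(N^{m+1},h)$ be Riemannian manifolds and let $\varphi:M^m\to N^{m+1}$ be an isometric immersion, i.e. $\varphi^*h=g$. Let $\nabla\mathrm d\varphi(X,Y)=\nabla^{\varphi}_X(\mathrm d\varphi(Y))-\mathrm d\varphi(\nabla^M_XY)$ be the second fundamental form of a map $\varphi: M\to N$, where $\nabla^\varphi$ is the pull-back of the Levi-Civita connection of $N$, and let $\tau(\varphi)=\operatorname{Trace}_g\nabla\mathrm d\varphi$ be its tension field. The map $\varphi$ is called biharmonic if it is a critical point of the bienergy $E^2(\varphi,\Omega)=\frac12\int_\Omega|\tau(\varphi)|^2\,\mathrm dv_g$ for every compact subset $\Omega$ of $M$, i.e. $\frac{d}{dt}\big|_{t=0}E^2(\varphi_t,\Omega)=0$ for every smooth variation $(\varphi_t)_{|t|<\varepsilon}$ of $\varphi_0=\varphi$ such that $\varphi_t=\varphi$ outside $\Omega$ for all $t$. For the isometric immersion $\varphi$ let $\eta=\frac1m\operatorname{Trace}_g\nabla\mathrm d\varphi$ be the mean curvature vector. For a smooth unit normal vector field $\xi$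 along $\varphi$ on an open set $U\subset M$, let $H$ be the mean curvature function, $\eta=H\xi$ on $U$, and let $A$ be the shape operator, $\langle AX,Y\rangle=-\langle\nabla^\varphi_X\xi,\mathrm d\varphi(Y)\rangle$. Consider on $U$ the equations $$\begin{cases}\Delta H-H|A|^2+H\,\mathrm{Ric}^N(\xi,\xi)=0,\\[2pt] 2A(\operatorname{grad}H)+\frac m2\operatorname{grad}H^2-2H\,(\mathrm{Ric}^N(\xi))^{\top}=0.\end{cases}\qquad(*)$$ Here $\Delta=\operatorname{div}\operatorname{grad}$ is the Laplace--Beltrami operator of $(M,g)$, $|A|^2=\sum_{i,j}\langle Ae_i,e_j\rangle^2$ for an orthonormal frame $(e_i)$ of $M$, $R^N(X,Y)Z=[\nabla^N_X,\nabla^N_Y]Z-\nabla^N_{[X,Y]}Z$, $\mathrm{Ric}^N(Z,W)=\operatorname{Trace}(X\mapsto R^N(X,Z)W)$, the Ricci operator is defined by $\langle\mathrm{Ric}^N(Z),W\rangle=\mathrm{Ric}^N(Z,W)$, and $\top$ denotes the tangential part, regarded as a tangent vector of $M$ through $\mathrm d\varphi$. Then $\varphi$ is biharmonic if and only if $(*)$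 holds for every choice of $U$ and $\xi$ (and the corresponding $H$, $A$). Moreover, $\varphi$ is biharmonic if and only if every point of $M$ has an open neighbourhood $U$ carrying a smooth unit normal field $\xi$ for which $(*)$ holds on $U$. -/

import Mathlib

open Bundle Manifold MeasureTheory Set
open scoped ContDiff Topology

noncomputable section

namespace Biharmonic

/-! ## The Levi-Civita connection and the connection along a map

`N` is a smooth `n`-manifold without boundary, whose tangent spaces carry inner products. -/

section Connection

variable {n : ℕ} {N : Type*} [TopologicalSpace N] [ChartedSpace (EuclideanSpace ℝ (Fin n)) N]
  [IsManifold (𝓡 n) ∞ N]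

/-- The vector field near `q` with constant components in the preferred chart at `q`, taking the
value `v` at `q`. -/
def coordField {q : N} (v : TangentSpace (𝓡 n) q) : Π y : N, TangentSpace (𝓡 n) y :=
  FiberBundle.extend (EuclideanSpace ℝ (Fin n)) v

variable [RiemannianBundle (fun q : N ↦ TangentSpace (𝓡 n) q)]

instance (q : N) : FiniteDimensional ℝ (TangentSpace (𝓡 n) q) :=
  inferInstanceAs (FiniteDimensional ℝ (EuclideanSpace ℝ (Fin n)))

instance (q : N) : CompleteSpace (TangentSpace (𝓡 n) q) :=
  FiniteDimensional.complete ℝ _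

variable (n) in
/-- An orthonormal basis of the tangent space at `q`, for the inner product given by the metric. -/
def onb (q : N) :
    OrthonormalBasis (Fin (Module.finrank ℝ (TangentSpace (𝓡 n) q))) ℝ (TangentSpace (𝓡 n) q) :=
  stdOrthonormalBasis ℝ (TangentSpace (𝓡 n) q)

/-- The derivative at `q`, in the direction `u`, of the metric coefficient `⟨∂_v, ∂_w⟩` in the
preferred chart at `q`. -/
def metricDeriv (q : N) (u v w : TangentSpace (𝓡 n) q) : ℝ :=
  mvfderiv (𝓡 n) (fun y : N ↦ inner ℝ (coordField v y) (coordField w y)) q u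

/-- The Christoffel symbol `Γ(u, v)` at `q` in the preferred chart at `q`:
`⟨Γ(u, v), w⟩ = (∂_u ⟨∂_v, ∂_w⟩ + ∂_v ⟨∂_u, ∂_w⟩ - ∂_w ⟨∂_u, ∂_v⟩) / 2` for all `w`. -/
def christoffel (q : N) (u v : TangentSpace (𝓡 n) q) : TangentSpace (𝓡 n) q :=
  ∑ k, ((metricDeriv q u v (onb n q k) + metricDeriv q v u (onb n q k)
    - metricDeriv q (onb n q k) u v) / 2) • onb n q k

variable {m : ℕ} {M : Type*} [TopologicalSpace M] [ChartedSpace (EuclideanSpace ℝ (Fin m)) M]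

/-- The components, in the preferred chart of `N` at `q`, of a vector field `V` along `φ`. -/
def components (φ : M → N) (V : Π x : M, TangentSpace (𝓡 n) (φ x)) (q : N) (y : M) :
    EuclideanSpace ℝ (Fin n) :=
  (trivializationAt (EuclideanSpace ℝ (Fin n)) (TangentSpace (𝓡 n)) q ⟨φ y, V y⟩).2

/-- The covariant derivative `∇^φ_u V` at `x` of a vector field `V` along a map `φ : M → N`, i.e. of
a section of `φ⁻¹TN`, for the pull-back of the Levi-Civita connection of `N`:
in the preferred chart of `N` at `φ x` it is `D_u V + Γ(dφ(u), V)`. -/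
def covAlong (φ : M → N) (V : Π x : M, TangentSpace (𝓡 n) (φ x)) (x : M)
    (u : TangentSpace (𝓡 m) x) : TangentSpace (𝓡 n) (φ x) :=
  (show TangentSpace (𝓡 n) (φ x) from mvfderiv (𝓡 m) (components φ V (φ x)) x u)
    + christoffel (φ x) (mfderiv (𝓡 m) (𝓡 n) φ x u) (V x)

/-- The Levi-Civita covariant derivative `∇_u Y` at `q`. -/
def leviCivita (Y : Π q : N, TangentSpace (𝓡 n) q) (q : N) (u : TangentSpace (𝓡 n) q) :
    TangentSpace (𝓡 n) q :=
  covAlong (fun y : N ↦ y) Y q u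

/-! ## Curvature -/

/-- `R(X, Y)Z = ∇_X ∇_Y Z - ∇_Y ∇_X Z - ∇_[X, Y] Z` for vector fields. -/
def curvatureField (X Y Z : Π q : N, TangentSpace (𝓡 n) q) (q : N) : TangentSpace (𝓡 n) q :=
  leviCivita (fun y ↦ leviCivita Z y (Y y)) q (X q)
    - leviCivita (fun y ↦ leviCivita Z y (X y)) q (Y q)
    - leviCivita Z q (VectorField.mlieBracket (𝓡 n) X Y q)

/-- The curvature operator `R(u, v)w` at a point. -/
def curvature (q : N) (u v w : TangentSpace (𝓡 n) q) : TangentSpace (𝓡 n) q :=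
  curvatureField (coordField u) (coordField v) (coordField w) q

/-- The Ricci tensor `Ric(z, w) = trace (u ↦ R(u, z)w)`. -/
def ricci (q : N) (z w : TangentSpace (𝓡 n) q) : ℝ :=
  ∑ i, inner ℝ (curvature q (onb n q i) z w) (onb n q i)

/-- The Ricci operator, `⟨Ric(z), w⟩ = Ric(z, w)`. -/
def ricciOp (q : N) (z : TangentSpace (𝓡 n) q) : TangentSpace (𝓡 n) q :=
  ∑ j, ricci q z (onb n q j) • onb n q j

/-! ## Gradient and Laplacian of functions -/

variable (n) in
/-- The gradient of a function: `⟨grad f, u⟩ = df(u)`. -/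
def grad (f : N → ℝ) (q : N) : TangentSpace (𝓡 n) q :=
  (InnerProductSpace.toDual ℝ (TangentSpace (𝓡 n) q)).symm (mvfderiv (𝓡 n) f q)

variable (n) in
/-- The Laplace-Beltrami operator `Δ f = div grad f`. -/
def laplacian (f : N → ℝ) (q : N) : ℝ :=
  ∑ i, inner ℝ (leviCivita (grad n f) q (onb n q i)) (onb n q i)

/-! ## The Riemannian volume measure -/

variable (n) in
/-- The Gram matrix `g_ij = ⟨∂_i, ∂_j⟩` at `y` of the preferred chart at `p`. -/
def gram (p y : N) : Matrix (Fin n) (Fin n) ℝ :=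
  Matrix.of fun i j ↦ inner ℝ
    ((trivializationAt (EuclideanSpace ℝ (Fin n)) (TangentSpace (𝓡 n)) p).symm y
      (EuclideanSpace.single i 1))
    ((trivializationAt (EuclideanSpace ℝ (Fin n)) (TangentSpace (𝓡 n)) p).symm y
      (EuclideanSpace.single j 1))

variable [MeasurableSpace N] [BorelSpace N]

variable (n) in
/-- The measure `√(det g_ij) dx¹ ⋯ dxⁿ` on the domain of the preferred chart at `p`,
extended by zero to `N`. -/
def chartVolume (p : N) : Measure N :=
  (((volume : Measure (EuclideanSpace ℝ (Fin n))).restrict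
      (chartAt (EuclideanSpace ℝ (Fin n)) p).target).withDensity
    (fun z ↦ ENNReal.ofReal
      (Real.sqrt (gram n p ((chartAt (EuclideanSpace ℝ (Fin n)) p).symm z)).det))).map
    (chartAt (EuclideanSpace ℝ (Fin n)) p).symm

variable (n N) in
/-- The Riemannian volume measure. The measures `chartVolume p` agree on overlaps of charts, so
their supremum is the measure which restricts to `chartVolume p` on each preferred chart domain. -/
def riemannianVolume : Measure N :=
  ⨆ p : N, chartVolume n p

end Connection

/-! ## Tension field, bienergy and biharmonic maps -/

section Maps

variable {m n : ℕ} {M : Type*} [TopologicalSpace M] [ChartedSpace (EuclideanSpace ℝ (Fin m)) M]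
  [IsManifold (𝓡 m) ∞ M] [RiemannianBundle (fun x : M ↦ TangentSpace (𝓡 m) x)]
  {N : Type*} [TopologicalSpace N] [ChartedSpace (EuclideanSpace ℝ (Fin n)) N]
  [IsManifold (𝓡 n) ∞ N] [RiemannianBundle (fun q : N ↦ TangentSpace (𝓡 n) q)]

/-- The second fundamental form `∇dφ(u, v) = ∇^φ_u (dφ(Y)) - dφ(∇_u Y)` of a map at a point, where
`Y` is a vector field with value `v` at this point. -/
def secondFundamentalForm (φ : M → N) (x : M) (u v : TangentSpace (𝓡 m) x) :
    TangentSpace (𝓡 n) (φ x) :=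
  covAlong φ (fun y ↦ mfderiv (𝓡 m) (𝓡 n) φ y (coordField v y)) x u
    - mfderiv (𝓡 m) (𝓡 n) φ x (leviCivita (coordField v) x u)

variable (m n) in
/-- The tension field `τ(φ) = trace ∇dφ`. -/
def tension (φ : M → N) (x : M) : TangentSpace (𝓡 n) (φ x) :=
  ∑ i, secondFundamentalForm φ x (onb m x i) (onb m x i)

variable (m n) in
/-- The bienergy `E²(φ, Ω) = (1/2) ∫_Ω |τ(φ)|²`. -/
def bienergy [MeasurableSpace M] [BorelSpace M] (φ : M → N) (Ω : Set M) : ℝ :=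
  (1 / 2) * ∫ x in Ω, ‖tension m n φ x‖ ^ 2 ∂(riemannianVolume m M)

variable (m n) in
/-- `Φ` is a smooth variation `(Φ_t)`, `|t| < ε`, of `φ` supported in `Ω`. -/
structure IsVariation (φ : M → N) (Ω : Set M) (ε : ℝ) (Φ : ℝ → M → N) : Prop where
  smooth : ContMDiffOn (𝓘(ℝ, ℝ).prod (𝓡 m)) (𝓡 n) ∞ (fun p : ℝ × M ↦ Φ p.1 p.2)
    (Ioo (-ε) ε ×ˢ univ)
  zero : Φ 0 = φ
  eq_off : ∀ t ∈ Ioo (-ε) ε, ∀ x ∉ Ω, Φ t x = φ x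

variable (m n) in
/-- A smooth map is biharmonic if it is a critical point of the bienergy on every compact set `Ω`,
with respect to all smooth variations supported in `Ω`. -/
def IsBiharmonic [MeasurableSpace M] [BorelSpace M] (φ : M → N) : Prop :=
  ContMDiff (𝓡 m) (𝓡 n) ∞ φ ∧
    ∀ Ω : Set M, IsCompact Ω → ∀ ε > 0, ∀ Φ : ℝ → M → N, IsVariation m n φ Ω ε Φ →
      HasDerivAt (fun t ↦ bienergy m n (Φ t) Ω) 0 0

variable (m n) in
/-- Smooth isometric immersions. (Preserving inner products, the differential is injective.) -/
structure IsIsometricImmersion (φ : M → N) : Prop where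
  smooth : ContMDiff (𝓡 m) (𝓡 n) ∞ φ
  inner_eq : ∀ (x : M) (u v : TangentSpace (𝓡 m) x),
    inner ℝ (mfderiv (𝓡 m) (𝓡 n) φ x u) (mfderiv (𝓡 m) (𝓡 n) φ x v) = inner ℝ u v

variable (m) in
/-- The mean curvature vector `η = (1/m) trace B` of an isometric immersion, where `B = ∇dφ`. -/
def meanCurvatureVector (φ : M → N) (x : M) : TangentSpace (𝓡 n) (φ x) :=
  (1 / (m : ℝ)) • ∑ i, secondFundamentalForm φ x (onb m x i) (onb m x i)

/-- The tangential part `Z^⊤` of `Z ∈ T_{φ x} N` for an isometric immersion, seen in `T_x M`: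
`⟨Z^⊤, u⟩ = ⟨Z, dφ(u)⟩` for all `u ∈ T_x M`. -/
def tangentialPart (φ : M → N) (x : M) (Z : TangentSpace (𝓡 n) (φ x)) : TangentSpace (𝓡 m) x :=
  ContinuousLinearMap.adjoint (mfderiv (𝓡 m) (𝓡 n) φ x) Z

/-- The shape operator with respect to the unit normal field `ξ`: `⟨A u, v⟩ = -⟨∇^φ_u ξ, dφ(v)⟩`. -/
def shapeOperator (φ : M → N) (ξ : Π x : M, TangentSpace (𝓡 n) (φ x)) (x : M)
    (u : TangentSpace (𝓡 m) x) : TangentSpace (𝓡 m) x :=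
  -tangentialPart φ x (covAlong φ ξ x u)

variable (m) in
/-- `|A|² = ∑_{i, j} ⟨A e_i, e_j⟩²`. -/
def shapeNormSq (φ : M → N) (ξ : Π x : M, TangentSpace (𝓡 n) (φ x)) (x : M) : ℝ :=
  ∑ i, ∑ j, (inner ℝ (shapeOperator φ ξ x (onb m x i)) (onb m x j)) ^ 2

variable (m) in
/-- On the open set `U ⊆ M`, `ξ` is a smooth unit normal vector field along `φ`, and `H` is the mean
curvature function with respect to `ξ`, i.e. `η = H ξ`. (Values off `U` play no role.) -/
structure IsNormalWithMeanCurvature (φ : M → N) (U : Set M)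
    (ξ : Π x : M, TangentSpace (𝓡 n) (φ x)) (H : M → ℝ) : Prop where
  isOpen : IsOpen U
  smooth : ContMDiffOn (𝓡 m) (𝓡 n).tangent ∞
    (fun x ↦ (⟨φ x, ξ x⟩ : TangentBundle (𝓡 n) N)) U
  norm_eq_one : ∀ x ∈ U, ‖ξ x‖ = 1
  normal : ∀ x ∈ U, ∀ u : TangentSpace (𝓡 m) x, inner ℝ (mfderiv (𝓡 m) (𝓡 n) φ x u) (ξ x) = 0
  meanCurvature : ∀ x ∈ U, meanCurvatureVector m φ x = H x • ξ x

variable (m) in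
/-- The two equations at the point `x`:
`ΔH - H |A|² + H Ric(ξ, ξ) = 0` and `2 A(grad H) + (m/2) grad H² - 2 H (Ric(ξ))^⊤ = 0`. -/
def HypersurfaceEquations (φ : M → N) (ξ : Π x : M, TangentSpace (𝓡 n) (φ x)) (H : M → ℝ)
    (x : M) : Prop :=
  laplacian m H x - H x * shapeNormSq m φ ξ x + H x * ricci (φ x) (ξ x) (ξ x) = 0 ∧
  (2 : ℝ) • shapeOperator φ ξ x (grad m H x) + ((m : ℝ) / 2) • grad m (fun y ↦ H y ^ 2) x
    - (2 * H x) • tangentialPart φ x (ricciOp (φ x) (ξ x)) = 0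

end Maps

end Biharmonic

end

/-! Let $J V=\operatorname{tr}\nabla^2V+\operatorname{tr}R^N(V,d\varphi)d\varphi$ be the Jacobi
operator of the energy (`jac`). The proof shows that biharmonicity is the pointwise equation
$J\tau=0$, and that on a hypersurface, where $\tau=mH\xi$, the equations $(*)$ are the normal and
the tangential component of $J\tau=0$, up to the factors $m$ and $-m$. Since $J\tau=0$ is local and
unit normals exist locally, both equivalences follow.

First variation. Torsion-freeness and the commutation of covariant derivatives give
$\nabla_t\tau=JV$ for the variation field $V$, hence $\frac12\partial_t|\tau|^2=\langle
JV,\tau\rangle$ (`hasDerivAt_tension_sq`). The operator $J$ is formally self-adjoint: $\langle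
JV,\tau\rangle-\langle V,J\tau\rangle$ is the divergence of the one-form
$u\mapsto\langle\nabla_uV,\tau\rangle-\langle V,\nabla_u\tau\rangle$ (`jac_sub_jac`). No global
divergence theorem is used. The integrand is multiplied by a cutoff $\rho$ supported in a chart, and
Euclidean integration by parts (`integral_mul_divForm`) leaves as remainder the integral of this
one-form on $\operatorname{grad}\rho$. If $J\tau=0$, a partition of unity makes the remainders
cancel, because its gradients add up to zero (`isBiharmonic_of_jac_eq_zero`). Conversely, take
$V=\beta J\tau$ for a bump $\beta$ and $\rho=1$ near its support: the remainder vanishes, and so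
does $\int\beta|J\tau|^2$, which forces $J\tau=0$ at the centre (`jac_eq_zero_of_isBiharmonic`).

Components. The product rule `jac_smul` reads $J(K\xi)=(\Delta
K)\xi+2\nabla_{\operatorname{grad}K}\xi+KJ\xi$. Differentiating $\langle\xi,\xi\rangle=1$ twice
shows that the normal part of $J\xi$ is $-|A|^2+\mathrm{Ric}(\xi,\xi)$. The tangential part of
$\operatorname{tr}\nabla^2\xi$ comes from the traced Codazzi equation: it is minus the gradient of
the mean curvature $K=mH$ plus a Ricci term, so that the Ricci term of $J$ is doubled
(`IsLocalHypersurface.inner_jac_normal`, `IsLocalHypersurface.inner_jac_tangent`,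
`IsNormalWithMeanCurvature.hypersurfaceEquations_iff`).

Coordinates. All computations are done for metrics on open subsets of vector spaces. The intrinsic
definitions use the preferred chart at the point in question, so that passing to one fixed chart
requires the transformation laws of connection and curvature. These hold because an isometry with
surjective differential has vanishing second fundamental form (`sff_eq_zero`, `cov_transform`,
`curv_transform`, `triv_covAlong`). -/

noncomputable section

set_option maxSynthPendingDepth 3
set_option synthInstance.maxHeartbeats 200000
set_option linter.unusedSectionVars false

namespace Biharmonic

/-! ## Riemannian metrics on open subsets of vector spaces -/

section LocalMetric

variable {F : Type*} [NormedAddCommGroup F] [NormedSpace ℝ F]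

/-- `h` is a smooth Riemannian metric on the open set `W`. -/
structure IsMetricOn (h : F → F →L[ℝ] F →L[ℝ] ℝ) (W : Set F) : Prop where
  isOpen : IsOpen W
  smooth : ContDiffOn ℝ ∞ h W
  symm : ∀ z ∈ W, ∀ a b, h z a b = h z b a
  pos : ∀ z ∈ W, ∀ a, a ≠ 0 → 0 < h z a a

/-- The vector dual to a linear form. -/
def sharp (h : F → F →L[ℝ] F →L[ℝ] ℝ) (z : F) : (F →L[ℝ] ℝ) →L[ℝ] F := (h z).inverse

/-- The lowered Christoffel symbol. -/
def koszul (h : F → F →L[ℝ] F →L[ℝ] ℝ) (z : F) : F →L[ℝ] F →L[ℝ] F →L[ℝ] ℝ :=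
  (2⁻¹ : ℝ) • (fderiv ℝ h z + (fderiv ℝ h z).flip
    - ((ContinuousLinearMap.flipₗᵢ ℝ F F ℝ : (F →L[ℝ] F →L[ℝ] ℝ) →L[ℝ] (F →L[ℝ] F →L[ℝ] ℝ)) ∘L
        (fderiv ℝ h z).flip))

/-- The Christoffel symbol of a metric. -/
def gam (h : F → F →L[ℝ] F →L[ℝ] ℝ) (z : F) : F →L[ℝ] F →L[ℝ] F :=
  (ContinuousLinearMap.compL ℝ F (F →L[ℝ] ℝ) F (sharp h z)) ∘L koszul h z

theorem koszul_apply (h : F → F →L[ℝ] F →L[ℝ] ℝ) (z a b c : F) :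
    koszul h z a b c
      = (fderiv ℝ h z a b c + fderiv ℝ h z b a c - fderiv ℝ h z c a b) / 2 := by
  simp only [koszul, smul_apply, sub_apply,
    add_apply, ContinuousLinearMap.flip_apply,
    ContinuousLinearMap.comp_apply, smul_eq_mul]
  change 2⁻¹ * (_ + _ - ((fderiv ℝ h z).flip a).flip b c) = _
  simp only [ContinuousLinearMap.flip_apply]
  ring

theorem gam_apply (h : F → F →L[ℝ] F →L[ℝ] ℝ) (z a b : F) :
    gam h z a b = sharp h z (koszul h z a b) := rfl

variable {h : F → F →L[ℝ] F →L[ℝ] ℝ} {W : Set F}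

theorem IsMetricOn.eq_of_forall (hh : IsMetricOn h W) {z : F} (hz : z ∈ W) {a b : F}
    (H : ∀ c, h z a c = h z b c) : a = b := by
  by_contra hne
  have := hh.pos z hz (a - b) (sub_ne_zero.2 hne)
  simp [map_sub, H] at this

variable [FiniteDimensional ℝ F]

theorem IsMetricOn.isInvertible (hh : IsMetricOn h W) {z : F} (hz : z ∈ W) :
    (h z).IsInvertible := by
  have hinj : Function.Injective (h z : F →ₗ[ℝ] (F →L[ℝ] ℝ)) := by
    intro a b hab
    exact hh.eq_of_forall hz fun c ↦ by
      have : h z a = h z b := hab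
      rw [this]
  have hdim : Module.finrank ℝ F = Module.finrank ℝ (F →L[ℝ] ℝ) := by
    rw [← (LinearMap.toContinuousLinearMap : (F →ₗ[ℝ] ℝ) ≃ₗ[ℝ] (F →L[ℝ] ℝ)).finrank_eq]
    exact (Subspace.dual_finrank_eq (K := ℝ) (V := F)).symm
  refine ⟨(LinearEquiv.ofInjectiveOfFinrankEq (h z : F →ₗ[ℝ] (F →L[ℝ] ℝ)) hinj
    hdim).toContinuousLinearEquiv, ?_⟩
  ext a b
  rfl

theorem IsMetricOn.sharp_spec (hh : IsMetricOn h W) {z : F} (hz : z ∈ W) (α : F →L[ℝ] ℝ) :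
    h z (sharp h z α) = α := by
  obtain ⟨e, he⟩ := hh.isInvertible hz
  rw [sharp, ← he, ContinuousLinearMap.inverse_equiv]
  simp

/-- Inversion of operators is smooth at invertible ones, and positivity makes `h z` injective
between spaces of equal dimension. -/
theorem IsMetricOn.contDiffOn_sharp (hh : IsMetricOn h W) : ContDiffOn ℝ ∞ (sharp h) W := by
  intro z hz
  obtain ⟨e, he⟩ := hh.isInvertible hz
  have h1 : ContDiffAt ℝ ∞ (ContinuousLinearMap.inverse : (F →L[ℝ] F →L[ℝ] ℝ) → _) (h z) := by
    rw [← he]; exact contDiffAt_map_inverse e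
  exact h1.comp_contDiffWithinAt z (hh.smooth z hz)

theorem IsMetricOn.contDiffOn_fderiv (hh : IsMetricOn h W) :
    ContDiffOn ℝ ∞ (fderiv ℝ h) W :=
  hh.smooth.fderiv_of_isOpen hh.isOpen (by simp)

theorem IsMetricOn.contDiffOn_gam (hh : IsMetricOn h W) : ContDiffOn ℝ ∞ (gam h) W := by
  have h1 := hh.contDiffOn_fderiv
  have h2 : ContDiffOn ℝ ∞ (fun z ↦ (fderiv ℝ h z).flip) W :=
    (ContinuousLinearMap.flipₗᵢ ℝ F F (F →L[ℝ] ℝ)).toContinuousLinearEquiv.contDiff.comp_contDiffOn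
      h1
  have h3 : ContDiffOn ℝ ∞ (koszul h) W :=
    ((h1.add h2).sub (contDiffOn_const.clm_comp h2)).const_smul _
  exact ((ContinuousLinearMap.compL ℝ F (F →L[ℝ] ℝ) F).contDiff.comp_contDiffOn
    hh.contDiffOn_sharp).clm_comp h3

theorem IsMetricOn.fderiv_symm (hh : IsMetricOn h W) {z : F} (hz : z ∈ W) (c a b : F) :
    fderiv ℝ h z c a b = fderiv ℝ h z c b a := by
  have hd : DifferentiableAt ℝ h z :=
    (hh.smooth.contDiffAt (hh.isOpen.mem_nhds hz)).differentiableAt (by simp)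
  have e1 : ∀ a b, HasFDerivAt (fun y ↦ h y a b)
      (((fderiv ℝ h z).flip a).flip b) z := by
    intro a b
    have := (hd.hasFDerivAt.clm_apply (hasFDerivAt_const a z)).clm_apply (hasFDerivAt_const b z)
    refine this.congr_fderiv ?_
    ext; simp
  have e2 : (fun y ↦ h y a b) =ᶠ[𝓝 z] fun y ↦ h y b a := by
    filter_upwards [hh.isOpen.mem_nhds hz] with y hy using hh.symm y hy a b
  have := (e1 b a).unique ((e1 a b).congr_of_eventuallyEq e2.symm)
  have := congrArg (fun L ↦ L c) this
  simpa using this.symm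

theorem IsMetricOn.gam_spec (hh : IsMetricOn h W) {z : F} (hz : z ∈ W) (a b c : F) :
    h z (gam h z a b) c
      = (fderiv ℝ h z a b c + fderiv ℝ h z b a c - fderiv ℝ h z c a b) / 2 := by
  rw [gam_apply, hh.sharp_spec hz, koszul_apply]

theorem IsMetricOn.gam_symm (hh : IsMetricOn h W) {z : F} (hz : z ∈ W) (a b : F) :
    gam h z a b = gam h z b a := by
  refine hh.eq_of_forall hz fun c ↦ ?_
  rw [hh.gam_spec hz, hh.gam_spec hz, hh.fderiv_symm hz c a b]
  ring

/-- Compatibility of the connection with the metric: in the sum of the two Koszul formulas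
everything but $\partial_c h(a,b)$ cancels. -/
theorem IsMetricOn.fderiv_eq_gam (hh : IsMetricOn h W) {z : F} (hz : z ∈ W) (c a b : F) :
    fderiv ℝ h z c a b = h z (gam h z c a) b + h z a (gam h z c b) := by
  rw [hh.symm z hz a, hh.gam_spec hz, hh.gam_spec hz, hh.fderiv_symm hz c b a,
    hh.fderiv_symm hz b c a, hh.fderiv_symm hz a c b]
  ring

/-- The curvature of a metric in coordinates. -/
def curv (h : F → F →L[ℝ] F →L[ℝ] ℝ) (z a b c : F) : F :=
  fderiv ℝ (gam h) z a b c - fderiv ℝ (gam h) z b a c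
    + gam h z a (gam h z b c) - gam h z b (gam h z a c)

end LocalMetric

/-! ## Covariant derivatives along maps between vector spaces -/

section LocalCov

variable {X F G : Type*} [NormedAddCommGroup X] [NormedSpace ℝ X]
  [NormedAddCommGroup F] [NormedSpace ℝ F] [NormedAddCommGroup G] [NormedSpace ℝ G]

/-- The covariant derivative of the vector field `V` along `f`. -/
def cov (h : F → F →L[ℝ] F →L[ℝ] ℝ) (f V : X → F) (x u : X) : F :=
  fderiv ℝ V x u + gam h (f x) (fderiv ℝ f x u) (V x)

theorem contDiffOn_fderiv_apply {O : Set X} (hO : IsOpen O) {f : X → G} (hf : ContDiffOn ℝ ∞ f O)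
    {u : X → X} (hu : ContDiffOn ℝ ∞ u O) : ContDiffOn ℝ ∞ (fun x ↦ fderiv ℝ f x (u x)) O :=
  (hf.fderiv_of_isOpen hO (by simp)).clm_apply hu

theorem differentiableAt_of_contDiffOn {O : Set X} (hO : IsOpen O) {f : X → G}
    (hf : ContDiffOn ℝ ∞ f O) {x : X} (hx : x ∈ O) : DifferentiableAt ℝ f x :=
  (hf.contDiffAt (hO.mem_nhds hx)).differentiableAt (by simp)

theorem fderiv_congr_of_eqOn {O : Set X} (hO : IsOpen O) {f f' : X → G}
    (H : EqOn f f' O) {x : X} (hx : x ∈ O) : fderiv ℝ f x = fderiv ℝ f' x :=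
  (H.eventuallyEq_of_mem (hO.mem_nhds hx)).fderiv_eq

theorem fderiv_apply_const_comm {O : Set X} (hO : IsOpen O) {f : X → G} (hf : ContDiffOn ℝ ∞ f O)
    {x : X} (hx : x ∈ O) (u v : X) :
    fderiv ℝ (fun y ↦ fderiv ℝ f y v) x u = fderiv ℝ (fun y ↦ fderiv ℝ f y u) x v := by
  have hd : DifferentiableAt ℝ (fderiv ℝ f) x :=
    differentiableAt_of_contDiffOn hO (hf.fderiv_of_isOpen hO (by simp)) hx
  have hs : IsSymmSndFDerivAt ℝ f x :=
    (hf.contDiffAt (hO.mem_nhds hx)).isSymmSndFDerivAt (by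
      rw [minSmoothness_of_isRCLikeNormedField]
      exact WithTop.coe_le_coe.2 (mod_cast le_top))
  have e : ∀ u v, fderiv ℝ (fun y ↦ fderiv ℝ f y v) x u = fderiv ℝ (fderiv ℝ f) x u v := by
    intro u v
    rw [fderiv_clm_apply hd (differentiableAt_const _)]
    simp
  rw [e, e, hs.eq]

variable {h : F → F →L[ℝ] F →L[ℝ] ℝ} {W : Set F} {f V Z : X → F} {O : Set X}

theorem cov_congr (hO : IsOpen O) {V Z : X → F} (H : EqOn V Z O) {x : X} (hx : x ∈ O) (u : X) :
    cov h f V x u = cov h f Z x u := by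
  rw [cov, cov, fderiv_congr_of_eqOn hO H hx, H hx]

theorem cov_add_right (V : X → F) (x u v : X) :
    cov h f V x (u + v) = cov h f V x u + cov h f V x v := by
  simp only [cov, map_add, add_apply]; abel

theorem cov_smul_right (V : X → F) (x u : X) (c : ℝ) :
    cov h f V x (c • u) = c • cov h f V x u := by
  simp only [cov, map_smul, smul_apply, smul_add]

theorem cov_zero_right (V : X → F) (x : X) : cov h f V x 0 = 0 := by
  simpa using cov_smul_right (h := h) (f := f) V x 0 0

theorem cov_sum_right {ι : Type*} (s : Finset ι) (V : X → F) (x : X) (u : ι → X) :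
    cov h f V x (∑ i ∈ s, u i) = ∑ i ∈ s, cov h f V x (u i) := by
  simp only [cov, map_sum, sum_apply, Finset.sum_add_distrib]

theorem cov_add {x : X} (hV : DifferentiableAt ℝ V x) (hZ : DifferentiableAt ℝ Z x) (u : X) :
    cov h f (fun y ↦ V y + Z y) x u = cov h f V x u + cov h f Z x u := by
  simp only [cov, fderiv_fun_add hV hZ, map_add, add_apply]; abel

theorem cov_sub {x : X} (hV : DifferentiableAt ℝ V x) (hZ : DifferentiableAt ℝ Z x) (u : X) :
    cov h f (fun y ↦ V y - Z y) x u = cov h f V x u - cov h f Z x u := by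
  simp only [cov, fderiv_fun_sub hV hZ, map_sub, sub_apply]; abel

theorem cov_sum {ι : Type*} {s : Finset ι} {V : ι → X → F} {x : X}
    (hV : ∀ i ∈ s, DifferentiableAt ℝ (V i) x) (u : X) :
    cov h f (fun y ↦ ∑ i ∈ s, V i y) x u = ∑ i ∈ s, cov h f (V i) x u := by
  simp only [cov, fderiv_fun_sum hV, map_sum, sum_apply,
    Finset.sum_add_distrib]

theorem cov_smul {x : X} {c : X → ℝ} (hc : DifferentiableAt ℝ c x)
    (hV : DifferentiableAt ℝ V x) (u : X) :
    cov h f (fun y ↦ c y • V y) x u = fderiv ℝ c x u • V x + c x • cov h f V x u := by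
  simp only [cov, fderiv_fun_smul hc hV, map_smul, add_apply,
    smul_apply, ContinuousLinearMap.smulRight_apply, smul_add]
  abel

variable [FiniteDimensional ℝ F]

theorem contDiffOn_cov (hh : IsMetricOn h W) (hO : IsOpen O) (hf : ContDiffOn ℝ ∞ f O)
    (hm : MapsTo f O W) (hV : ContDiffOn ℝ ∞ V O) {u : X → X} (hu : ContDiffOn ℝ ∞ u O) :
    ContDiffOn ℝ ∞ (fun x ↦ cov h f V x (u x)) O :=
  (contDiffOn_fderiv_apply hO hV hu).add
    (((hh.contDiffOn_gam.comp hf hm).clm_apply (contDiffOn_fderiv_apply hO hf hu)).clm_apply hV)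

/-- The product rule for inner products of fields along a map. The derivative of the metric
coefficients supplies exactly the two Christoffel terms. -/
theorem fderiv_metric (hh : IsMetricOn h W) {x : X} (hx : f x ∈ W) (hf : DifferentiableAt ℝ f x)
    (hV : DifferentiableAt ℝ V x) (hZ : DifferentiableAt ℝ Z x) (u : X) :
    fderiv ℝ (fun y ↦ h (f y) (V y) (Z y)) x u
      = h (f x) (cov h f V x u) (Z x) + h (f x) (V x) (cov h f Z x u) := by
  have hd : DifferentiableAt ℝ h (f x) := differentiableAt_of_contDiffOn hh.isOpen hh.smooth hx
  have h1 : HasFDerivAt (fun y ↦ h (f y)) _ x := hd.hasFDerivAt.comp x hf.hasFDerivAt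
  rw [((h1.clm_apply hV.hasFDerivAt).clm_apply hZ.hasFDerivAt).fderiv]
  simp only [add_apply, ContinuousLinearMap.comp_apply,
    ContinuousLinearMap.flip_apply, hh.fderiv_eq_gam hx, cov, map_add]
  ring

/-- Torsion-freeness along a map: second derivatives commute and the Christoffel symbol is
symmetric. -/
theorem cov_fderiv_comm (hh : IsMetricOn h W) (hO : IsOpen O) (hf : ContDiffOn ℝ ∞ f O)
    (hm : MapsTo f O W) {x : X} (hx : x ∈ O) (u v : X) :
    cov h f (fun y ↦ fderiv ℝ f y v) x u = cov h f (fun y ↦ fderiv ℝ f y u) x v := by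
  rw [cov, cov, fderiv_apply_const_comm hO hf hx, hh.gam_symm (hm hx)]

/-- Second derivatives of `V` and of `f` drop out by symmetry, and the terms of first order in `V`
occur symmetrically in `u` and `v`; what remains is the curvature formula. With `f` the identity
this computes the curvature of the metric itself; with a family of maps on $\mathbb R\times E$ it
interchanges time and space derivatives. -/
theorem cov_cov_sub (hh : IsMetricOn h W) (hO : IsOpen O) (hf : ContDiffOn ℝ ∞ f O)
    (hm : MapsTo f O W) (hV : ContDiffOn ℝ ∞ V O) {x : X} (hx : x ∈ O) (u v : X) :
    cov h f (fun y ↦ cov h f V y v) x u - cov h f (fun y ↦ cov h f V y u) x v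
      = curv h (f x) (fderiv ℝ f x u) (fderiv ℝ f x v) (V x) := by
  have hfd := differentiableAt_of_contDiffOn hO hf hx
  have hVd := differentiableAt_of_contDiffOn hO hV hx
  have hgd : HasFDerivAt (fun y ↦ gam h (f y)) _ x :=
    (differentiableAt_of_contDiffOn hh.isOpen hh.contDiffOn_gam (hm hx)).hasFDerivAt.comp x
      hfd.hasFDerivAt
  have key : ∀ u v, cov h f (fun y ↦ cov h f V y v) x u
      = fderiv ℝ (fun y ↦ fderiv ℝ V y v) x u
        + (fderiv ℝ (gam h) (f x) (fderiv ℝ f x u) (fderiv ℝ f x v) (V x)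
          + gam h (f x) (fderiv ℝ (fun y ↦ fderiv ℝ f y v) x u) (V x)
          + gam h (f x) (fderiv ℝ f x v) (fderiv ℝ V x u))
        + (gam h (f x) (fderiv ℝ f x u) (fderiv ℝ V x v)
          + gam h (f x) (fderiv ℝ f x u) (gam h (f x) (fderiv ℝ f x v) (V x))) := by
    intro u v
    have h1 : DifferentiableAt ℝ (fun y ↦ fderiv ℝ V y v) x :=
      differentiableAt_of_contDiffOn hO (contDiffOn_fderiv_apply hO hV contDiffOn_const) hx
    have h2 : DifferentiableAt ℝ (fun y ↦ fderiv ℝ f y v) x :=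
      differentiableAt_of_contDiffOn hO (contDiffOn_fderiv_apply hO hf contDiffOn_const) hx
    have h3 := (hgd.clm_apply h2.hasFDerivAt).clm_apply hVd.hasFDerivAt
    conv_lhs => unfold cov
    rw [(h1.hasFDerivAt.fun_add h3).fderiv]
    simp only [add_apply, ContinuousLinearMap.comp_apply,
      ContinuousLinearMap.flip_apply, map_add]
    abel
  rw [key u v, key v u, fderiv_apply_const_comm hO hV hx u v, fderiv_apply_const_comm hO hf hx u v,
    curv]
  abel

end LocalCov

/-! ### Symmetries of the curvature tensor. -/

section Curvature

variable {F : Type*} [NormedAddCommGroup F] [NormedSpace ℝ F]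
  {h : F → F →L[ℝ] F →L[ℝ] ℝ} {W : Set F}

theorem curv_add_left (z a a' b c : F) :
    curv h z (a + a') b c = curv h z a b c + curv h z a' b c := by
  simp only [curv, map_add, add_apply]; abel

theorem curv_smul_left (z a b c : F) (r : ℝ) : curv h z (r • a) b c = r • curv h z a b c := by
  simp only [curv, map_smul, smul_apply, smul_add, smul_sub]

theorem curv_skew_left (z a b c : F) : curv h z a b c = -curv h z b a c := by
  simp only [curv]; abel

theorem curv_add_mid (z a b b' c : F) :
    curv h z a (b + b') c = curv h z a b c + curv h z a b' c := by
  simp only [curv, map_add, add_apply]; abel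

theorem curv_smul_mid (z a b c : F) (r : ℝ) : curv h z a (r • b) c = r • curv h z a b c := by
  simp only [curv, map_smul, smul_apply, smul_add, smul_sub]

theorem curv_add_right (z a b c c' : F) :
    curv h z a b (c + c') = curv h z a b c + curv h z a b c' := by
  simp only [curv, map_add]; abel

theorem curv_smul_right (z a b c : F) (r : ℝ) : curv h z a b (r • c) = r • curv h z a b c := by
  simp only [curv, map_smul, smul_add, smul_sub]

theorem curv_self (z a c : F) : curv h z a a c = 0 := by simp [curv]

variable [FiniteDimensional ℝ F]

theorem IsMetricOn.fderiv_gam_symm (hh : IsMetricOn h W) {z : F} (hz : z ∈ W) (a b c : F) :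
    fderiv ℝ (gam h) z a b c = fderiv ℝ (gam h) z a c b := by
  have hd : DifferentiableAt ℝ (gam h) z :=
    differentiableAt_of_contDiffOn hh.isOpen hh.contDiffOn_gam hz
  have e : ∀ b c, fderiv ℝ (fun y ↦ gam h y b c) z a = fderiv ℝ (gam h) z a b c := by
    intro b c
    have := (hd.hasFDerivAt.clm_apply (hasFDerivAt_const b z)).clm_apply (hasFDerivAt_const c z)
    rw [this.fderiv]
    simp
  rw [← e, ← e, fderiv_congr_of_eqOn hh.isOpen (fun y hy ↦ hh.gam_symm hy b c) hz]

theorem IsMetricOn.curv_bianchi (hh : IsMetricOn h W) {z : F} (hz : z ∈ W) (a b c : F) :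
    curv h z a b c + curv h z b c a + curv h z c a b = 0 := by
  simp only [curv]
  rw [hh.fderiv_gam_symm hz a c b, hh.fderiv_gam_symm hz b a c, hh.fderiv_gam_symm hz c b a,
    hh.gam_symm hz c b, hh.gam_symm hz a c, hh.gam_symm hz b a]
  abel

/-- The second derivatives of the function $h(c,d)$ in the directions `a` and `b` commute. Expanded
by the product rule, the products of first covariant derivatives are symmetric in `a`, `b` and
cancel, leaving $h(R(a,b)c,d)+h(c,R(a,b)d)=0$. -/
theorem IsMetricOn.curv_skew_right (hh : IsMetricOn h W) {z : F} (hz : z ∈ W) (a b c d : F) :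
    h z (curv h z a b c) d = -h z (curv h z a b d) c := by
  have hO := hh.isOpen
  have hid : ContDiffOn ℝ ∞ (fun y : F ↦ y) W := contDiffOn_id
  have hm : MapsTo (fun y : F ↦ y) W W := mapsTo_id _
  have hcon : ∀ c : F, ContDiffOn ℝ ∞ (fun _ : F ↦ c) W := fun c ↦ contDiffOn_const
  have hcov : ∀ c v : F, ContDiffOn ℝ ∞ (fun y ↦ cov h (fun y ↦ y) (fun _ ↦ c) y v) W :=
    fun c v ↦ contDiffOn_cov hh hO hid hm (hcon c) (hcon v)
  have hdf : ∀ {V : F → F}, ContDiffOn ℝ ∞ V W → ∀ {y}, y ∈ W → DifferentiableAt ℝ V y :=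
    fun hV y hy ↦ differentiableAt_of_contDiffOn hO hV hy
  have hfun : ContDiffOn ℝ ∞ (fun y ↦ h y c d) W :=
    (hh.smooth.clm_apply contDiffOn_const).clm_apply contDiffOn_const
  have first : ∀ v : F, ∀ y ∈ W, fderiv ℝ (fun y ↦ h y c d) y v
      = h y (cov h (fun y ↦ y) (fun _ ↦ c) y v) d + h y c (cov h (fun y ↦ y) (fun _ ↦ d) y v) := by
    intro v y hy
    exact fderiv_metric (f := fun y ↦ y) (V := fun _ ↦ c) (Z := fun _ ↦ d) hh hy (hdf hid hy)
      (hdf (hcon c) hy) (hdf (hcon d) hy) v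
  have second : ∀ u v : F, fderiv ℝ (fun y ↦ fderiv ℝ (fun y ↦ h y c d) y v) z u
      = (h z (cov h (fun y ↦ y) (fun y ↦ cov h (fun y ↦ y) (fun _ ↦ c) y v) z u) d
        + h z (cov h (fun y ↦ y) (fun _ ↦ c) z v) (cov h (fun y ↦ y) (fun _ ↦ d) z u))
        + (h z (cov h (fun y ↦ y) (fun _ ↦ c) z u) (cov h (fun y ↦ y) (fun _ ↦ d) z v)
        + h z c (cov h (fun y ↦ y) (fun y ↦ cov h (fun y ↦ y) (fun _ ↦ d) y v) z u)) := by
    intro u v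
    have d1 : DifferentiableAt ℝ (fun y ↦ h y (cov h (fun y ↦ y) (fun _ ↦ c) y v) d) z :=
      differentiableAt_of_contDiffOn hO ((hh.smooth.clm_apply (hcov c v)).clm_apply (hcon d)) hz
    have d2 : DifferentiableAt ℝ (fun y ↦ h y c (cov h (fun y ↦ y) (fun _ ↦ d) y v)) z :=
      differentiableAt_of_contDiffOn hO ((hh.smooth.clm_apply (hcon c)).clm_apply (hcov d v)) hz
    rw [fderiv_congr_of_eqOn hO (first v) hz, fderiv_fun_add d1 d2, add_apply,
      fderiv_metric (f := fun y ↦ y) (Z := fun _ ↦ d) hh hz (hdf hid hz)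
        (hdf (hcov c v) hz) (hdf (hcon d) hz),
      fderiv_metric (f := fun y ↦ y) (V := fun _ ↦ c) hh hz (hdf hid hz) (hdf (hcon c) hz)
        (hdf (hcov d v) hz)]
  have hc := cov_cov_sub hh hO hid hm (hcon c) hz a b
  have hd := cov_cov_sub hh hO hid hm (hcon d) hz a b
  have hs := fderiv_apply_const_comm hO hfun hz a b
  rw [second, second] at hs
  simp only [fderiv_fun_id, ContinuousLinearMap.id_apply] at hc hd
  rw [← hc, ← hd, hh.symm z hz (_ - _) c]
  simp only [map_sub, sub_apply]
  linarith

/-- The usual consequence of four Bianchi identities and the two skew symmetries. It is what makes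
the curvature term of the Jacobi operator symmetric. -/
theorem IsMetricOn.curv_pair (hh : IsMetricOn h W) {z : F} (hz : z ∈ W) (a b c d : F) :
    h z (curv h z a b c) d = h z (curv h z c d a) b := by
  have B : ∀ a b c d, h z (curv h z a b c) d + h z (curv h z b c a) d + h z (curv h z c a b) d
      = 0 := by
    intro a b c d
    have := congrArg (fun v ↦ h z v d) (hh.curv_bianchi hz a b c)
    simpa only [map_add, add_apply, map_zero, zero_apply] using this
  have S : ∀ a b c d, h z (curv h z a b c) d = -h z (curv h z a b d) c :=
    hh.curv_skew_right hz
  have K : ∀ a b c d, h z (curv h z a b c) d = -h z (curv h z b a c) d := by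
    intro a b c d
    rw [curv_skew_left, map_neg, neg_apply]
  have b1 := B a b c d
  have b2 := B b c d a
  have b3 := B c d a b
  have b4 := B d a b c
  have := S a b c d
  have := S b c a d
  have := S c a b d
  have := S b c d a
  have := S c d b a
  have := S d b c a
  have := S c d a b
  have := S d a c b
  have := S a c d b
  have := S d a b c
  have := S a b d c
  have := S b d a c
  have := K a c d b
  have := K d b c a
  have := K d b a c
  have := K d a b c
  have := K b c a d
  have := K c a b d
  linarith [K a d b c, K b d a c, K b d c a, K c a d b, K a c b d]

end Curvature

/-! ## Traces -/

section Trace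

/-- The trace of a bilinear map in a pair of dual frames agrees with the trace in an orthonormal
frame. -/
theorem sum_dualFrame_eq {V G ι κ : Type*} [AddCommGroup V] [Module ℝ V] [AddCommGroup G]
    [Module ℝ G] [Fintype ι] [Fintype κ] (Q : V → V → ℝ) (hQ : ∀ v w, Q v w = Q w v)
    {a b : ι → V} {c : κ → V} (hab : ∀ v, v = ∑ i, Q v (b i) • a i)
    (hc : ∀ v, v = ∑ k, Q v (c k) • c k) (B : V →ₗ[ℝ] V →ₗ[ℝ] G) :
    ∑ i, B (a i) (b i) = ∑ k, B (c k) (c k) := by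
  -- Both traces are expanded into the double sum of `Q (b i) (c k) • B (a i) (c k)`.
  have h1 : ∀ i, B (a i) (b i) = ∑ k, Q (b i) (c k) • B (a i) (c k) := by
    intro i
    conv_lhs => rw [hc (b i)]
    simp
  have h2 : ∀ k, B (c k) (c k) = ∑ i, Q (b i) (c k) • B (a i) (c k) := by
    intro k
    have := congrArg (fun v ↦ B v (c k)) (hab (c k))
    simp only [map_sum, LinearMap.sum_apply, map_smul, LinearMap.smul_apply] at this
    exact this.trans (Finset.sum_congr rfl fun i _ ↦ by rw [hQ])
  simp_rw [h1, h2]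
  exact Finset.sum_comm

variable {E F ι : Type*} [NormedAddCommGroup E] [NormedSpace ℝ E] [FiniteDimensional ℝ E]
  [NormedAddCommGroup F] [NormedSpace ℝ F] [Fintype ι]
  {g : E → E →L[ℝ] E →L[ℝ] ℝ} {O : Set E}

/-- The frame dual to a basis with respect to a metric. -/
def dualVec (g : E → E →L[ℝ] E →L[ℝ] ℝ) (b : Module.Basis ι ℝ E) (i : ι) (z : E) : E :=
  sharp g z (LinearMap.toContinuousLinearMap (b.coord i))

variable {b : Module.Basis ι ℝ E}

theorem IsMetricOn.dualVec_left (hg : IsMetricOn g O) {z : E} (hz : z ∈ O) (i : ι) (v : E) :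
    g z (dualVec g b i z) v = b.repr v i := by
  rw [dualVec, hg.sharp_spec hz]; rfl

theorem IsMetricOn.dualVec_right (hg : IsMetricOn g O) {z : E} (hz : z ∈ O) (i : ι) (v : E) :
    g z v (dualVec g b i z) = b.repr v i := by
  rw [hg.symm z hz, hg.dualVec_left hz]

theorem IsMetricOn.sum_dualVec_smul (hg : IsMetricOn g O) {z : E} (hz : z ∈ O) (v : E) :
    ∑ i, g z v (dualVec g b i z) • b i = v := by
  simp_rw [hg.dualVec_right hz]; exact b.sum_repr v

theorem IsMetricOn.sum_smul_dualVec (hg : IsMetricOn g O) {z : E} (hz : z ∈ O) (v : E) :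
    ∑ i, g z v (b i) • dualVec g b i z = v := by
  refine hg.eq_of_forall hz fun c ↦ ?_
  simp only [map_sum, map_smul, sum_apply, smul_apply, hg.dualVec_left hz, smul_eq_mul]
  conv_rhs => rw [← b.sum_repr c]
  simp only [map_sum, map_smul, smul_eq_mul, mul_comm]

theorem IsMetricOn.contDiffOn_dualVec (hg : IsMetricOn g O) (i : ι) :
    ContDiffOn ℝ ∞ (dualVec g b i) O :=
  hg.contDiffOn_sharp.clm_apply contDiffOn_const

/-- `B` need not be symmetric: $\sum_i\theta_i\otimes b_i$ is itself symmetric, being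
$\sum_{i,j}g(\theta_i,\theta_j)\,b_j\otimes b_i$. -/
theorem IsMetricOn.sum_comm_dualVec (hg : IsMetricOn g O) {z : E} (hz : z ∈ O)
    (B : E →ₗ[ℝ] E →ₗ[ℝ] F) :
    ∑ i, B (dualVec g b i z) (b i) = ∑ i, B (b i) (dualVec g b i z) := by
  have h1 : ∀ i, B (dualVec g b i z) (b i)
      = ∑ j, g z (dualVec g b i z) (dualVec g b j z) • B (b j) (b i) := by
    intro i
    conv_lhs => rw [← hg.sum_dualVec_smul (b := b) hz (dualVec g b i z)]
    simp
  have h2 : ∀ j, B (b j) (dualVec g b j z)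
      = ∑ i, g z (dualVec g b i z) (dualVec g b j z) • B (b j) (b i) := by
    intro j
    conv_lhs => rw [← hg.sum_dualVec_smul (b := b) hz (dualVec g b j z)]
    simp only [map_sum, map_smul]
    exact Finset.sum_congr rfl fun i _ ↦ by rw [hg.symm z hz (dualVec g b j z)]
  simp_rw [h1, h2]
  exact Finset.sum_comm

theorem cov_const (h : F → F →L[ℝ] F →L[ℝ] ℝ) (c z a : F) :
    cov h (fun y ↦ y) (fun _ ↦ c) z a = gam h z a c := by
  simp [cov]

/-- Differentiate the constant function $g(\theta_i,c)$. -/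
theorem IsMetricOn.cov_dualVec (hg : IsMetricOn g O) {z : E} (hz : z ∈ O) (i : ι) (k c : E) :
    g z (cov g (fun y ↦ y) (dualVec g b i) z k) c = -g z (dualVec g b i z) (gam g z k c) := by
  have h1 := fderiv_metric (f := fun y ↦ y) (V := dualVec g b i) (Z := fun _ ↦ c) hg hz
    differentiableAt_id
    (differentiableAt_of_contDiffOn hg.isOpen (hg.contDiffOn_dualVec i) hz)
    (differentiableAt_const c) k
  rw [fderiv_congr_of_eqOn hg.isOpen (fun y hy ↦ hg.dualVec_left hy i c) hz, cov_const] at h1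
  simp at h1
  linarith

/-- This says that the tensor $\sum_i b_i\otimes\theta_i$ is parallel, since
$\nabla_kb_i=\Gamma(k,b_i)$. Hence metric traces commute with covariant differentiation. -/
theorem IsMetricOn.sum_cov_dualVec (hg : IsMetricOn g O) {z : E} (hz : z ∈ O) (k : E)
    (B : E →ₗ[ℝ] E →ₗ[ℝ] F) :
    ∑ i, B (b i) (cov g (fun y ↦ y) (dualVec g b i) z k)
      = -∑ i, B (gam g z k (b i)) (dualVec g b i z) := by
  have h1 : ∀ i, B (b i) (cov g (fun y ↦ y) (dualVec g b i) z k)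
      = -∑ j, g z (dualVec g b i z) (gam g z k (b j)) • B (b i) (dualVec g b j z) := by
    intro i
    conv_lhs => rw [← hg.sum_smul_dualVec (b := b) hz (cov g (fun y ↦ y) (dualVec g b i) z k)]
    simp only [hg.cov_dualVec hz, neg_smul, Finset.sum_neg_distrib, map_neg, map_sum, map_smul]
  have h2 : ∀ j, B (gam g z k (b j)) (dualVec g b j z)
      = ∑ i, g z (dualVec g b i z) (gam g z k (b j)) • B (b i) (dualVec g b j z) := by
    intro j
    conv_lhs => rw [← hg.sum_dualVec_smul (b := b) hz (gam g z k (b j))]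
    simp only [map_sum, map_smul, LinearMap.sum_apply, LinearMap.smul_apply]
    exact Finset.sum_congr rfl fun i _ ↦ by rw [hg.symm z hz (dualVec g b i z)]
  simp_rw [h1, h2, Finset.sum_neg_distrib]
  rw [Finset.sum_comm]

/-- The coefficients on the right are the logarithmic derivatives of the volume density, so this
term cancels the derivative of the density in the divergence formula. -/
theorem IsMetricOn.sum_cov_dualVec_self (hg : IsMetricOn g O) {z : E} (hz : z ∈ O) :
    ∑ i, cov g (fun y ↦ y) (dualVec g b i) z (b i)
      = -∑ j, (∑ i, g z (dualVec g b i z) (gam g z (b j) (b i))) • dualVec g b j z := by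
  refine hg.eq_of_forall hz fun c ↦ ?_
  simp only [map_sum, map_neg, map_smul, sum_apply, neg_apply, smul_apply, hg.cov_dualVec hz,
    hg.dualVec_left hz, Finset.sum_neg_distrib, smul_eq_mul]
  congr 1
  conv_lhs => rw [← b.sum_repr c]
  simp only [map_sum, map_smul, Finset.sum_mul, Finsupp.coe_finsetSum, Finset.sum_apply,
    Finsupp.smul_apply, smul_eq_mul]
  rw [Finset.sum_comm]
  refine Finset.sum_congr rfl fun j _ ↦ Finset.sum_congr rfl fun i _ ↦ ?_
  rw [hg.gam_symm hz (b i), mul_comm]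

end Trace

/-! ## One-forms along maps, second fundamental form and the Codazzi equation -/

section Forms

variable {E F : Type*} [NormedAddCommGroup E] [NormedSpace ℝ E] [FiniteDimensional ℝ E]
  [NormedAddCommGroup F] [NormedSpace ℝ F] [FiniteDimensional ℝ F]
  {g : E → E →L[ℝ] E →L[ℝ] ℝ} {O : Set E} {h : F → F →L[ℝ] F →L[ℝ] ℝ} {W : Set F} {f : E → F}

/-- The covariant derivative of a one-form `A` with values in the vector fields along `f`. -/
def covForm (g : E → E →L[ℝ] E →L[ℝ] ℝ) (h : F → F →L[ℝ] F →L[ℝ] ℝ) (f : E → F)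
    (A : E → E →L[ℝ] F) (z : E) : E →L[ℝ] E →L[ℝ] F :=
  fderiv ℝ A z
    + (((ContinuousLinearMap.compL ℝ E F F).flip (A z)) ∘L gam h (f z) ∘L fderiv ℝ f z
      - (ContinuousLinearMap.compL ℝ E E F (A z)) ∘L gam g z)

theorem covForm_apply (A : E → E →L[ℝ] F) (z a b : E) :
    covForm g h f A z a b = fderiv ℝ A z a b
      + (gam h (f z) (fderiv ℝ f z a) (A z b) - A z (gam g z a b)) := rfl

theorem contDiffOn_covForm (hg : IsMetricOn g O) (hh : IsMetricOn h W) (hf : ContDiffOn ℝ ∞ f O)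
    (hm : MapsTo f O W) {A : E → E →L[ℝ] F} (hA : ContDiffOn ℝ ∞ A O) :
    ContDiffOn ℝ ∞ (covForm g h f A) O := by
  have h1 : ContDiffOn ℝ ∞ (fderiv ℝ A) O := hA.fderiv_of_isOpen hg.isOpen (by simp)
  have h2 : ContDiffOn ℝ ∞ (fderiv ℝ f) O := hf.fderiv_of_isOpen hg.isOpen (by simp)
  have h3 : ContDiffOn ℝ ∞ (fun z ↦ gam h (f z)) O := hh.contDiffOn_gam.comp hf hm
  exact h1.add ((((ContinuousLinearMap.compL ℝ E F F).flip.contDiff.comp_contDiffOn hA).clm_comp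
    (h3.clm_comp h2)).sub (((ContinuousLinearMap.compL ℝ E E F).contDiff.comp_contDiffOn
      hA).clm_comp hg.contDiffOn_gam))

theorem cov_apply_form {A : E → E →L[ℝ] F} {Y : E → E} {z : E} (hA : DifferentiableAt ℝ A z)
    (hY : DifferentiableAt ℝ Y z) (a : E) :
    cov h f (fun y ↦ A y (Y y)) z a
      = covForm g h f A z a (Y z) + A z (cov g (fun y ↦ y) Y z a) := by
  rw [cov, (hA.hasFDerivAt.clm_apply hY.hasFDerivAt).fderiv, covForm_apply]
  simp only [cov, add_apply, ContinuousLinearMap.comp_apply, ContinuousLinearMap.flip_apply,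
    map_add, fderiv_fun_id, ContinuousLinearMap.id_apply]
  abel

theorem cov_apply_form_const {A : E → E →L[ℝ] F} {z : E} (hA : DifferentiableAt ℝ A z) (a b : E) :
    cov h f (fun y ↦ A y b) z a = covForm g h f A z a b + A z (gam g z a b) := by
  rw [cov_apply_form (g := g) (Y := fun _ ↦ b) hA (differentiableAt_const b), cov_const]

/-- The covariant differential of a vector field along `f`. -/
def covL (h : F → F →L[ℝ] F →L[ℝ] ℝ) (f V : E → F) (z : E) : E →L[ℝ] F :=
  fderiv ℝ V z + ((gam h (f z)).flip (V z)) ∘L fderiv ℝ f z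

theorem covL_apply (V : E → F) (z u : E) : covL h f V z u = cov h f V z u := rfl

theorem contDiffOn_covL (hh : IsMetricOn h W) (hO : IsOpen O) (hf : ContDiffOn ℝ ∞ f O)
    (hm : MapsTo f O W) {V : E → F} (hV : ContDiffOn ℝ ∞ V O) :
    ContDiffOn ℝ ∞ (covL h f V) O := by
  have h1 : ContDiffOn ℝ ∞ (fderiv ℝ V) O := hV.fderiv_of_isOpen hO (by simp)
  have h2 : ContDiffOn ℝ ∞ (fderiv ℝ f) O := hf.fderiv_of_isOpen hO (by simp)
  have h3 : ContDiffOn ℝ ∞ (fun z ↦ (gam h (f z)).flip) O :=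
    (ContinuousLinearMap.flipₗᵢ ℝ F F F).toContinuousLinearEquiv.contDiff.comp_contDiffOn
      (hh.contDiffOn_gam.comp hf hm)
  exact h1.add ((h3.clm_apply hV).clm_comp h2)

/-- The second fundamental form of `f` in coordinates. -/
def sff (g : E → E →L[ℝ] E →L[ℝ] ℝ) (h : F → F →L[ℝ] F →L[ℝ] ℝ) (f : E → F) (z : E) :
    E →L[ℝ] E →L[ℝ] F :=
  covForm g h f (fderiv ℝ f) z

theorem contDiffOn_sff (hg : IsMetricOn g O) (hh : IsMetricOn h W) (hf : ContDiffOn ℝ ∞ f O)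
    (hm : MapsTo f O W) : ContDiffOn ℝ ∞ (sff g h f) O :=
  contDiffOn_covForm hg hh hf hm (hf.fderiv_of_isOpen hg.isOpen (by simp))

theorem cov_pushforward (hO : IsOpen O) (hf : ContDiffOn ℝ ∞ f O) {Y : E → E} {z : E}
    (hz : z ∈ O) (hY : DifferentiableAt ℝ Y z) (a : E) :
    cov h f (fun y ↦ fderiv ℝ f y (Y y)) z a
      = sff g h f z a (Y z) + fderiv ℝ f z (cov g (fun y ↦ y) Y z a) :=
  cov_apply_form (differentiableAt_of_contDiffOn hO (hf.fderiv_of_isOpen hO (by simp)) hz) hY a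

theorem cov_pushforward_const (hO : IsOpen O) (hf : ContDiffOn ℝ ∞ f O) {z : E}
    (hz : z ∈ O) (a b : E) :
    cov h f (fun y ↦ fderiv ℝ f y b) z a = sff g h f z a b + fderiv ℝ f z (gam g z a b) :=
  cov_apply_form_const (differentiableAt_of_contDiffOn hO (hf.fderiv_of_isOpen hO (by simp)) hz) a b

theorem sff_symm (hg : IsMetricOn g O) (hh : IsMetricOn h W) (hf : ContDiffOn ℝ ∞ f O)
    (hm : MapsTo f O W) {z : E} (hz : z ∈ O) (a b : E) : sff g h f z a b = sff g h f z b a := by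
  have h1 := cov_pushforward_const (g := g) (h := h) hg.isOpen hf hz a b
  have h2 := cov_pushforward_const (g := g) (h := h) hg.isOpen hf hz b a
  rw [cov_fderiv_comm hh hg.isOpen hf hm hz, h2, hg.gam_symm hz] at h1
  exact (add_right_cancel h1).symm

/-- Differentiating `hiso` expresses the derivative of `g` through inner products of
$\nabla_a(df\,b)$ with $df\,c$. Inserted in the Koszul formula, together with the symmetry of
$\nabla df$, this shows that the tangential part of $\nabla_a(df\,b)$ is $df(\Gamma(a,b))$. -/
theorem sff_normal (hg : IsMetricOn g O) (hh : IsMetricOn h W) (hf : ContDiffOn ℝ ∞ f O)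
    (hm : MapsTo f O W) (hiso : ∀ y ∈ O, ∀ a b, h (f y) (fderiv ℝ f y a) (fderiv ℝ f y b) = g y a b)
    {z : E} (hz : z ∈ O) (a b c : E) : h (f z) (sff g h f z a b) (fderiv ℝ f z c) = 0 := by
  have hO := hg.isOpen
  have hfd := differentiableAt_of_contDiffOn hO hf hz
  have hfb : ∀ b : E, DifferentiableAt ℝ (fun y ↦ fderiv ℝ f y b) z := fun b ↦
    differentiableAt_of_contDiffOn hO (contDiffOn_fderiv_apply hO hf contDiffOn_const) hz
  have hgd : DifferentiableAt ℝ g z := differentiableAt_of_contDiffOn hO hg.smooth hz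
  have K : ∀ a b c : E, fderiv ℝ g z a b c
      = h (f z) (cov h f (fun y ↦ fderiv ℝ f y b) z a) (fderiv ℝ f z c)
        + h (f z) (fderiv ℝ f z b) (cov h f (fun y ↦ fderiv ℝ f y c) z a) := by
    intro a b c
    rw [← fderiv_metric (V := fun y ↦ fderiv ℝ f y b) (Z := fun y ↦ fderiv ℝ f y c) hh (hm hz) hfd
      (hfb b) (hfb c), fderiv_congr_of_eqOn hO (fun y hy ↦ hiso y hy b c) hz,
      ((hgd.hasFDerivAt.clm_apply (hasFDerivAt_const b z)).clm_apply
        (hasFDerivAt_const c z)).fderiv]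
    simp
  have C := fun u v ↦ cov_fderiv_comm hh hO hf hm hz u v
  have e := cov_pushforward_const (g := g) (h := h) hO hf hz a b
  have e' : sff g h f z a b
      = cov h f (fun y ↦ fderiv ℝ f y b) z a - fderiv ℝ f z (gam g z a b) := by rw [e]; abel
  rw [e', map_sub, sub_apply, hiso z hz, hg.gam_spec hz, K a b c, K b a c, K c a b, C b a, C c a,
    C c b, hh.symm _ (hm hz) (fderiv ℝ f z b), hh.symm _ (hm hz) (fderiv ℝ f z a)]
  ring

/-- The Codazzi equation, together with the Gauss equation. -/
theorem codazzi (hg : IsMetricOn g O) (hh : IsMetricOn h W) (hf : ContDiffOn ℝ ∞ f O)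
    (hm : MapsTo f O W) {z : E} (hz : z ∈ O) (a b c : E) :
    (cov h f (fun y ↦ sff g h f y a b) z c - sff g h f z (gam g z c a) b
        - sff g h f z a (gam g z c b))
      - (cov h f (fun y ↦ sff g h f y c b) z a - sff g h f z (gam g z a c) b
        - sff g h f z c (gam g z a b))
      = curv h (f z) (fderiv ℝ f z c) (fderiv ℝ f z a) (fderiv ℝ f z b)
        - fderiv ℝ f z (curv g z c a b) := by
  have hO := hg.isOpen
  have hid : ContDiffOn ℝ ∞ (fun y : E ↦ y) O := contDiffOn_id
  have hmid : MapsTo (fun y : E ↦ y) O O := mapsTo_id _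
  -- The form $B(a,b)=\nabla_a(df\,b)-df\,\Gamma(a,b)$ is differentiated along `c`. On
  -- antisymmetrizing in `a` and `c`, the first term yields the curvature of `h` and the last one
  -- the curvature of `g`.
  have key : ∀ a c, cov h f (fun y ↦ sff g h f y a b) z c
      = cov h f (fun y ↦ cov h f (fun y ↦ fderiv ℝ f y b) y a) z c
        - (sff g h f z c (gam g z a b)
          + fderiv ℝ f z (cov g (fun y ↦ y) (fun y ↦ cov g (fun y ↦ y) (fun _ ↦ b) y a) z c)) := by
    intro a c
    have hY : ContDiffOn ℝ ∞ (fun y ↦ gam g y a b) O :=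
      (hg.contDiffOn_gam.clm_apply contDiffOn_const).clm_apply contDiffOn_const
    have e1 : EqOn (fun y ↦ sff g h f y a b) (fun y ↦ cov h f (fun y ↦ fderiv ℝ f y b) y a
        - fderiv ℝ f y (gam g y a b)) O := by
      intro y hy
      simp only [cov_pushforward_const (g := g) (h := h) hO hf hy a b]
      abel
    have d1 : DifferentiableAt ℝ (fun y ↦ cov h f (fun y ↦ fderiv ℝ f y b) y a) z :=
      differentiableAt_of_contDiffOn hO (contDiffOn_cov hh hO hf hm
        (contDiffOn_fderiv_apply hO hf contDiffOn_const) contDiffOn_const) hz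
    have d2 : DifferentiableAt ℝ (fun y ↦ fderiv ℝ f y (gam g y a b)) z :=
      differentiableAt_of_contDiffOn hO (contDiffOn_fderiv_apply hO hf hY) hz
    rw [cov_congr hO e1 hz, cov_sub d1 d2,
      cov_pushforward (g := g) hO hf hz (differentiableAt_of_contDiffOn hO hY hz)]
    simp only [cov_const]
  have k1 := cov_cov_sub hh hO hf hm (contDiffOn_fderiv_apply hO hf (u := fun _ ↦ b)
    contDiffOn_const) hz c a
  have k2 := cov_cov_sub hg hO hid hmid (contDiffOn_const (c := b)) hz c a
  simp only [fderiv_fun_id, ContinuousLinearMap.id_apply] at k2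
  rw [key a c, key c a, ← k1, ← k2, hg.gam_symm hz c a, map_sub]
  abel

/-- Traces commute with covariant derivatives. -/
theorem cov_sum_dualVec (hg : IsMetricOn g O) {ι : Type*} [Fintype ι] {b : Module.Basis ι ℝ E}
    {T : E → E →L[ℝ] E →L[ℝ] F} (hT : ContDiffOn ℝ ∞ T O) {z : E} (hz : z ∈ O) (c : E) :
    cov h f (fun y ↦ ∑ i, T y (b i) (dualVec g b i y)) z c
      = ∑ i, (cov h f (fun y ↦ T y (b i) (dualVec g b i z)) z c
        - T z (gam g z c (b i)) (dualVec g b i z) - T z (b i) (gam g z c (dualVec g b i z))) := by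
  have hO := hg.isOpen
  have hTd : ∀ a, DifferentiableAt ℝ (fun y ↦ T y a) z := fun a ↦
    differentiableAt_of_contDiffOn hO (hT.clm_apply contDiffOn_const) hz
  have hθ : ∀ i, DifferentiableAt ℝ (dualVec g b i) z := fun i ↦
    differentiableAt_of_contDiffOn hO (hg.contDiffOn_dualVec i) hz
  rw [cov_sum fun i _ ↦ (hTd (b i)).clm_apply (hθ i)]
  -- The derivative of the dual frame is traded for that of the constant frame.
  have h1 := hg.sum_cov_dualVec (b := b) hz c
    (LinearMap.mk₂ ℝ (fun a b ↦ T z a b) (by simp) (by simp) (by simp) (by simp))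
  simp only [LinearMap.mk₂_apply] at h1
  simp only [cov_apply_form (g := g) (A := fun y ↦ T y (b _)) (hTd _) (hθ _),
    cov_apply_form_const (g := g) (A := fun y ↦ T y (b _)) (hTd _), Finset.sum_add_distrib,
    Finset.sum_sub_distrib, h1]
  abel

end Forms

/-! ## Isometric changes of coordinates -/

section Transform

variable {X E F : Type*} [NormedAddCommGroup X] [NormedSpace ℝ X]
  [NormedAddCommGroup E] [NormedSpace ℝ E] [FiniteDimensional ℝ E]
  [NormedAddCommGroup F] [NormedSpace ℝ F] [FiniteDimensional ℝ F]
  {g : E → E →L[ℝ] E →L[ℝ] ℝ} {O : Set E} {h : F → F →L[ℝ] F →L[ℝ] ℝ} {W : Set F} {κ : E → F}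

/-- The second fundamental form is normal to the image of the differential, which is the whole space
here. -/
theorem sff_eq_zero (hg : IsMetricOn g O) (hh : IsMetricOn h W) (hκ : ContDiffOn ℝ ∞ κ O)
    (hm : MapsTo κ O W) (hiso : ∀ y ∈ O, ∀ a b, h (κ y) (fderiv ℝ κ y a) (fderiv ℝ κ y b) = g y a b)
    {z : E} (hz : z ∈ O) (hs : Function.Surjective (fderiv ℝ κ z)) (a b : E) :
    sff g h κ z a b = 0 := by
  refine hh.eq_of_forall (hm hz) fun c ↦ ?_
  obtain ⟨c, rfl⟩ := hs c
  rw [sff_normal hg hh hκ hm hiso hz, map_zero, zero_apply]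

/-- Vanishing of the second fundamental form of `κ` is precisely the transformation law of
Christoffel symbols. -/
theorem cov_transform (hg : IsMetricOn g O) (hh : IsMetricOn h W) (hκ : ContDiffOn ℝ ∞ κ O)
    (hm : MapsTo κ O W) (hiso : ∀ y ∈ O, ∀ a b, h (κ y) (fderiv ℝ κ y a) (fderiv ℝ κ y b) = g y a b)
    (hs : ∀ z ∈ O, Function.Surjective (fderiv ℝ κ z)) {f : X → E} {V : X → E} {x : X}
    (hx : f x ∈ O) (hf : DifferentiableAt ℝ f x) (hV : DifferentiableAt ℝ V x) (u : X) :
    cov h (fun y ↦ κ (f y)) (fun y ↦ fderiv ℝ κ (f y) (V y)) x u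
      = fderiv ℝ κ (f x) (cov g f V x u) := by
  have h0 := sff_eq_zero hg hh hκ hm hiso hx (hs _ hx) (fderiv ℝ f x u) (V x)
  rw [sff, covForm_apply] at h0
  have d1 : DifferentiableAt ℝ κ (f x) := differentiableAt_of_contDiffOn hg.isOpen hκ hx
  have d2 : DifferentiableAt ℝ (fderiv ℝ κ) (f x) := differentiableAt_of_contDiffOn hg.isOpen
    (hκ.fderiv_of_isOpen hg.isOpen (by simp)) hx
  have e1 : HasFDerivAt (fun y ↦ κ (f y)) _ x := d1.hasFDerivAt.comp x hf.hasFDerivAt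
  have e2 : HasFDerivAt (fun y ↦ fderiv ℝ κ (f y)) _ x := d2.hasFDerivAt.comp x hf.hasFDerivAt
  rw [cov, e1.fderiv, (e2.clm_apply hV.hasFDerivAt).fderiv, cov, map_add]
  simp only [add_apply, ContinuousLinearMap.comp_apply, ContinuousLinearMap.flip_apply]
  rw [add_sub, sub_eq_zero] at h0
  rw [← h0]
  abel

/-- Curvature is the commutator of covariant derivatives, and these are transported by
`cov_transform`. -/
theorem curv_transform (hg : IsMetricOn g O) (hh : IsMetricOn h W) (hκ : ContDiffOn ℝ ∞ κ O)
    (hm : MapsTo κ O W) (hiso : ∀ y ∈ O, ∀ a b, h (κ y) (fderiv ℝ κ y a) (fderiv ℝ κ y b) = g y a b)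
    (hs : ∀ z ∈ O, Function.Surjective (fderiv ℝ κ z)) {z : E} (hz : z ∈ O) (a b c : E) :
    curv h (κ z) (fderiv ℝ κ z a) (fderiv ℝ κ z b) (fderiv ℝ κ z c)
      = fderiv ℝ κ z (curv g z a b c) := by
  have hO := hg.isOpen
  have hid : ContDiffOn ℝ ∞ (fun y : E ↦ y) O := contDiffOn_id
  have hmid : MapsTo (fun y : E ↦ y) O O := mapsTo_id _
  have T : ∀ {Y : E → E}, ContDiffOn ℝ ∞ Y O → ∀ y ∈ O, ∀ u,
      cov h κ (fun y ↦ fderiv ℝ κ y (Y y)) y u = fderiv ℝ κ y (cov g (fun y ↦ y) Y y u) :=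
    fun hY y hy u ↦ cov_transform (f := fun y ↦ y) hg hh hκ hm hiso hs hy differentiableAt_id
      (differentiableAt_of_contDiffOn hO hY hy) u
  have hc : ContDiffOn ℝ ∞ (fun _ : E ↦ c) O := contDiffOn_const
  have D : ∀ u v, cov h κ (fun y ↦ cov h κ (fun y ↦ fderiv ℝ κ y c) y v) z u
      = fderiv ℝ κ z (cov g (fun y ↦ y) (fun y ↦ cov g (fun y ↦ y) (fun _ ↦ c) y v) z u) := by
    intro u v
    rw [cov_congr hO (fun y hy ↦ T hc y hy v) hz,
      T (contDiffOn_cov hg hO hid hmid hc contDiffOn_const) z hz]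
  have k1 := cov_cov_sub hh hO hκ hm (contDiffOn_fderiv_apply hO hκ hc) hz a b
  have k2 := cov_cov_sub hg hO hid hmid hc hz a b
  simp only [fderiv_fun_id, ContinuousLinearMap.id_apply] at k2
  rw [← k1, ← k2, D, D, map_sub]

end Transform

/-! ## The Jacobi operator and its self-adjointness -/

section Jacobi

variable {E F ι : Type*} [NormedAddCommGroup E] [NormedSpace ℝ E] [FiniteDimensional ℝ E]
  [NormedAddCommGroup F] [NormedSpace ℝ F] [FiniteDimensional ℝ F] [Fintype ι]
  {g : E → E →L[ℝ] E →L[ℝ] ℝ} {O : Set E} {h : F → F →L[ℝ] F →L[ℝ] ℝ} {W : Set F} {f V Z : E → F}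
  {b : Module.Basis ι ℝ E}

/-- The second covariant derivative of a vector field along `f`. -/
def hess (g : E → E →L[ℝ] E →L[ℝ] ℝ) (h : F → F →L[ℝ] F →L[ℝ] ℝ) (f V : E → F) (z : E) :
    E →L[ℝ] E →L[ℝ] F :=
  covForm g h f (covL h f V) z

/-- The tension field in coordinates. -/
def tens (g : E → E →L[ℝ] E →L[ℝ] ℝ) (h : F → F →L[ℝ] F →L[ℝ] ℝ) (b : Module.Basis ι ℝ E)
    (f : E → F) (z : E) : F :=
  ∑ i, sff g h f z (b i) (dualVec g b i z)

/-- The Jacobi operator in coordinates: rough Laplacian plus curvature term. -/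
def jac (g : E → E →L[ℝ] E →L[ℝ] ℝ) (h : F → F →L[ℝ] F →L[ℝ] ℝ) (b : Module.Basis ι ℝ E)
    (f V : E → F) (z : E) : F :=
  ∑ i, (hess g h f V z (b i) (dualVec g b i z)
    + curv h (f z) (V z) (fderiv ℝ f z (b i)) (fderiv ℝ f z (dualVec g b i z)))

/-- The divergence of a one-form in coordinates. -/
def divForm (g : E → E →L[ℝ] E →L[ℝ] ℝ) (b : Module.Basis ι ℝ E) (α : E → E →L[ℝ] ℝ) (z : E) : ℝ :=
  ∑ i, (fderiv ℝ α z (b i) (dualVec g b i z) - α z (gam g z (b i) (dualVec g b i z)))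

/-- The one-form `u ↦ ⟨∇_u V, Z⟩ - ⟨V, ∇_u Z⟩`. -/
def flux (h : F → F →L[ℝ] F →L[ℝ] ℝ) (f V Z : E → F) (z : E) : E →L[ℝ] ℝ :=
  ((h (f z)).flip (Z z)) ∘L covL h f V z - (h (f z) (V z)) ∘L covL h f Z z

theorem flux_apply (z u : E) : flux h f V Z z u
    = h (f z) (cov h f V z u) (Z z) - h (f z) (V z) (cov h f Z z u) := rfl

theorem contDiffOn_flux (hO : IsOpen O) (hh : IsMetricOn h W) (hf : ContDiffOn ℝ ∞ f O)
    (hm : MapsTo f O W) (hV : ContDiffOn ℝ ∞ V O) (hZ : ContDiffOn ℝ ∞ Z O) :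
    ContDiffOn ℝ ∞ (flux h f V Z) O := by
  have h1 : ContDiffOn ℝ ∞ (fun z ↦ (h (f z)).flip) O :=
    (ContinuousLinearMap.flipₗᵢ ℝ F F ℝ).toContinuousLinearEquiv.contDiff.comp_contDiffOn
      (hh.smooth.comp hf hm)
  exact ((h1.clm_apply hZ).clm_comp (contDiffOn_covL hh hO hf hm hV)).sub
    (((hh.smooth.comp hf hm).clm_apply hV).clm_comp (contDiffOn_covL hh hO hf hm hZ))

theorem hess_apply (hO : IsOpen O) (hh : IsMetricOn h W) (hf : ContDiffOn ℝ ∞ f O)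
    (hm : MapsTo f O W) (hV : ContDiffOn ℝ ∞ V O) {z : E} (hz : z ∈ O) (a c : E) :
    hess g h f V z a c = cov h f (fun y ↦ cov h f V y c) z a - cov h f V z (gam g z a c) := by
  have := cov_apply_form_const (g := g) (h := h) (f := f)
    (differentiableAt_of_contDiffOn hO (contDiffOn_covL hh hO hf hm hV) hz) a c
  simp only [covL_apply] at this
  rw [this, hess]; abel

theorem sff_apply (hO : IsOpen O) (hf : ContDiffOn ℝ ∞ f O) {z : E} (hz : z ∈ O) (a c : E) :
    sff g h f z a c
      = cov h f (fun y ↦ fderiv ℝ f y c) z a - fderiv ℝ f z (gam g z a c) := by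
  rw [cov_pushforward_const (g := g) hO hf hz]; abel

theorem contDiffOn_tens (hg : IsMetricOn g O) (hh : IsMetricOn h W) (hf : ContDiffOn ℝ ∞ f O)
    (hm : MapsTo f O W) : ContDiffOn ℝ ∞ (tens g h b f) O :=
  ContDiffOn.sum fun i _ ↦ ((contDiffOn_sff hg hh hf hm).clm_apply contDiffOn_const).clm_apply
    (hg.contDiffOn_dualVec i)

theorem contDiffOn_jac (hg : IsMetricOn g O) (hh : IsMetricOn h W) (hf : ContDiffOn ℝ ∞ f O)
    (hm : MapsTo f O W) (hV : ContDiffOn ℝ ∞ V O) : ContDiffOn ℝ ∞ (jac g h b f V) O := by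
  have hO := hg.isOpen
  have hG : ContDiffOn ℝ ∞ (fun z ↦ gam h (f z)) O := hh.contDiffOn_gam.comp hf hm
  have hDG : ContDiffOn ℝ ∞ (fun z ↦ fderiv ℝ (gam h) (f z)) O :=
    (hh.contDiffOn_gam.fderiv_of_isOpen hh.isOpen (by simp)).comp hf hm
  have hc : ∀ {A B C : E → F}, ContDiffOn ℝ ∞ A O → ContDiffOn ℝ ∞ B O → ContDiffOn ℝ ∞ C O →
      ContDiffOn ℝ ∞ (fun z ↦ curv h (f z) (A z) (B z) (C z)) O := by
    intro A B C hA hB hC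
    exact (((((hDG.clm_apply hA).clm_apply hB).clm_apply hC).sub
      (((hDG.clm_apply hB).clm_apply hA).clm_apply hC)).add
      ((hG.clm_apply hA).clm_apply ((hG.clm_apply hB).clm_apply hC))).sub
      ((hG.clm_apply hB).clm_apply ((hG.clm_apply hA).clm_apply hC))
  exact ContDiffOn.sum fun i _ ↦
    (((contDiffOn_covForm hg hh hf hm (contDiffOn_covL hh hO hf hm hV)).clm_apply
      contDiffOn_const).clm_apply (hg.contDiffOn_dualVec i)).add
    (hc hV (contDiffOn_fderiv_apply hO hf contDiffOn_const)
      (contDiffOn_fderiv_apply hO hf (hg.contDiffOn_dualVec i)))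

/-- Formal self-adjointness of the Jacobi operator. In the derivative of the flux, the products of
first derivatives are antisymmetric in the two slots and disappear in the trace. -/
theorem jac_sub_jac (hg : IsMetricOn g O) (hh : IsMetricOn h W) (hf : ContDiffOn ℝ ∞ f O)
    (hm : MapsTo f O W) (hV : ContDiffOn ℝ ∞ V O) (hZ : ContDiffOn ℝ ∞ Z O) {z : E} (hz : z ∈ O) :
    h (f z) (jac g h b f V z) (Z z) - h (f z) (V z) (jac g h b f Z z)
      = divForm g b (flux h f V Z) z := by
  have hO := hg.isOpen
  have hα := contDiffOn_flux hO hh hf hm hV hZ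
  have hd : ∀ {V : E → F}, ContDiffOn ℝ ∞ V O → DifferentiableAt ℝ V z := fun h ↦
    differentiableAt_of_contDiffOn hO h hz
  have hcov : ∀ {V : E → F}, ContDiffOn ℝ ∞ V O → ∀ c : E,
      ContDiffOn ℝ ∞ (fun y ↦ cov h f V y c) O := fun hV c ↦
    contDiffOn_cov hh hO hf hm hV contDiffOn_const
  have key : ∀ a c : E, fderiv ℝ (flux h f V Z) z a c - flux h f V Z z (gam g z a c)
      = h (f z) (hess g h f V z a c) (Z z) - h (f z) (V z) (hess g h f Z z a c)
        + (h (f z) (cov h f V z c) (cov h f Z z a) - h (f z) (cov h f V z a) (cov h f Z z c)) := by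
    intro a c
    have e1 : fderiv ℝ (flux h f V Z) z a c = fderiv ℝ (fun y ↦ flux h f V Z y c) z a := by
      rw [((differentiableAt_of_contDiffOn hO hα hz).hasFDerivAt.clm_apply
        (hasFDerivAt_const c z)).fderiv]
      simp
    have d1 : DifferentiableAt ℝ (fun y ↦ h (f y) (cov h f V y c) (Z y)) z :=
      differentiableAt_of_contDiffOn hO
        (((hh.smooth.comp hf hm).clm_apply (hcov hV c)).clm_apply hZ) hz
    have d2 : DifferentiableAt ℝ (fun y ↦ h (f y) (V y) (cov h f Z y c)) z :=
      differentiableAt_of_contDiffOn hO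
        (((hh.smooth.comp hf hm).clm_apply hV).clm_apply (hcov hZ c)) hz
    rw [e1]
    simp only [flux_apply]
    rw [fderiv_fun_sub d1 d2, sub_apply,
      fderiv_metric hh (hm hz) (hd hf) (hd (hcov hV c)) (hd hZ),
      fderiv_metric hh (hm hz) (hd hf) (hd hV) (hd (hcov hZ c)),
      hess_apply hO hh hf hm hV hz, hess_apply hO hh hf hm hZ hz]
    simp only [map_sub, sub_apply]
    ring
  have hsym := hg.sum_comm_dualVec (b := b) hz
    (LinearMap.mk₂ ℝ (fun a c ↦ h (f z) (cov h f V z a) (cov h f Z z c))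
      (fun _ _ _ ↦ by rw [cov_add_right, map_add, add_apply])
      (fun _ _ _ ↦ by rw [cov_smul_right, map_smul, smul_apply])
      (fun _ _ _ ↦ by rw [cov_add_right, map_add])
      (fun _ _ _ ↦ by rw [cov_smul_right, map_smul]))
  have hcur := hg.sum_comm_dualVec (b := b) hz
    (LinearMap.mk₂ ℝ
      (fun a c ↦ h (f z) (curv h (f z) (Z z) (fderiv ℝ f z a) (fderiv ℝ f z c)) (V z))
      (fun _ _ _ ↦ by rw [map_add, curv_add_mid, map_add, add_apply])
      (fun _ _ _ ↦ by rw [map_smul, curv_smul_mid, map_smul, smul_apply])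
      (fun _ _ _ ↦ by rw [map_add, curv_add_right, map_add, add_apply])
      (fun _ _ _ ↦ by rw [map_smul, curv_smul_right, map_smul, smul_apply]))
  simp only [LinearMap.mk₂_apply] at hsym hcur
  -- Pair symmetry exchanges `V` with `Z` at the price of exchanging the two frame vectors; the
  -- symmetry of the trace (`hcur`) undoes the latter.
  have hR : ∀ i, h (f z) (curv h (f z) (V z) (fderiv ℝ f z (b i))
      (fderiv ℝ f z (dualVec g b i z))) (Z z)
      = h (f z) (curv h (f z) (Z z) (fderiv ℝ f z (dualVec g b i z)) (fderiv ℝ f z (b i)))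
        (V z) := by
    intro i
    rw [hh.curv_pair (hm hz), curv_skew_left, map_neg, neg_apply, hh.curv_skew_right (hm hz),
      neg_neg]
  simp only [divForm, key, jac, map_sum, map_add, sum_apply, add_apply, Finset.sum_add_distrib,
    Finset.sum_sub_distrib, hR, hsym, hcur, hh.symm _ (hm hz) (V z)]
  ring

end Jacobi

/-! ## The volume density and the divergence theorem -/

section Divergence

variable {E ι : Type*} [NormedAddCommGroup E] [NormedSpace ℝ E] [FiniteDimensional ℝ E]
  [Fintype ι] [DecidableEq ι] {g : E → E →L[ℝ] E →L[ℝ] ℝ} {O : Set E} {b : Module.Basis ι ℝ E}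

/-- The Gram matrix of a basis. -/
def gramOf (g : E → E →L[ℝ] E →L[ℝ] ℝ) (b : Module.Basis ι ℝ E) (z : E) : Matrix ι ι ℝ :=
  Matrix.of fun i j ↦ g z (b i) (b j)

/-- The Riemannian volume density with respect to a basis. -/
def density (g : E → E →L[ℝ] E →L[ℝ] ℝ) (b : Module.Basis ι ℝ E) (z : E) : ℝ :=
  Real.sqrt (gramOf g b z).det

theorem contDiff_det : ContDiff ℝ ∞ (fun A : ι → ι → ℝ ↦ (Matrix.of A).det) := by
  simp only [Matrix.det_apply]
  refine ContDiff.sum fun σ _ ↦ ?_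
  refine ContDiff.const_smul _ (contDiff_prod fun i _ ↦ ?_)
  exact contDiff_apply_apply ℝ ℝ (σ i) i

theorem gramOf_isPosDef (hg : IsMetricOn g O) {z : E} (hz : z ∈ O) : (gramOf g b z).PosDef := by
  refine Matrix.PosDef.of_dotProduct_mulVec_pos ?_ ?_
  · ext i j
    simp [gramOf, hg.symm z hz (b j)]
  · intro x hx
    have hne : ∑ i, x i • b i ≠ 0 := by
      intro h0
      exact hx (funext fun i ↦ (Fintype.linearIndependent_iff.1 b.linearIndependent) x h0 i)
    have := hg.pos z hz _ hne
    simp only [map_sum, map_smul, sum_apply, smul_apply, smul_eq_mul] at this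
    simp only [dotProduct, Matrix.mulVec, gramOf, Matrix.of_apply, Pi.star_apply, star_trivial]
    convert! this using 1
    simp only [Finset.mul_sum]
    rw [Finset.sum_comm]
    refine Finset.sum_congr rfl fun i _ ↦ Finset.sum_congr rfl fun j _ ↦ by ring

theorem density_pos (hg : IsMetricOn g O) {z : E} (hz : z ∈ O) : 0 < density g b z :=
  Real.sqrt_pos.2 (gramOf_isPosDef hg hz).det_pos

theorem contDiffOn_det_gramOf (hg : IsMetricOn g O) :
    ContDiffOn ℝ ∞ (fun z ↦ (gramOf g b z).det) O := by
  refine contDiff_det.comp_contDiffOn (f := fun z i j ↦ g z (b i) (b j)) ?_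
  exact contDiffOn_pi.2 fun i ↦ contDiffOn_pi.2 fun j ↦
    (hg.smooth.clm_apply contDiffOn_const).clm_apply contDiffOn_const

theorem contDiffOn_density (hg : IsMetricOn g O) : ContDiffOn ℝ ∞ (density g b) O :=
  (contDiffOn_det_gramOf hg).sqrt fun _ hz ↦ (gramOf_isPosDef hg hz).det_pos.ne'

theorem hasDerivAt_det_one_add_smul (P : Matrix ι ι ℝ) :
    HasDerivAt (fun t : ℝ ↦ (1 + t • P).det) P.trace 0 := by
  -- The polynomial `p` is the remainder in $\det(1+tP)=1+t\operatorname{tr}P+t^2p(t)$.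
  set p := (Matrix.det (1 + (Polynomial.X : Polynomial ℝ) • P.map Polynomial.C)).divX.divX
    with hp
  have e : (fun t : ℝ ↦ (1 + t • P).det) = fun t ↦ 1 + P.trace * t + p.eval t * t ^ 2 :=
    funext fun t ↦ Matrix.det_one_add_smul t P
  rw [e]
  have h1 : HasDerivAt (fun t : ℝ ↦ 1 + P.trace * t) P.trace 0 := by
    simpa using ((hasDerivAt_id (0 : ℝ)).const_mul P.trace).const_add 1
  have h2 := (p.hasDerivAt 0).mul ((hasDerivAt_id (0 : ℝ)).pow 2)
  simpa using h1.fun_add h2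

/-- Let $P$ be the matrix of $\Gamma(a,\cdot)$ and $G$ the Gram matrix. By metric compatibility the
derivative of the Gram matrix along `a` is $P^{T}G+GP$, the velocity at $t=0$ of the curve
$(1+tP^{T})G(1+tP)$. The determinant along this curve is $\det G\,\det(1+tP)^2$, with derivative
$2\det G\operatorname{tr}P$; no adjugate is needed. -/
theorem fderiv_det_gramOf (hg : IsMetricOn g O) {z : E} (hz : z ∈ O) (a : E) :
    fderiv ℝ (fun z ↦ (gramOf g b z).det) z a
      = 2 * (gramOf g b z).det * ∑ i, g z (dualVec g b i z) (gam g z a (b i)) := by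
  set P : Matrix ι ι ℝ := Matrix.of fun k i ↦ b.repr (gam g z a (b i)) k with hP
  set G := gramOf g b z with hG
  have hgd : DifferentiableAt ℝ g z := differentiableAt_of_contDiffOn hg.isOpen hg.smooth hz
  have hB : HasFDerivAt (fun z i j ↦ g z (b i) (b j) : E → ι → ι → ℝ)
      (ContinuousLinearMap.pi fun i ↦ ContinuousLinearMap.pi fun j ↦
        ((fderiv ℝ g z).flip (b i)).flip (b j)) z := by
    refine hasFDerivAt_pi.2 fun i ↦ hasFDerivAt_pi.2 fun j ↦ ?_
    have := (hgd.hasFDerivAt.clm_apply (hasFDerivAt_const (b i) z)).clm_apply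
      (hasFDerivAt_const (b j) z)
    refine this.congr_fderiv ?_
    ext; simp
  have hdet : DifferentiableAt ℝ (fun A : ι → ι → ℝ ↦ (Matrix.of A).det)
      (fun i j ↦ g z (b i) (b j)) := contDiff_det.contDiffAt.differentiableAt (by simp)
  have h1 : fderiv ℝ (fun z ↦ (gramOf g b z).det) z a
      = fderiv ℝ (fun A : ι → ι → ℝ ↦ (Matrix.of A).det) (fun i j ↦ g z (b i) (b j))
          (fun i j ↦ fderiv ℝ g z a (b i) (b j)) := by
    have := (hdet.hasFDerivAt.comp z hB).fderiv
    change fderiv ℝ ((fun A : ι → ι → ℝ ↦ (Matrix.of A).det) ∘ _) z a = _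
    rw [this]; rfl
  have hmul : ∀ i j, fderiv ℝ g z a (b i) (b j) = (P.transpose * G + G * P) i j := by
    intro i j
    have e : ∀ i j, g z (gam g z a (b i)) (b j) = ∑ k, P k i * G k j := by
      intro i j
      conv_lhs => rw [← b.sum_repr (gam g z a (b i))]
      simp only [map_sum, map_smul, sum_apply, smul_apply, smul_eq_mul]
      rfl
    rw [hg.fderiv_eq_gam hz, hg.symm z hz (b i), e, e, Matrix.add_apply, Matrix.mul_apply,
      Matrix.mul_apply]
    congr 1
    refine Finset.sum_congr rfl fun k _ ↦ ?_
    rw [mul_comm, hG, gramOf, Matrix.of_apply, Matrix.of_apply, hg.symm z hz]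
  have hc : HasDerivAt (fun t : ℝ ↦ ((1 + t • P.transpose) * G * (1 + t • P) : Matrix ι ι ℝ).det)
      (2 * G.det * P.trace) 0 := by
    have e : (fun t : ℝ ↦ ((1 + t • P.transpose) * G * (1 + t • P) : Matrix ι ι ℝ).det)
        = fun t : ℝ ↦ (1 + t • P).det * (G.det * (1 + t • P).det) := by
      funext t
      have : (1 + t • P.transpose : Matrix ι ι ℝ) = (1 + t • P).transpose := by simp
      rw [this, Matrix.det_mul, Matrix.det_mul, Matrix.det_transpose]
      ring
    rw [e]
    have hd := hasDerivAt_det_one_add_smul P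
    refine (hd.mul (hd.const_mul G.det)).congr_deriv ?_
    simp; ring
  have hcurve : HasDerivAt
      (fun t i j ↦ ((1 + t • P.transpose) * G * (1 + t • P) : Matrix ι ι ℝ) i j : ℝ → ι → ι → ℝ)
      (fun i j ↦ (P.transpose * G + G * P) i j) 0 := by
    refine hasDerivAt_pi.2 fun i ↦ hasDerivAt_pi.2 fun j ↦ ?_
    have e : (fun t : ℝ ↦ ((1 + t • P.transpose) * G * (1 + t • P) : Matrix ι ι ℝ) i j)
        = fun t : ℝ ↦ G i j + t * (P.transpose * G + G * P) i j
          + t ^ 2 * (P.transpose * G * P) i j := by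
      funext t
      have : ((1 + t • P.transpose) * G * (1 + t • P) : Matrix ι ι ℝ)
          = G + t • (P.transpose * G + G * P) + t ^ 2 • (P.transpose * G * P) := by
        simp only [Matrix.add_mul, Matrix.mul_add, Matrix.one_mul, Matrix.mul_one,
          Matrix.smul_mul, Matrix.mul_smul, smul_add, smul_smul, pow_two]
        abel
      rw [this]; simp; ring
    rw [e]
    have h1 := (((hasDerivAt_id (0 : ℝ)).mul_const ((P.transpose * G + G * P) i j)).const_add
      (G i j)).fun_add (((hasDerivAt_id (0 : ℝ)).pow 2).mul_const ((P.transpose * G * P) i j))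
    simpa using h1
  have h0 : (fun t i j ↦ ((1 + t • P.transpose) * G * (1 + t • P) : Matrix ι ι ℝ) i j : ℝ → ι → ι → ℝ) 0
      = fun i j ↦ g z (b i) (b j) := by
    simp [hG, gramOf]
  have h2 := HasFDerivAt.comp_hasDerivAt (0 : ℝ)
    (by rw [h0]; exact hdet.hasFDerivAt : HasFDerivAt (fun A : ι → ι → ℝ ↦ (Matrix.of A).det)
      (fderiv ℝ (fun A : ι → ι → ℝ ↦ (Matrix.of A).det) (fun i j ↦ g z (b i) (b j)))
      ((fun t i j ↦ ((1 + t • P.transpose) * G * (1 + t • P) : Matrix ι ι ℝ) i j : ℝ → ι → ι → ℝ) 0))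
    hcurve
  have h3 := h2.unique hc
  have htr : P.trace = ∑ i, g z (dualVec g b i z) (gam g z a (b i)) := by
    simp [Matrix.trace, hP, hg.dualVec_left hz]
  rw [h1, ← htr, ← h3]
  congr 1
  funext i j
  exact hmul i j

theorem fderiv_density (hg : IsMetricOn g O) {z : E} (hz : z ∈ O) (a : E) :
    fderiv ℝ (density g b) z a
      = density g b z * ∑ i, g z (dualVec g b i z) (gam g z a (b i)) := by
  have hpos := (gramOf_isPosDef (b := b) hg hz).det_pos
  have hd := differentiableAt_of_contDiffOn hg.isOpen (contDiffOn_det_gramOf (b := b) hg) hz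
  have := (hd.hasFDerivAt.sqrt hpos.ne').fderiv
  change fderiv ℝ (fun z ↦ Real.sqrt (gramOf g b z).det) z a = _
  rw [this, smul_apply, fderiv_det_gramOf hg hz, density]
  have h2 := Real.sq_sqrt hpos.le
  have h3 := Real.sqrt_pos.2 hpos
  rw [smul_eq_mul]
  nth_rewrite 2 [← h2]
  field_simp

/-- The formula $\operatorname{div}\alpha=\frac1{\sqrt{g}}\partial_i(\sqrt g\,\alpha^i)$, which
turns the Riemannian divergence into a Euclidean one. -/
theorem sum_fderiv_density_mul (hg : IsMetricOn g O) {α : E → E →L[ℝ] ℝ}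
    (hα : ContDiffOn ℝ ∞ α O) {z : E} (hz : z ∈ O) :
    ∑ i, fderiv ℝ (fun y ↦ density g b y * α y (dualVec g b i y)) z (b i)
      = density g b z * divForm g b α z := by
  have hO := hg.isOpen
  have hs := differentiableAt_of_contDiffOn hO (contDiffOn_density (b := b) hg) hz
  have hαd := differentiableAt_of_contDiffOn hO hα hz
  have hθ : ∀ i, DifferentiableAt ℝ (dualVec g b i) z := fun i ↦
    differentiableAt_of_contDiffOn hO (hg.contDiffOn_dualVec i) hz
  have e : ∀ i, fderiv ℝ (fun y ↦ density g b y * α y (dualVec g b i y)) z (b i)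
      = density g b z * (fderiv ℝ α z (b i) (dualVec g b i z)
          - α z (gam g z (b i) (dualVec g b i z))
          + (α z (cov g (fun y ↦ y) (dualVec g b i) z (b i))
          + (∑ j, g z (dualVec g b j z) (gam g z (b i) (b j))) * α z (dualVec g b i z))) := by
    intro i
    rw [(hs.hasFDerivAt.fun_mul (hαd.hasFDerivAt.clm_apply (hθ i).hasFDerivAt)).fderiv]
    simp only [add_apply, smul_apply, ContinuousLinearMap.comp_apply,
      ContinuousLinearMap.flip_apply, fderiv_density hg hz, smul_eq_mul, cov, fderiv_fun_id,
      ContinuousLinearMap.id_apply, map_add]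
    ring
  simp only [e, ← Finset.mul_sum, divForm]
  congr 1
  have := congrArg (α z) (hg.sum_cov_dualVec_self (b := b) hz)
  simp only [map_sum, map_neg, map_smul, smul_eq_mul] at this
  rw [Finset.sum_add_distrib, Finset.sum_add_distrib (f := fun i ↦ α z _), this]
  ring

end Divergence

/-! ## First variation of the squared tension field -/

section Variation

variable {E F ι : Type*} [NormedAddCommGroup E] [NormedSpace ℝ E] [FiniteDimensional ℝ E]
  [NormedAddCommGroup F] [NormedSpace ℝ F] [FiniteDimensional ℝ F] [Fintype ι]
  {g : E → E →L[ℝ] E →L[ℝ] ℝ} {O : Set E} {h : F → F →L[ℝ] F →L[ℝ] ℝ} {W : Set F}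
  {b : Module.Basis ι ℝ E} {Φ : ℝ × E → F} {Q : Set (ℝ × E)}

theorem IsMetricOn.sharp_eq_sum (hg : IsMetricOn g O) {z : E} (hz : z ∈ O) (α : E →L[ℝ] ℝ) :
    sharp g z α = ∑ i, α (b i) • dualVec g b i z := by
  conv_lhs => rw [← hg.sum_smul_dualVec (b := b) hz (sharp g z α)]
  simp_rw [hg.sharp_spec hz]

theorem fderiv_slice {G : Type*} [NormedAddCommGroup G] [NormedSpace ℝ G] {V : ℝ × E → G}
    {p : ℝ × E} (hV : DifferentiableAt ℝ V p) (a : E) :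
    fderiv ℝ (fun y ↦ V (p.1, y)) p.2 a = fderiv ℝ V p (0, a) := by
  have h1 : HasFDerivAt (fun y : E ↦ (p.1, y)) (ContinuousLinearMap.inr ℝ ℝ E) p.2 :=
    hasFDerivAt_prodMk_right p.1 p.2
  have h2 : HasFDerivAt V (fderiv ℝ V p) (p.1, p.2) := hV.hasFDerivAt
  have h3 : HasFDerivAt (fun y ↦ V (p.1, y)) _ p.2 := h2.comp p.2 h1
  rw [h3.fderiv]; rfl

theorem cov_slice {V : ℝ × E → F} {p : ℝ × E} (hΦ : DifferentiableAt ℝ Φ p)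
    (hV : DifferentiableAt ℝ V p) (a : E) :
    cov h (fun y ↦ Φ (p.1, y)) (fun y ↦ V (p.1, y)) p.2 a = cov h Φ V p (0, a) := by
  rw [cov, cov, fderiv_slice hΦ, fderiv_slice hV]

theorem isOpen_slice (hQ : IsOpen Q) (t : ℝ) : IsOpen {y | (t, y) ∈ Q} :=
  hQ.preimage (by fun_prop)

theorem contDiffOn_slice {G : Type*} [NormedAddCommGroup G] [NormedSpace ℝ G] {V : ℝ × E → G}
    (hV : ContDiffOn ℝ ∞ V Q) (t : ℝ) : ContDiffOn ℝ ∞ (fun y ↦ V (t, y)) {y | (t, y) ∈ Q} :=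
  hV.comp (contDiff_prodMk_right t).contDiffOn fun _ hy ↦ hy

/-- The tension fields of a family of maps. -/
def tensFam (g : E → E →L[ℝ] E →L[ℝ] ℝ) (h : F → F →L[ℝ] F →L[ℝ] ℝ) (b : Module.Basis ι ℝ E)
    (Φ : ℝ × E → F) (p : ℝ × E) : F :=
  ∑ i, (cov h Φ (fun q ↦ fderiv ℝ Φ q (0, dualVec g b i p.2)) p (0, b i)
    - fderiv ℝ Φ p (0, gam g p.2 (b i) (dualVec g b i p.2)))

/-- The tension of each map of the family is expressed by covariant derivatives along $\Phi$ on
$\mathbb R\times E$, where it can also be differentiated in time. -/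
theorem tens_slice (hQ : IsOpen Q) (hΦ : ContDiffOn ℝ ∞ Φ Q) {p : ℝ × E} (hp : p ∈ Q) :
    tens g h b (fun y ↦ Φ (p.1, y)) p.2 = tensFam g h b Φ p := by
  have hO := isOpen_slice hQ p.1
  have hz : p.2 ∈ {y | (p.1, y) ∈ Q} := hp
  have hΦd : ∀ q ∈ Q, DifferentiableAt ℝ Φ q := fun q hq ↦ differentiableAt_of_contDiffOn hQ hΦ hq
  refine Finset.sum_congr rfl fun i _ ↦ ?_
  rw [sff_apply hO (contDiffOn_slice hΦ p.1) hz, fderiv_slice (hΦd p hp)]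
  congr 1
  rw [cov_congr hO (fun y hy ↦ fderiv_slice (hΦd (p.1, y) hy) _) hz,
    cov_slice (V := fun q ↦ fderiv ℝ Φ q (0, dualVec g b i p.2)) (hΦd p hp)
      (differentiableAt_of_contDiffOn hQ (contDiffOn_fderiv_apply hQ hΦ contDiffOn_const) hp)]

theorem contDiffOn_tensFam (hg : IsMetricOn g O) (hh : IsMetricOn h W) (hQ : IsOpen Q)
    (hΦ : ContDiffOn ℝ ∞ Φ Q) (hm : MapsTo Φ Q W) (hQO : ∀ p ∈ Q, p.2 ∈ O) :
    ContDiffOn ℝ ∞ (tensFam g h b Φ) Q := by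
  have h1 : ContDiffOn ℝ ∞ (fderiv ℝ Φ) Q := hΦ.fderiv_of_isOpen hQ (by simp)
  have h2 : ContDiffOn ℝ ∞ (fderiv ℝ (fderiv ℝ Φ)) Q := h1.fderiv_of_isOpen hQ (by simp)
  have hG : ContDiffOn ℝ ∞ (fun q ↦ gam h (Φ q)) Q := hh.contDiffOn_gam.comp hΦ hm
  have hθ : ∀ i, ContDiffOn ℝ ∞ (fun q : ℝ × E ↦ dualVec g b i q.2) Q := fun i ↦
    (hg.contDiffOn_dualVec i).comp contDiffOn_snd hQO
  have hθ' : ∀ i, ContDiffOn ℝ ∞ (fun q : ℝ × E ↦ ((0 : ℝ), dualVec g b i q.2)) Q := fun i ↦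
    contDiffOn_const.prodMk (hθ i)
  have hgg : ContDiffOn ℝ ∞ (fun q : ℝ × E ↦ gam g q.2) Q :=
    hg.contDiffOn_gam.comp contDiffOn_snd hQO
  -- In `tensFam` the dual frame is frozen at the point of evaluation, so smoothness in `p` is
  -- visible only after expanding the covariant derivative.
  have : EqOn (tensFam g h b Φ) (fun p ↦ ∑ i, (fderiv ℝ (fderiv ℝ Φ) p (0, b i)
      (0, dualVec g b i p.2) + gam h (Φ p) (fderiv ℝ Φ p (0, b i))
        (fderiv ℝ Φ p (0, dualVec g b i p.2))
      - fderiv ℝ Φ p (0, gam g p.2 (b i) (dualVec g b i p.2)))) Q := by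
    intro p hp
    refine Finset.sum_congr rfl fun i _ ↦ ?_
    rw [cov, ((differentiableAt_of_contDiffOn hQ h1 hp).hasFDerivAt.clm_apply
      (hasFDerivAt_const _ p)).fderiv]
    simp
  refine ContDiffOn.congr (ContDiffOn.sum fun i _ ↦ ?_) this
  exact (((h2.clm_apply contDiffOn_const).clm_apply (hθ' i)).add
    ((hG.clm_apply (h1.clm_apply contDiffOn_const)).clm_apply (h1.clm_apply (hθ' i)))).sub
    (h1.clm_apply (contDiffOn_const.prodMk ((hgg.clm_apply contDiffOn_const).clm_apply (hθ i))))

/-- The reason is $\nabla_t\tau=J(\partial_t\Phi)$: the time derivative is moved past the outer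
space derivative, producing the curvature term, and then past the inner one by torsion-freeness. -/
theorem hasDerivAt_tension_sq (hh : IsMetricOn h W) (hQ : IsOpen Q)
    (hΦ : ContDiffOn ℝ ∞ Φ Q) (hm : MapsTo Φ Q W) {p : ℝ × E} (hp : p ∈ Q) :
    HasDerivAt (fun s ↦ h (Φ (s, p.2)) (tensFam g h b Φ (s, p.2)) (tensFam g h b Φ (s, p.2)))
      (2 * h (Φ p) (jac g h b (fun y ↦ Φ (p.1, y)) (fun y ↦ fderiv ℝ Φ (p.1, y) (1, 0)) p.2)
        (tensFam g h b Φ p)) p.1 := by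
  have hO := isOpen_slice hQ p.1
  have hz : p.2 ∈ {y | (p.1, y) ∈ Q} := hp
  have hd : ∀ {V : ℝ × E → F}, ContDiffOn ℝ ∞ V Q → ∀ {q}, q ∈ Q → DifferentiableAt ℝ V q :=
    fun hV q hq ↦ differentiableAt_of_contDiffOn hQ hV hq
  have hΦc : ∀ c : ℝ × E, ContDiffOn ℝ ∞ (fun q ↦ fderiv ℝ Φ q c) Q := fun c ↦
    contDiffOn_fderiv_apply hQ hΦ contDiffOn_const
  have hcov : ∀ {V : ℝ × E → F}, ContDiffOn ℝ ∞ V Q → ∀ c : ℝ × E,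
      ContDiffOn ℝ ∞ (fun q ↦ cov h Φ V q c) Q := fun hV c ↦
    contDiffOn_cov hh hQ hΦ hm hV contDiffOn_const
  set θ : ι → ℝ × E := fun i ↦ (0, dualVec g b i p.2) with hθ
  set Γ : ι → ℝ × E := fun i ↦ (0, gam g p.2 (b i) (dualVec g b i p.2)) with hΓ
  -- With the frame frozen at `p.2`, the field `T` agrees with the tension fields along the line
  -- $s\mapsto(s,p.2)$, and only this line matters for the derivative.
  set T : ℝ × E → F := fun q ↦ ∑ i, (cov h Φ (fun q ↦ fderiv ℝ Φ q (θ i)) q (0, b i)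
    - fderiv ℝ Φ q (Γ i)) with hT
  have hTs : ContDiffOn ℝ ∞ T Q :=
    ContDiffOn.sum fun i _ ↦ (hcov (hΦc (θ i)) _).sub (hΦc (Γ i))
  have hcurve : HasDerivAt (fun s : ℝ ↦ (s, p.2)) ((1 : ℝ), (0 : E)) p.1 :=
    (hasDerivAt_id p.1).prodMk (hasDerivAt_const p.1 p.2)
  have hfun : ContDiffOn ℝ ∞ (fun q ↦ h (Φ q) (T q) (T q)) Q :=
    ((hh.smooth.comp hΦ hm).clm_apply hTs).clm_apply hTs
  have h1 : HasDerivAt (fun s ↦ h (Φ (s, p.2)) (T (s, p.2)) (T (s, p.2)))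
      (fderiv ℝ (fun q ↦ h (Φ q) (T q) (T q)) p (1, 0)) p.1 :=
    (differentiableAt_of_contDiffOn hQ hfun hp).hasFDerivAt.comp_hasDerivAt (f := fun s : ℝ ↦ (s, p.2)) p.1 hcurve
  rw [fderiv_metric hh (hm hp) (hd hΦ hp) (hd hTs hp) (hd hTs hp),
    hh.symm _ (hm hp) (T p), ← two_mul] at h1
  have key : cov h Φ T p (1, 0)
      = jac g h b (fun y ↦ Φ (p.1, y)) (fun y ↦ fderiv ℝ Φ (p.1, y) (1, 0)) p.2 := by
    rw [hT, cov_sum fun i _ ↦ hd ((hcov (hΦc (θ i)) _).sub (hΦc (Γ i))) hp]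
    refine Finset.sum_congr rfl fun i _ ↦ ?_
    have hsl : MapsTo (fun y ↦ Φ (p.1, y)) {y | (p.1, y) ∈ Q} W := fun y hy ↦ hm hy
    have hVs := contDiffOn_slice (hΦc (1, 0)) p.1
    rw [cov_sub (hd (hcov (hΦc (θ i)) _) hp) (hd (hΦc (Γ i)) hp),
      hess_apply hO hh (contDiffOn_slice hΦ p.1) hsl hVs hz, fderiv_slice (hd hΦ hp),
      fderiv_slice (hd hΦ hp)]
    -- After the next rewriting: $\nabla_{b_i}\nabla_t-\nabla_t\nabla_{b_i}$ gives the curvature,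
    -- and $\nabla_t\partial_\theta\Phi=\nabla_\theta\partial_t\Phi$.
    have e1 := cov_cov_sub hh hQ hΦ hm (hΦc (θ i)) hp (1, 0) (0, b i)
    rw [cov_congr hQ (V := fun y ↦ cov h Φ (fun y ↦ fderiv ℝ Φ y (θ i)) y (1, 0))
      (fun y hy ↦ cov_fderiv_comm hh hQ hΦ hm hy (1, 0) (θ i)) hp] at e1
    rw [cov_fderiv_comm hh hQ hΦ hm hp (1, 0) (Γ i), sub_eq_iff_eq_add.1 e1,
      cov_congr hO (fun y hy ↦ cov_slice (p := (p.1, y)) (V := fun q ↦ fderiv ℝ Φ q (1, 0))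
        (hd hΦ hy) (hd (hΦc (1, 0)) hy) _) hz,
      cov_slice (V := fun q ↦ cov h Φ (fun q ↦ fderiv ℝ Φ q (1, 0)) q (0, dualVec g b i p.2))
        (hd hΦ hp) (hd (hcov (hΦc (1, 0)) _) hp),
      cov_slice (V := fun q ↦ fderiv ℝ Φ q (1, 0)) (hd hΦ hp) (hd (hΦc (1, 0)) hp)]
    abel
  rw [key] at h1
  exact h1

end Variation

/-! ## Integration by parts -/

section Integral

variable {E ι : Type*} [NormedAddCommGroup E] [NormedSpace ℝ E] [FiniteDimensional ℝ E]
  [MeasurableSpace E] [BorelSpace E] [Fintype ι] [DecidableEq ι]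
  {g : E → E →L[ℝ] E →L[ℝ] ℝ} {O : Set E} {b : Module.Basis ι ℝ E}

theorem continuous_mul_of_tsupport_subset {X : Type*} [TopologicalSpace X] {O : Set X}
    {ρ s : X → ℝ} (hO : IsOpen O) (hρ : Continuous ρ)
    (hs : tsupport ρ ⊆ O) (hc : ContinuousOn s O) : Continuous fun z ↦ ρ z * s z :=
  (hρ.continuousOn.mul hc).continuous_of_tsupport_subset hO
    ((closure_mono (Function.support_mul_subset_left _ _)).trans hs)

theorem integrable_mul_of_tsupport_subset {O : Set E} {ρ s : E → ℝ} {μ : Measure E}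
    [IsFiniteMeasureOnCompacts μ] (hO : IsOpen O) (hρ : Continuous ρ) (hcs : HasCompactSupport ρ)
    (hs : tsupport ρ ⊆ O) (hc : ContinuousOn s O) : Integrable (fun z ↦ ρ z * s z) μ :=
  (continuous_mul_of_tsupport_subset hO hρ hs hc).integrable_of_hasCompactSupport hcs.mul_right

/-- Euclidean integration by parts for $\sqrt g\,\alpha(\theta_i)$ against `ρ`. The cutoff carries
the compact support, so nothing is required of `α` outside `O`. -/
theorem integral_mul_divForm (hg : IsMetricOn g O) (μ : Measure E) [μ.IsAddHaarMeasure]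
    {ρ : E → ℝ} (hρ : ContDiff ℝ ∞ ρ) (hcs : HasCompactSupport ρ) (hs : tsupport ρ ⊆ O)
    {α : E → E →L[ℝ] ℝ} (hα : ContDiffOn ℝ ∞ α O) :
    ∫ z, ρ z * (density g b z * divForm g b α z) ∂μ
      = -∫ z, density g b z * α z (sharp g z (fderiv ℝ ρ z)) ∂μ := by
  have hO := hg.isOpen
  set Y : ι → E → ℝ := fun i y ↦ density g b y * α y (dualVec g b i y) with hY
  have hYs : ∀ i, ContDiffOn ℝ ∞ (Y i) O := fun i ↦
    (contDiffOn_density hg).mul (hα.clm_apply (hg.contDiffOn_dualVec i))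
  have hdρ : ∀ i, Continuous fun z ↦ fderiv ℝ ρ z (b i) := fun i ↦
    (hρ.continuous_fderiv (by simp)).clm_apply continuous_const
  have hdc : ∀ i, HasCompactSupport fun z ↦ fderiv ℝ ρ z (b i) := fun i ↦
    hcs.fderiv_apply ℝ (b i)
  have hds : ∀ i, tsupport (fun z ↦ fderiv ℝ ρ z (b i)) ⊆ O := fun i ↦
    (tsupport_fderiv_apply_subset ℝ (b i)).trans hs
  have hYd : ∀ i, ContinuousOn (fun z ↦ fderiv ℝ (Y i) z (b i)) O := fun i ↦
    (contDiffOn_fderiv_apply hO (hYs i) contDiffOn_const).continuousOn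
  have i1 : ∀ i, Integrable (fun z ↦ ρ z * fderiv ℝ (Y i) z (b i)) μ := fun i ↦
    integrable_mul_of_tsupport_subset hO hρ.continuous hcs hs (hYd i)
  have i2 : ∀ i, Integrable (fun z ↦ fderiv ℝ ρ z (b i) * Y i z) μ := fun i ↦
    integrable_mul_of_tsupport_subset hO (hdρ i) (hdc i) (hds i) (hYs i).continuousOn
  have i3 : ∀ i, Integrable (fun z ↦ ρ z * Y i z) μ := fun i ↦
    integrable_mul_of_tsupport_subset hO hρ.continuous hcs hs (hYs i).continuousOn
  have e1 : ∀ z, ρ z * (density g b z * divForm g b α z)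
      = ∑ i, ρ z * fderiv ℝ (Y i) z (b i) := by
    intro z
    by_cases hz : z ∈ O
    · rw [← sum_fderiv_density_mul hg hα hz, Finset.mul_sum]
    · have : ρ z = 0 := image_eq_zero_of_notMem_tsupport fun hz' ↦ hz (hs hz')
      simp [this]
  have e2 : ∀ z, density g b z * α z (sharp g z (fderiv ℝ ρ z))
      = ∑ i, fderiv ℝ ρ z (b i) * Y i z := by
    intro z
    by_cases hz : z ∈ O
    · rw [hg.sharp_eq_sum (b := b) hz, map_sum, Finset.mul_sum]
      refine Finset.sum_congr rfl fun i _ ↦ ?_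
      rw [map_smul, smul_eq_mul, hY]; ring
    · have : fderiv ℝ ρ z = 0 := image_eq_zero_of_notMem_tsupport fun hz' ↦
        hz (hs (tsupport_fderiv_subset ℝ hz'))
      simp [this]
  simp_rw [e1, e2]
  rw [integral_finsetSum _ fun i _ ↦ i1 i, integral_finsetSum _ fun i _ ↦ i2 i,
    ← Finset.sum_neg_distrib]
  refine Finset.sum_congr rfl fun i _ ↦ ?_
  exact integral_mul_fderiv_eq_neg_fderiv_mul_of_integrable (i2 i) (i1 i) (i3 i)
    (fun z _ ↦ hρ.differentiable (by simp) z)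
    (fun z hz ↦ differentiableAt_of_contDiffOn hO (hYs i) (hs hz))

end Integral

/-! ## The Jacobi operator on the tension field of a hypersurface -/

section Hypersurface

variable {E F ι : Type*} [NormedAddCommGroup E] [NormedSpace ℝ E] [FiniteDimensional ℝ E]
  [NormedAddCommGroup F] [NormedSpace ℝ F] [FiniteDimensional ℝ F] [Fintype ι]
  {g : E → E →L[ℝ] E →L[ℝ] ℝ} {O : Set E} {h : F → F →L[ℝ] F →L[ℝ] ℝ} {W : Set F} {f V Z ξ : E → F}
  {b : Module.Basis ι ℝ E} {K : E → ℝ}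

theorem jac_congr (hO : IsOpen O) (H : EqOn V Z O) {z : E} (hz : z ∈ O) :
    jac g h b f V z = jac g h b f Z z := by
  have h1 : EqOn (covL h f V) (covL h f Z) O := by
    intro y hy
    ext u
    exact cov_congr hO H hy u
  simp only [jac, hess, covForm_apply, fderiv_congr_of_eqOn hO h1 hz, h1 hz, H hz]

/-- The two mixed terms of the second derivative have equal trace, by the symmetry of $\sum
b_i\otimes\theta_i$; hence the factor 2. -/
theorem jac_smul (hg : IsMetricOn g O) (hh : IsMetricOn h W) (hf : ContDiffOn ℝ ∞ f O)
    (hm : MapsTo f O W) (hξ : ContDiffOn ℝ ∞ ξ O) (hK : ContDiffOn ℝ ∞ K O) {z : E} (hz : z ∈ O) :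
    jac g h b f (fun y ↦ K y • ξ y) z
      = divForm g b (fderiv ℝ K) z • ξ z + (2 : ℝ) • cov h f ξ z (sharp g z (fderiv ℝ K z))
        + K z • jac g h b f ξ z := by
  have hO := hg.isOpen
  have hKξ : ContDiffOn ℝ ∞ (fun y ↦ K y • ξ y) O := hK.smul hξ
  have hdK : ∀ c : E, ContDiffOn ℝ ∞ (fun y ↦ fderiv ℝ K y c) O := fun c ↦
    contDiffOn_fderiv_apply hO hK contDiffOn_const
  have hDξ : ∀ c : E, ContDiffOn ℝ ∞ (fun y ↦ cov h f ξ y c) O := fun c ↦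
    contDiffOn_cov hh hO hf hm hξ contDiffOn_const
  have hd : ∀ {V : E → F}, ContDiffOn ℝ ∞ V O → ∀ {q}, q ∈ O → DifferentiableAt ℝ V q :=
    fun hV q hq ↦ differentiableAt_of_contDiffOn hO hV hq
  have hr : ∀ {V : E → ℝ}, ContDiffOn ℝ ∞ V O → ∀ {q}, q ∈ O → DifferentiableAt ℝ V q :=
    fun hV q hq ↦ differentiableAt_of_contDiffOn hO hV hq
  have key : ∀ a c : E, hess g h f (fun y ↦ K y • ξ y) z a c
      = (fderiv ℝ (fderiv ℝ K) z a c - fderiv ℝ K z (gam g z a c)) • ξ z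
        + (fderiv ℝ K z c • cov h f ξ z a + fderiv ℝ K z a • cov h f ξ z c)
        + K z • hess g h f ξ z a c := by
    intro a c
    have e0 : EqOn (fun y ↦ cov h f (fun y ↦ K y • ξ y) y c)
        (fun y ↦ fderiv ℝ K y c • ξ y + K y • cov h f ξ y c) O := fun y hy ↦
      cov_smul (hr hK hy) (hd hξ hy) c
    have e1 : fderiv ℝ (fun y ↦ fderiv ℝ K y c) z a = fderiv ℝ (fderiv ℝ K) z a c := by
      rw [((differentiableAt_of_contDiffOn hO (hK.fderiv_of_isOpen hO (by simp)) hz).hasFDerivAt.clm_apply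
        (hasFDerivAt_const c z)).fderiv]
      simp
    rw [hess_apply hO hh hf hm hKξ hz, hess_apply hO hh hf hm hξ hz, cov_congr hO e0 hz,
      cov_add (V := fun y ↦ fderiv ℝ K y c • ξ y) (Z := fun y ↦ K y • cov h f ξ y c)
        (hd ((hdK c).smul hξ) hz) (hd (hK.smul (hDξ c)) hz),
      cov_smul (hr (hdK c) hz) (hd hξ hz), cov_smul (hr hK hz) (hd (hDξ c) hz),
      cov_smul (hr hK hz) (hd hξ hz), e1]
    simp only [sub_smul, smul_sub]
    abel
  have s1 : ∑ i, fderiv ℝ K z (b i) • cov h f ξ z (dualVec g b i z)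
      = cov h f ξ z (sharp g z (fderiv ℝ K z)) := by
    rw [hg.sharp_eq_sum (b := b) hz, cov_sum_right]
    simp_rw [cov_smul_right]
  have s2 := hg.sum_comm_dualVec (b := b) hz
    (LinearMap.mk₂ ℝ (fun a c ↦ fderiv ℝ K z a • cov h f ξ z c)
      (fun _ _ _ ↦ by rw [map_add, add_smul])
      (fun _ _ _ ↦ by rw [map_smul, smul_assoc])
      (fun _ _ _ ↦ by rw [cov_add_right, smul_add])
      (fun _ _ _ ↦ by rw [cov_smul_right, smul_comm]))
  simp only [LinearMap.mk₂_apply] at s2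
  simp only [jac, key, Finset.sum_add_distrib, s2, s1, divForm, Finset.sum_smul,
    Finset.smul_sum, smul_add, two_smul, curv_smul_left]
  abel

/-- `f` is a hypersurface in coordinates, with unit normal `ξ`. -/
structure IsLocalHypersurface (g : E → E →L[ℝ] E →L[ℝ] ℝ) (O : Set E)
    (h : F → F →L[ℝ] F →L[ℝ] ℝ) (W : Set F) (f ξ : E → F) : Prop where
  metric_left : IsMetricOn g O
  metric_right : IsMetricOn h W
  smooth : ContDiffOn ℝ ∞ f O
  mapsTo : MapsTo f O W
  iso : ∀ y ∈ O, ∀ a b, h (f y) (fderiv ℝ f y a) (fderiv ℝ f y b) = g y a b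
  smooth_normal : ContDiffOn ℝ ∞ ξ O
  unit : ∀ y ∈ O, h (f y) (ξ y) (ξ y) = 1
  normal : ∀ y ∈ O, ∀ a, h (f y) (fderiv ℝ f y a) (ξ y) = 0
  span : ∀ y ∈ O, ∀ v, ∃ a, ∃ s : ℝ, v = fderiv ℝ f y a + s • ξ y

namespace IsLocalHypersurface

variable (S : IsLocalHypersurface g O h W f ξ) {z : E}
include S

theorem diff {G : Type*} [NormedAddCommGroup G] [NormedSpace ℝ G] {V : E → G}
    (hV : ContDiffOn ℝ ∞ V O) (hz : z ∈ O) : DifferentiableAt ℝ V z :=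
  differentiableAt_of_contDiffOn S.metric_left.isOpen hV hz

theorem contDiffOn_cov_normal (c : E) : ContDiffOn ℝ ∞ (fun y ↦ cov h f ξ y c) O :=
  contDiffOn_cov S.metric_right S.metric_left.isOpen S.smooth S.mapsTo S.smooth_normal
    contDiffOn_const

theorem cov_normal_normal (hz : z ∈ O) (a : E) : h (f z) (cov h f ξ z a) (ξ z) = 0 := by
  have h1 := fderiv_metric (V := ξ) (Z := ξ) S.metric_right (S.mapsTo hz) (S.diff S.smooth hz)
    (S.diff S.smooth_normal hz) (S.diff S.smooth_normal hz) a
  rw [fderiv_congr_of_eqOn S.metric_left.isOpen S.unit hz,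
    S.metric_right.symm _ (S.mapsTo hz) (ξ z)] at h1
  simp at h1
  linarith

theorem cov_normal_tangent (hz : z ∈ O) (a c : E) :
    h (f z) (cov h f ξ z a) (fderiv ℝ f z c) = -h (f z) (sff g h f z a c) (ξ z) := by
  have h1 := fderiv_metric (V := fun y ↦ fderiv ℝ f y c) (Z := ξ) S.metric_right (S.mapsTo hz)
    (S.diff S.smooth hz)
    (S.diff (contDiffOn_fderiv_apply S.metric_left.isOpen S.smooth contDiffOn_const) hz)
    (S.diff S.smooth_normal hz) a
  rw [fderiv_congr_of_eqOn S.metric_left.isOpen (fun y hy ↦ S.normal y hy c) hz,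
    cov_pushforward_const (g := g) S.metric_left.isOpen S.smooth hz, map_add, add_apply,
    S.normal z hz, S.metric_right.symm _ (S.mapsTo hz) (fderiv ℝ f z c)] at h1
  simp at h1
  linarith

/-- In codimension one, $\nabla\xi$ is tangential because $\xi$ has unit length, while the second
fundamental form is normal. -/
theorem cov_normal_sff (hz : z ∈ O) (a k c : E) :
    h (f z) (cov h f ξ z a) (sff g h f z k c) = 0 := by
  obtain ⟨a', s, hs⟩ := S.span z hz (cov h f ξ z a)
  have h1 := S.cov_normal_normal hz a
  rw [hs, map_add, add_apply, S.normal z hz, map_smul, smul_apply, S.unit z hz] at h1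
  have hs0 : s = 0 := by simpa using h1
  rw [hs, hs0, zero_smul, add_zero, S.metric_right.symm _ (S.mapsTo hz)]
  exact sff_normal S.metric_left S.metric_right S.smooth S.mapsTo S.iso hz _ _ _

/-- Differentiate $\langle\nabla_c\xi,\xi\rangle=0$ once more. -/
theorem hess_normal_normal (hz : z ∈ O) (a c : E) :
    h (f z) (hess g h f ξ z a c) (ξ z) = -h (f z) (cov h f ξ z a) (cov h f ξ z c) := by
  have h1 := fderiv_metric (V := fun y ↦ cov h f ξ y c) (Z := ξ) S.metric_right (S.mapsTo hz)
    (S.diff S.smooth hz) (S.diff (S.contDiffOn_cov_normal c) hz) (S.diff S.smooth_normal hz) a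
  rw [fderiv_congr_of_eqOn S.metric_left.isOpen (fun y hy ↦ S.cov_normal_normal hy c) hz] at h1
  rw [hess_apply S.metric_left.isOpen S.metric_right S.smooth S.mapsTo S.smooth_normal hz,
    map_sub, sub_apply, S.cov_normal_normal hz, S.metric_right.symm _ (S.mapsTo hz) (cov h f ξ z a)]
  simp at h1
  linarith

/-- Differentiate the Weingarten equation $\langle\nabla_k\xi,df\,c\rangle=-\langle
B(c,k),\xi\rangle$. The cross terms pair $\nabla\xi$ with $B$ and vanish by `cov_normal_sff`, so
only the derivative of $B$ survives. -/
theorem hess_normal_tangent (hz : z ∈ O) (a k c : E) :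
    h (f z) (hess g h f ξ z a k) (fderiv ℝ f z c)
      = -h (f z) (cov h f (fun y ↦ sff g h f y c k) z a - sff g h f z (gam g z a c) k
        - sff g h f z c (gam g z a k)) (ξ z) := by
  have hO := S.metric_left.isOpen
  have hsym := fun {y} (hy : y ∈ O) ↦
    sff_symm S.metric_left S.metric_right S.smooth S.mapsTo hy
  have hB : ContDiffOn ℝ ∞ (fun y ↦ sff g h f y c k) O :=
    ((contDiffOn_sff S.metric_left S.metric_right S.smooth S.mapsTo).clm_apply
      contDiffOn_const).clm_apply contDiffOn_const
  have h1 := fderiv_metric (V := fun y ↦ cov h f ξ y k) (Z := fun y ↦ fderiv ℝ f y c)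
    S.metric_right (S.mapsTo hz) (S.diff S.smooth hz) (S.diff (S.contDiffOn_cov_normal k) hz)
    (S.diff (contDiffOn_fderiv_apply hO S.smooth contDiffOn_const) hz) a
  have h2 := fderiv_metric (V := fun y ↦ sff g h f y c k) (Z := ξ) S.metric_right (S.mapsTo hz)
    (S.diff S.smooth hz) (S.diff hB hz) (S.diff S.smooth_normal hz) a
  have e : EqOn (fun y ↦ h (f y) (cov h f ξ y k) (fderiv ℝ f y c))
      (fun y ↦ -h (f y) (sff g h f y c k) (ξ y)) O := by
    intro y hy
    simp only [S.cov_normal_tangent hy, hsym hy k c]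
  rw [fderiv_congr_of_eqOn hO e hz, fderiv_fun_neg, neg_apply, h2,
    cov_pushforward_const (g := g) hO S.smooth hz, map_add, S.cov_normal_sff hz,
    S.cov_normal_tangent hz, S.metric_right.symm _ (S.mapsTo hz) (sff g h f z c k),
    S.cov_normal_sff hz, hsym hz k] at h1
  rw [hess_apply hO S.metric_right S.smooth S.mapsTo S.smooth_normal hz, map_sub, sub_apply,
    S.cov_normal_tangent hz, hsym hz (gam g z a k)]
  simp only [map_sub, sub_apply]
  linarith

theorem inner_jac_normal (hz : z ∈ O) (hK : ContDiffOn ℝ ∞ K O)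
    (hτ : ∀ y ∈ O, tens g h b f y = K y • ξ y) :
    h (f z) (jac g h b f (tens g h b f) z) (ξ z)
      = divForm g b (fderiv ℝ K) z
        - K z * ∑ i, h (f z) (cov h f ξ z (b i)) (cov h f ξ z (dualVec g b i z))
        + K z * ∑ i, h (f z) (curv h (f z) (ξ z) (fderiv ℝ f z (b i))
          (fderiv ℝ f z (dualVec g b i z))) (ξ z) := by
  rw [jac_congr S.metric_left.isOpen hτ hz,
    jac_smul S.metric_left S.metric_right S.smooth S.mapsTo S.smooth_normal hK hz]
  simp only [map_add, map_smul, add_apply, smul_apply, S.unit z hz, S.cov_normal_normal hz, jac,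
    map_sum, sum_apply, S.hess_normal_normal hz, Finset.sum_add_distrib, Finset.sum_neg_distrib,
    smul_eq_mul]
  ring

/-- The curvature sum has coefficient 2: one copy is the curvature term of $J$, the other arises
when Codazzi is used to identify the trace of $\nabla^2\xi$. -/
theorem inner_jac_tangent (hz : z ∈ O) (hK : ContDiffOn ℝ ∞ K O)
    (hτ : ∀ y ∈ O, tens g h b f y = K y • ξ y) (c : E) :
    h (f z) (jac g h b f (tens g h b f) z) (fderiv ℝ f z c)
      = 2 * h (f z) (cov h f ξ z (sharp g z (fderiv ℝ K z))) (fderiv ℝ f z c)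
        - K z * fderiv ℝ K z c
        + 2 * K z * ∑ i, h (f z) (curv h (f z) (ξ z) (fderiv ℝ f z (b i))
          (fderiv ℝ f z (dualVec g b i z))) (fderiv ℝ f z c) := by
  have hO := S.metric_left.isOpen
  have hW := S.mapsTo hz
  have hh := S.metric_right
  have hR := S.metric_left.sum_comm_dualVec (b := b) hz
    (LinearMap.mk₂ ℝ
      (fun a k ↦ h (f z) (curv h (f z) (ξ z) (fderiv ℝ f z a) (fderiv ℝ f z k)) (fderiv ℝ f z c))
      (fun _ _ _ ↦ by rw [map_add, curv_add_mid, map_add, add_apply])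
      (fun _ _ _ ↦ by rw [map_smul, curv_smul_mid, map_smul, smul_apply])
      (fun _ _ _ ↦ by rw [map_add, curv_add_right, map_add, add_apply])
      (fun _ _ _ ↦ by rw [map_smul, curv_smul_right, map_smul, smul_apply]))
  simp only [LinearMap.mk₂_apply] at hR
  have hsff := contDiffOn_sff S.metric_left hh S.smooth S.mapsTo
  have htr := cov_sum_dualVec (h := h) (f := f) S.metric_left (b := b) hsff hz c
  have hτ' : h (f z) (cov h f (tens g h b f) z c) (ξ z) = fderiv ℝ K z c := by
    rw [cov_congr hO hτ hz, cov_smul (S.diff hK hz) (S.diff S.smooth_normal hz)]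
    simp [S.unit z hz, S.cov_normal_normal hz]
  -- Codazzi moves the derivative from the frame direction to `c`; the intrinsic curvature is
  -- tangential and is killed by $\xi$.
  have hcod : ∀ i, h (f z) (hess g h f ξ z (b i) (dualVec g b i z)) (fderiv ℝ f z c)
      = -h (f z) (cov h f (fun y ↦ sff g h f y (b i) (dualVec g b i z)) z c
          - sff g h f z (gam g z c (b i)) (dualVec g b i z)
          - sff g h f z (b i) (gam g z c (dualVec g b i z))) (ξ z)
        + h (f z) (curv h (f z) (ξ z) (fderiv ℝ f z (dualVec g b i z)) (fderiv ℝ f z (b i)))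
          (fderiv ℝ f z c) := by
    intro i
    rw [S.hess_normal_tangent hz, sub_eq_iff_eq_add.1 (codazzi S.metric_left hh S.smooth S.mapsTo hz
      c (dualVec g b i z) (b i)), map_add, add_apply, map_sub, sub_apply, S.normal z hz,
      hh.curv_pair hW, curv_skew_left, map_neg, neg_apply]
    ring
  -- Now the trace runs over both slots of $B$ and commutes with $\nabla_c$. It gives
  -- $\langle\nabla_c\tau,\xi\rangle=dK(c)$.
  have hsum : ∑ i, h (f z) (hess g h f ξ z (b i) (dualVec g b i z)) (fderiv ℝ f z c)
      = -fderiv ℝ K z c + ∑ i, h (f z) (curv h (f z) (ξ z) (fderiv ℝ f z (b i))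
          (fderiv ℝ f z (dualVec g b i z))) (fderiv ℝ f z c) := by
    simp only [hcod, Finset.sum_add_distrib, hR, Finset.sum_neg_distrib, ← hτ']
    congr 2
    change _ = h (f z) (cov h f (fun y ↦ ∑ i, sff g h f y (b i) (dualVec g b i y)) z c) (ξ z)
    rw [htr, map_sum, sum_apply]
  rw [jac_congr hO hτ hz,
    jac_smul S.metric_left S.metric_right S.smooth S.mapsTo S.smooth_normal hK hz]
  rw [map_add, map_add, add_apply, add_apply, map_smul, map_smul, map_smul, smul_apply, smul_apply,
    smul_apply, hh.symm _ hW (ξ z), S.normal z hz, jac, map_sum, sum_apply]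
  simp only [map_add, add_apply, Finset.sum_add_distrib, hsum, smul_eq_mul]
  ring

end IsLocalHypersurface

end Hypersurface

/-! ## Charts and tangent vectors in charts -/

section Charts

variable {m n : ℕ} {M : Type*} [TopologicalSpace M]
  [ChartedSpace (EuclideanSpace ℝ (Fin m)) M] [IsManifold (𝓡 m) ∞ M]
  {N : Type*} [TopologicalSpace N] [ChartedSpace (EuclideanSpace ℝ (Fin n)) N]
  [IsManifold (𝓡 n) ∞ N]

/-- The preferred chart at `p`. -/
abbrev chart (n : ℕ) {N : Type*} [TopologicalSpace N] [ChartedSpace (EuclideanSpace ℝ (Fin n)) N]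
    (p : N) : OpenPartialHomeomorph N (EuclideanSpace ℝ (Fin n)) :=
  chartAt (EuclideanSpace ℝ (Fin n)) p

/-- The components of a tangent vector at `y` in the preferred chart at `p`. -/
def triv (p y : N) (v : TangentSpace (𝓡 n) y) : EuclideanSpace ℝ (Fin n) :=
  (trivializationAt (EuclideanSpace ℝ (Fin n)) (TangentSpace (𝓡 n)) p ⟨y, v⟩).2

/-- The tangent vector at `y` with given components in the preferred chart at `p`. -/
def trivSymm (p y : N) (a : EuclideanSpace ℝ (Fin n)) : TangentSpace (𝓡 n) y :=
  (trivializationAt (EuclideanSpace ℝ (Fin n)) (TangentSpace (𝓡 n)) p).symm y a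

theorem triv_trivSymm {p y : N} (hy : y ∈ (chart n p).source) (a : EuclideanSpace ℝ (Fin n)) :
    triv p y (trivSymm p y a) = a := by
  have := (trivializationAt (EuclideanSpace ℝ (Fin n)) (TangentSpace (𝓡 n)) p).apply_mk_symm
    (b := y) hy a
  rw [triv, trivSymm, this]

theorem trivSymm_triv {p y : N} (hy : y ∈ (chart n p).source) (v : TangentSpace (𝓡 n) y) :
    trivSymm p y (triv p y v) = v :=
  (trivializationAt (EuclideanSpace ℝ (Fin n)) (TangentSpace (𝓡 n)) p).symm_apply_apply_mk
    (b := y) hy v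

theorem triv_injective {p y : N} (hy : y ∈ (chart n p).source) :
    Function.Injective (triv (n := n) p y) :=
  Function.LeftInverse.injective (trivSymm_triv hy)

theorem triv_eq_mfderiv {p y : N} (hy : y ∈ (chart n p).source) (v : TangentSpace (𝓡 n) y) :
    triv p y v = mfderiv (𝓡 n) (𝓡 n) (chart n p) y v := by
  have h1 := TangentBundle.continuousLinearMapAt_trivializationAt (I := 𝓡 n) hy
  have h2 := congrArg (fun L : TangentSpace (𝓡 n) y →L[ℝ] EuclideanSpace ℝ (Fin n) ↦ L v) h1
  simp only [Trivialization.continuousLinearMapAt_apply] at h2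
  rw [Trivialization.linearMapAt_apply] at h2
  exact (if_pos hy).symm.trans h2

/-- The tangent space at `p` is the model space itself, identified through the preferred chart at
`p`; hence this equality of vectors makes sense. -/
theorem triv_self (p : N) (v : TangentSpace (𝓡 n) p) : triv p p v = v := by
  have h1 := TangentBundle.continuousLinearMapAt_trivializationAt (I := 𝓡 n)
    (mem_chart_source (EuclideanSpace ℝ (Fin n)) p)
  rw [mfderiv_extChartAt_self] at h1
  have h2 := congrArg (fun L : TangentSpace (𝓡 n) p →L[ℝ] EuclideanSpace ℝ (Fin n) ↦ L v) h1
  simp only [Trivialization.continuousLinearMapAt_apply] at h2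
  rw [Trivialization.linearMapAt_apply] at h2
  exact (if_pos (mem_chart_source (EuclideanSpace ℝ (Fin n)) p)).symm.trans h2

theorem triv_add {p y : N} (hy : y ∈ (chart n p).source) (v w : TangentSpace (𝓡 n) y) :
    triv p y (v + w) = triv p y v + triv p y w := by
  rw [triv_eq_mfderiv hy, triv_eq_mfderiv hy, triv_eq_mfderiv hy]; exact map_add _ v w

theorem triv_smul {p y : N} (hy : y ∈ (chart n p).source) (c : ℝ) (v : TangentSpace (𝓡 n) y) :
    triv p y (c • v) = c • triv p y v := by
  rw [triv_eq_mfderiv hy, triv_eq_mfderiv hy]; exact map_smul _ c v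

theorem triv_zero {p y : N} (hy : y ∈ (chart n p).source) :
    triv p y (0 : TangentSpace (𝓡 n) y) = 0 := by
  rw [triv_eq_mfderiv hy]; exact map_zero _

theorem triv_sub {p y : N} (hy : y ∈ (chart n p).source) (v w : TangentSpace (𝓡 n) y) :
    triv p y (v - w) = triv p y v - triv p y w := by
  rw [triv_eq_mfderiv hy, triv_eq_mfderiv hy, triv_eq_mfderiv hy]; exact map_sub _ v w

theorem triv_sum {p y : N} (hy : y ∈ (chart n p).source) {ι : Type*} (s : Finset ι)
    (v : ι → TangentSpace (𝓡 n) y) : triv p y (∑ i ∈ s, v i) = ∑ i ∈ s, triv p y (v i) := by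
  simp only [triv_eq_mfderiv hy]; exact map_sum _ v s

variable (m) in
/-- A function on `M` in the chart at `p`. -/
def locFun (p : M) {G : Type*} (k : M → G) (z : EuclideanSpace ℝ (Fin m)) : G :=
  k ((chart m p).symm z)

variable (m n) in
/-- A map in the charts at `p` and `q`. -/
def locMap (p : M) (q : N) (φ : M → N) (z : EuclideanSpace ℝ (Fin m)) : EuclideanSpace ℝ (Fin n) :=
  chart n q (φ ((chart m p).symm z))

variable (m) in
/-- The part of the chart domain at `p` corresponding to a subset of `M`. -/
def locSet (p : M) (U : Set M) : Set (EuclideanSpace ℝ (Fin m)) :=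
  (chart m p).target ∩ (chart m p).symm ⁻¹' U

theorem isOpen_locSet (p : M) {U : Set M} (hU : IsOpen U) : IsOpen (locSet m p U) :=
  (chart m p).isOpen_inter_preimage_symm hU

theorem mem_locSet {p x : M} (hx : x ∈ (chart m p).source) {U : Set M} :
    chart m p x ∈ locSet m p U ↔ x ∈ U := by
  simp [locSet, hx]

theorem contDiffOn_locFun {p : M} {U : Set M} {G : Type*} [NormedAddCommGroup G] [NormedSpace ℝ G]
    {k : M → G} (hk : ContMDiffOn (𝓡 m) 𝓘(ℝ, G) ∞ k U) : ContDiffOn ℝ ∞ (locFun m p k) (locSet m p U) :=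
  contMDiffOn_iff_contDiffOn.1 (hk.comp
    ((contMDiffOn_chart_symm (I := 𝓡 m) (n := ∞) (x := p)).mono inter_subset_left) fun _ hz ↦ hz.2)

theorem contDiffOn_locMap {p : M} {q : N} {U : Set M} {φ : M → N}
    (hφ : ContMDiffOn (𝓡 m) (𝓡 n) ∞ φ U) (hU : MapsTo φ U (chart n q).source) :
    ContDiffOn ℝ ∞ (locMap m n p q φ) (locSet m p U) :=
  contDiffOn_locFun (k := fun x ↦ chart n q (φ x))
    ((contMDiffOn_chart (I := 𝓡 n) (n := ∞) (x := q)).comp hφ hU)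

theorem mfderiv_eq_fderiv_locFun {p x : M} (hx : x ∈ (chart m p).source) {G : Type*}
    [NormedAddCommGroup G] [NormedSpace ℝ G] {k : M → G}
    (hk : DifferentiableAt ℝ (locFun m p k) (chart m p x)) (u : TangentSpace (𝓡 m) x) :
    mfderiv (𝓡 m) 𝓘(ℝ, G) k x u = fderiv ℝ (locFun m p k) (chart m p x) (triv p x u) := by
  have h1 : k =ᶠ[𝓝 x] locFun m p k ∘ chart m p := by
    filter_upwards [(chart m p).open_source.mem_nhds hx] with y hy
    simp [locFun, hy]
  have h2 : MDifferentiableAt (𝓡 m) (𝓡 m) (chart m p) x :=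
    mdifferentiableAt_atlas (chart_mem_atlas _ p) hx
  rw [h1.mfderiv_eq, mfderiv_comp x hk.mdifferentiableAt h2, mfderiv_eq_fderiv,
    triv_eq_mfderiv hx]
  rfl

theorem mvfderiv_eq_fderiv_locFun {p x : M} (hx : x ∈ (chart m p).source) {G : Type*}
    [NormedAddCommGroup G] [NormedSpace ℝ G] {k : M → G}
    (hk : DifferentiableAt ℝ (locFun m p k) (chart m p x)) (u : TangentSpace (𝓡 m) x) :
    mvfderiv (𝓡 m) k x u = fderiv ℝ (locFun m p k) (chart m p x) (triv p x u) :=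
  mfderiv_eq_fderiv_locFun hx hk u

theorem triv_mfderiv {p x : M} {q : N} {φ : M → N} (hx : x ∈ (chart m p).source)
    (hφx : φ x ∈ (chart n q).source) (hφ : MDifferentiableAt (𝓡 m) (𝓡 n) φ x)
    (hd : DifferentiableAt ℝ (locMap m n p q φ) (chart m p x)) (u : TangentSpace (𝓡 m) x) :
    triv q (φ x) (mfderiv (𝓡 m) (𝓡 n) φ x u)
      = fderiv ℝ (locMap m n p q φ) (chart m p x) (triv p x u) := by
  have h2 : MDifferentiableAt (𝓡 n) (𝓡 n) (chart n q) (φ x) :=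
    mdifferentiableAt_atlas (chart_mem_atlas _ q) hφx
  have h3 := mfderiv_eq_fderiv_locFun (k := chart n q ∘ φ) hx hd u
  rw [mfderiv_comp x h2 hφ] at h3
  rw [triv_eq_mfderiv hφx]
  exact h3

theorem triv_eq_fderiv {p q x : N} (hp : x ∈ (chart n p).source) (hq : x ∈ (chart n q).source)
    (u : TangentSpace (𝓡 n) x) :
    triv q x u = fderiv ℝ (locMap n n p q (fun y : N ↦ y)) (chart n p x) (triv p x u) := by
  have hd : DifferentiableAt ℝ (locMap n n p q (fun y : N ↦ y)) (chart n p x) := by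
    have h1 : ContDiffOn ℝ ∞ (locMap n n p q (fun y : N ↦ y)) (locSet n p (chart n q).source) :=
      contDiffOn_locMap contMDiffOn_id (mapsTo_id _)
    exact differentiableAt_of_contDiffOn (isOpen_locSet p (chart n q).open_source) h1
      ((mem_locSet hp).2 hq)
  have := triv_mfderiv (φ := fun y : N ↦ y) hp hq mdifferentiableAt_id hd u
  rw [← this]
  congr 1
  exact (congrArg (fun L : TangentSpace (𝓡 n) x →L[ℝ] TangentSpace (𝓡 n) x ↦ L u)
    (mfderiv_id (I := 𝓡 n) (x := x))).symm

theorem components_eq_triv (φ : M → N) (V : Π x : M, TangentSpace (𝓡 n) (φ x)) (q : N) (y : M) :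
    components φ V q y = triv q (φ y) (V y) := rfl

theorem coordField_eq_trivSymm {q : N} (v : TangentSpace (𝓡 n) q) (y : N) :
    coordField v y = trivSymm q y v := by
  have := triv_self q v
  rw [triv] at this
  rw [coordField, FiberBundle.extend]
  simp only [this]
  rfl

theorem triv_coordField {q y : N} (hy : y ∈ (chart n q).source) (v : TangentSpace (𝓡 n) q) :
    triv q y (coordField v y) = v := by
  rw [coordField_eq_trivSymm]; exact triv_trivSymm hy _

end Charts

/-! ## The metric and the connection in charts -/

theorem cov_congr_of_eventuallyEq {X F : Type*} [NormedAddCommGroup X] [NormedSpace ℝ X]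
    [NormedAddCommGroup F] [NormedSpace ℝ F] {h : F → F →L[ℝ] F →L[ℝ] ℝ} {f f' V V' : X → F} {x : X}
    (hf : f =ᶠ[𝓝 x] f') (hV : V =ᶠ[𝓝 x] V') (u : X) : cov h f V x u = cov h f' V' x u := by
  rw [cov, cov, hf.fderiv_eq, hV.fderiv_eq, hf.eq_of_nhds, hV.eq_of_nhds]

section ChartMetric

variable {m n : ℕ} {M : Type*} [TopologicalSpace M]
  [ChartedSpace (EuclideanSpace ℝ (Fin m)) M] [IsManifold (𝓡 m) ∞ M]
  {N : Type*} [TopologicalSpace N] [ChartedSpace (EuclideanSpace ℝ (Fin n)) N]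
  [IsManifold (𝓡 n) ∞ N]
  [RiemannianBundle (fun q : N ↦ TangentSpace (𝓡 n) q)]

/-- The standard basis. -/
abbrev stdB (n : ℕ) : Module.Basis (Fin n) ℝ (EuclideanSpace ℝ (Fin n)) :=
  (EuclideanSpace.basisFun (Fin n) ℝ).toBasis

variable (n) in
/-- The metric in the preferred chart at `p`. -/
def hloc (p : N) (z : EuclideanSpace ℝ (Fin n)) :
    EuclideanSpace ℝ (Fin n) →L[ℝ] EuclideanSpace ℝ (Fin n) →L[ℝ] ℝ :=
  ∑ i, ∑ j, gram n p ((chart n p).symm z) i j •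
    (EuclideanSpace.proj i : EuclideanSpace ℝ (Fin n) →L[ℝ] ℝ).smulRight
      (EuclideanSpace.proj j : EuclideanSpace ℝ (Fin n) →L[ℝ] ℝ)

theorem hloc_apply (p : N) (z a b : EuclideanSpace ℝ (Fin n)) :
    hloc n p z a b = ∑ i, ∑ j, gram n p ((chart n p).symm z) i j * (a i * b j) := by
  simp [hloc, sum_apply]

theorem trivSymm_eq_sum {p y : N} (hy : y ∈ (chart n p).source) (a : EuclideanSpace ℝ (Fin n)) :
    trivSymm p y a = ∑ i, a i • trivSymm p y (EuclideanSpace.single i 1) := by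
  apply triv_injective hy
  rw [triv_trivSymm hy, triv_sum hy]
  simp_rw [triv_smul hy, triv_trivSymm hy]
  conv_lhs => rw [← (stdB n).sum_repr a]
  simp

theorem hloc_chart {p y : N} (hy : y ∈ (chart n p).source) (a b : EuclideanSpace ℝ (Fin n)) :
    hloc n p (chart n p y) a b = inner ℝ (trivSymm p y a) (trivSymm p y b) := by
  rw [hloc_apply, (chart n p).left_inv hy, trivSymm_eq_sum hy a, trivSymm_eq_sum hy b]
  simp only [sum_inner, inner_sum, real_inner_smul_left, real_inner_smul_right]
  rw [Finset.sum_comm]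
  refine Finset.sum_congr rfl fun i _ ↦ Finset.sum_congr rfl fun j _ ↦ ?_
  rw [gram, Matrix.of_apply]
  simp only [trivSymm]
  ring

theorem hloc_triv {p y : N} (hy : y ∈ (chart n p).source) (u v : TangentSpace (𝓡 n) y) :
    hloc n p (chart n p y) (triv p y u) (triv p y v) = inner ℝ u v := by
  rw [hloc_chart hy, trivSymm_triv hy, trivSymm_triv hy]

variable [IsContMDiffRiemannianBundle (𝓡 n) ∞ (EuclideanSpace ℝ (Fin n))
  (fun q : N ↦ TangentSpace (𝓡 n) q)]

theorem contMDiffOn_trivSymm (p : N) (a : EuclideanSpace ℝ (Fin n)) :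
    ContMDiffOn (𝓡 n) (𝓡 n).tangent ∞
      (fun y ↦ (⟨y, trivSymm p y a⟩ : TangentBundle (𝓡 n) N)) (chart n p).source := by
  have := (trivializationAt (EuclideanSpace ℝ (Fin n))
    (TangentSpace (𝓡 n)) p).contMDiffOn_section_baseSet_iff (IB := 𝓡 n) (n := ∞)
    (s := fun y ↦ trivSymm p y a)
  refine this.2 ((contMDiffOn_const (c := a)).congr fun y hy ↦ ?_)
  exact triv_trivSymm hy a

theorem isMetricOn_hloc (p : N) : IsMetricOn (hloc n p) (chart n p).target where
  isOpen := (chart n p).open_target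
  smooth := by
    refine ContDiffOn.sum fun i _ ↦ ContDiffOn.sum fun j _ ↦ ContDiffOn.fun_smul ?_ contDiffOn_const
    have h1 : ContMDiffOn (𝓡 n) 𝓘(ℝ, ℝ) ∞ (fun y ↦ gram n p y i j) (chart n p).source :=
      ContMDiffOn.inner_bundle (IB := 𝓡 n) (F := EuclideanSpace ℝ (Fin n))
        (E := fun q : N ↦ TangentSpace (𝓡 n) q) (b := fun y ↦ y)
        (contMDiffOn_trivSymm p (EuclideanSpace.single i 1))
        (contMDiffOn_trivSymm p (EuclideanSpace.single j 1))
    refine (contDiffOn_locFun (p := p) h1).mono fun z hz ↦ ⟨hz, (chart n p).map_target hz⟩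
  symm := by
    intro z hz a b
    have := (chart n p).right_inv hz
    rw [← this, hloc_chart ((chart n p).map_target hz), hloc_chart ((chart n p).map_target hz),
      real_inner_comm]
  pos := by
    intro z hz a ha
    have := (chart n p).right_inv hz
    rw [← this, hloc_chart ((chart n p).map_target hz)]
    refine real_inner_self_pos.2 fun h0 ↦ ha ?_
    rw [← triv_trivSymm ((chart n p).map_target hz) a, h0, triv_zero ((chart n p).map_target hz)]

theorem gramOf_hloc (p : N) (z : EuclideanSpace ℝ (Fin n)) :
    gramOf (hloc n p) (stdB n) z = gram n p ((chart n p).symm z) := by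
  ext i j
  simp only [gramOf, Matrix.of_apply, hloc_apply, stdB, OrthonormalBasis.coe_toBasis,
    EuclideanSpace.basisFun_apply]
  simp

theorem metricDeriv_eq (q : N) (u v w : TangentSpace (𝓡 n) q) :
    metricDeriv q u v w
      = fderiv ℝ (hloc n q) (chart n q q) (triv q q u) (triv q q v) (triv q q w) := by
  have hq := mem_chart_source (EuclideanSpace ℝ (Fin n)) q
  have hz := (chart n q).map_source hq
  have hd : DifferentiableAt ℝ (hloc n q) (chart n q q) :=
    differentiableAt_of_contDiffOn (isMetricOn_hloc q).isOpen (isMetricOn_hloc q).smooth hz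
  have h2 := (hd.hasFDerivAt.clm_apply (hasFDerivAt_const (triv q q v) _)).clm_apply
    (hasFDerivAt_const (triv q q w) _)
  have h1 : locFun n q (fun y : N ↦ inner ℝ (coordField v y) (coordField w y))
      =ᶠ[𝓝 (chart n q q)] fun z ↦ hloc n q z (triv q q v) (triv q q w) := by
    filter_upwards [(isMetricOn_hloc q).isOpen.mem_nhds hz] with z hz'
    have hy := (chart n q).map_target hz'
    conv_rhs => rw [← (chart n q).right_inv hz']
    rw [hloc_chart hy, locFun, coordField_eq_trivSymm, coordField_eq_trivSymm, triv_self, triv_self]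
  rw [metricDeriv, mvfderiv_eq_fderiv_locFun hq (h2.congr_of_eventuallyEq h1).differentiableAt,
    (h2.congr_of_eventuallyEq h1).fderiv]
  simp

theorem triv_christoffel (q : N) (u v : TangentSpace (𝓡 n) q) :
    triv q q (christoffel q u v) = gam (hloc n q) (chart n q q) (triv q q u) (triv q q v) := by
  have hq := mem_chart_source (EuclideanSpace ℝ (Fin n)) q
  have hz := (chart n q).map_source hq
  have hh := isMetricOn_hloc (n := n) q
  refine hh.eq_of_forall hz fun c ↦ ?_
  obtain ⟨w, rfl⟩ : ∃ w : TangentSpace (𝓡 n) q, triv q q w = c := ⟨_, triv_trivSymm hq c⟩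
  rw [hloc_triv hq, hh.gam_spec hz, christoffel, sum_inner]
  have hw : triv q q w = ∑ k, inner ℝ (onb n q k) w • triv q q (onb n q k) := by
    conv_lhs => rw [← (onb n q).sum_repr' w]
    rw [triv_sum hq]
    simp_rw [triv_smul hq]
  rw [hw]
  simp only [map_sum, map_smul, sum_apply, smul_apply, smul_eq_mul, real_inner_smul_left,
    metricDeriv_eq, ← Finset.sum_add_distrib, ← Finset.sum_sub_distrib, Finset.sum_div]
  refine Finset.sum_congr rfl fun k _ ↦ ?_
  ring

/-! ### Changes of charts -/

section Transition

variable (n) in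
/-- The change of charts from `p` to `q`. -/
abbrev transition (p q : N) : EuclideanSpace ℝ (Fin n) → EuclideanSpace ℝ (Fin n) :=
  locMap n n p q (fun y : N ↦ y)

variable (n) in
/-- The domain of the change of charts from `p` to `q`. -/
abbrev overlap (p q : N) : Set (EuclideanSpace ℝ (Fin n)) := locSet n p (chart n q).source

theorem contDiffOn_transition (p q : N) : ContDiffOn ℝ ∞ (transition n p q) (overlap n p q) :=
  contDiffOn_locMap contMDiffOn_id (mapsTo_id _)

theorem mapsTo_transition (p q : N) :
    MapsTo (transition n p q) (overlap n p q) (chart n q).target :=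
  fun _ hz ↦ (chart n q).map_source hz.2

theorem fderiv_transition_triv {p q : N} {z : EuclideanSpace ℝ (Fin n)} (hz : z ∈ overlap n p q)
    (u : TangentSpace (𝓡 n) ((chart n p).symm z)) :
    fderiv ℝ (transition n p q) z (triv p _ u) = triv q _ u := by
  have := triv_eq_fderiv ((chart n p).map_target hz.1) hz.2 u
  rw [this, (chart n p).right_inv hz.1]

theorem fderiv_transition_bijective {p q : N} {z : EuclideanSpace ℝ (Fin n)}
    (hz : z ∈ overlap n p q) : Function.Bijective (fderiv ℝ (transition n p q) z) := by
  have hp := (chart n p).map_target hz.1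
  constructor
  · intro a b hab
    rw [← triv_trivSymm hp a, ← triv_trivSymm hp b, fderiv_transition_triv hz,
      fderiv_transition_triv hz] at hab
    have := triv_injective hz.2 hab
    rw [← triv_trivSymm hp a, this, triv_trivSymm hp]
  · intro c
    refine ⟨triv p ((chart n p).symm z) (trivSymm q ((chart n p).symm z) c), ?_⟩
    rw [fderiv_transition_triv hz, triv_trivSymm hz.2]

theorem transition_isometry {p q : N} {z : EuclideanSpace ℝ (Fin n)} (hz : z ∈ overlap n p q)
    (a b : EuclideanSpace ℝ (Fin n)) :
    hloc n q (transition n p q z) (fderiv ℝ (transition n p q) z a)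
      (fderiv ℝ (transition n p q) z b) = hloc n p z a b := by
  have hp := (chart n p).map_target hz.1
  rw [← triv_trivSymm hp a, ← triv_trivSymm hp b, fderiv_transition_triv hz,
    fderiv_transition_triv hz]
  have h1 := hloc_triv hp (trivSymm p ((chart n p).symm z) a) (trivSymm p ((chart n p).symm z) b)
  rw [(chart n p).right_inv hz.1] at h1
  rw [h1]
  exact hloc_triv hz.2 _ _

theorem isMetricOn_overlap (p q : N) : IsMetricOn (hloc n p) (overlap n p q) where
  isOpen := isOpen_locSet p (chart n q).open_source
  smooth := (isMetricOn_hloc p).smooth.mono inter_subset_left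
  symm z hz := (isMetricOn_hloc p).symm z hz.1
  pos z hz := (isMetricOn_hloc p).pos z hz.1

end Transition

/-- The covariant derivative along a map, in arbitrary charts. -/
theorem triv_covAlong {φ : M → N} {V : Π x : M, TangentSpace (𝓡 n) (φ x)} {U : Set M}
    (hU : IsOpen U) (hφ : ContMDiffOn (𝓡 m) (𝓡 n) ∞ φ U) {p x : M} {q : N} (hxU : x ∈ U)
    (hx : x ∈ (chart m p).source) (hq : φ x ∈ (chart n q).source)
    (hV : DifferentiableAt ℝ (locFun m p (components φ V q)) (chart m p x))
    (u : TangentSpace (𝓡 m) x) :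
    triv q (φ x) (covAlong φ V x u)
      = cov (hloc n q) (locMap m n p q φ) (locFun m p (components φ V q)) (chart m p x)
          (triv p x u) := by
  set r := φ x with hr
  have hrr : r ∈ (chart n r).source := mem_chart_source _ r
  have hcont : ContinuousOn φ U := hφ.continuousOn
  -- Here `φ` takes values both in the given chart at `q` and in the preferred chart at `r = φ x`,
  -- in which `covAlong` is defined.
  set U' : Set M := U ∩ φ ⁻¹' ((chart n q).source ∩ (chart n r).source) with hU'
  have hU'o : IsOpen U' := hcont.isOpen_inter_preimage hU
    ((chart n q).open_source.inter (chart n r).open_source)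
  have hxU' : x ∈ U' := ⟨hxU, hq, hrr⟩
  have hφ' : ContMDiffOn (𝓡 m) (𝓡 n) ∞ φ U' := hφ.mono inter_subset_left
  have hz : chart m p x ∈ locSet m p U' := (mem_locSet hx).2 hxU'
  have hO := isOpen_locSet (m := m) p hU'o
  have hxs : (chart m p).symm (chart m p x) = x := (chart m p).left_inv hx
  have fq : ContDiffOn ℝ ∞ (locMap m n p q φ) (locSet m p U') :=
    contDiffOn_locMap hφ' fun y hy ↦ hy.2.1
  have fr : ContDiffOn ℝ ∞ (locMap m n p r φ) (locSet m p U') :=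
    contDiffOn_locMap hφ' fun y hy ↦ hy.2.2
  have hov : ∀ z ∈ locSet m p U', locMap m n p q φ z ∈ overlap n q r := by
    intro z hz
    exact (mem_locSet hz.2.2.1).2 hz.2.2.2
  have e1 : locMap m n p r φ =ᶠ[𝓝 (chart m p x)]
      fun z ↦ transition n q r (locMap m n p q φ z) := by
    filter_upwards [hO.mem_nhds hz] with z hz'
    simp only [transition, locMap, (chart n q).left_inv hz'.2.2.1]
  have e2 : locFun m p (components φ V r) =ᶠ[𝓝 (chart m p x)]
      fun z ↦ fderiv ℝ (transition n q r) (locMap m n p q φ z)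
        (locFun m p (components φ V q) z) := by
    filter_upwards [hO.mem_nhds hz] with z hz'
    exact triv_eq_fderiv hz'.2.2.1 hz'.2.2.2 (V ((chart m p).symm z))
  have hfq := differentiableAt_of_contDiffOn hO fq hz
  have hdT : DifferentiableAt ℝ (fun z ↦ fderiv ℝ (transition n q r) (locMap m n p q φ z))
      (chart m p x) := by
    refine DifferentiableAt.comp (chart m p x) (g := fderiv ℝ (transition n q r)) ?_ hfq
    exact differentiableAt_of_contDiffOn (isMetricOn_overlap q r).isOpen
      ((contDiffOn_transition q r).fderiv_of_isOpen (isMetricOn_overlap q r).isOpen (by simp))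
      (hov _ hz)
  have hVr : DifferentiableAt ℝ (locFun m p (components φ V r)) (chart m p x) :=
    (hdT.clm_apply hV).congr_of_eventuallyEq e2
  -- In the chart at `r` the formula is the definition; the chart at `p` in the source enters
  -- through the chain rule only.
  have own : triv r r (covAlong φ V x u)
      = cov (hloc n r) (locMap m n p r φ) (locFun m p (components φ V r)) (chart m p x)
          (triv p x u) := by
    have hmd : MDifferentiableAt (𝓡 m) (𝓡 n) φ x :=
      (hφ.contMDiffAt (hU.mem_nhds hxU)).mdifferentiableAt (by simp)
    have h1 : triv r r (covAlong φ V x u)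
        = mvfderiv (𝓡 m) (components φ V r) x u
          + triv r r (christoffel r (mfderiv (𝓡 m) (𝓡 n) φ x u) (V x)) := by
      rw [triv_self, triv_self]; rfl
    rw [h1, mvfderiv_eq_fderiv_locFun hx hVr, triv_christoffel, cov,
      triv_mfderiv hx hrr hmd (differentiableAt_of_contDiffOn hO fr hz)]
    congr 2
    · rw [locMap, hxs]
    · rw [locFun, components_eq_triv, hxs]
  -- The change of charts from `q` to `r` is an isometry of the local metrics. Its differential is
  -- injective, so the identity in the chart at `r` can be pulled back to `q`.
  have htr := cov_transform (isMetricOn_overlap q r) (isMetricOn_hloc r)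
    (contDiffOn_transition q r) (mapsTo_transition q r) (fun y hy ↦ transition_isometry hy)
    (fun y hy ↦ (fderiv_transition_bijective hy).2) (hov _ hz) hfq hV (triv p x u)
  rw [← cov_congr_of_eventuallyEq e1 e2, ← own] at htr
  refine (fderiv_transition_bijective (hov _ hz)).1 ?_
  rw [← htr, triv_eq_fderiv hq hrr, locMap, hxs]

end ChartMetric

/-! ## Tension field, gradient, Laplacian and curvature in charts -/

section Dictionary

variable {m n : ℕ} {M : Type*} [TopologicalSpace M]
  [ChartedSpace (EuclideanSpace ℝ (Fin m)) M] [IsManifold (𝓡 m) ∞ M]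
  {N : Type*} [TopologicalSpace N] [ChartedSpace (EuclideanSpace ℝ (Fin n)) N]
  [IsManifold (𝓡 n) ∞ N]
  [RiemannianBundle (fun x : M ↦ TangentSpace (𝓡 m) x)]
  [RiemannianBundle (fun q : N ↦ TangentSpace (𝓡 n) q)]

theorem contDiffOn_components {φ : M → N} {V : Π x : M, TangentSpace (𝓡 n) (φ x)} {U : Set M}
    {p : M} {q : N} (hV : ContMDiffOn (𝓡 m) (𝓡 n).tangent ∞
      (fun x ↦ (⟨φ x, V x⟩ : TangentBundle (𝓡 n) N)) U) (hq : MapsTo φ U (chart n q).source) :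
    ContDiffOn ℝ ∞ (locFun m p (components φ V q)) (locSet m p U) := by
  refine contDiffOn_locFun ?_
  have h := ((trivializationAt (EuclideanSpace ℝ (Fin n))
    (TangentSpace (𝓡 n) (M := N)) q).contMDiffOn_iff (IB := 𝓡 n) (IM := 𝓡 m) (n := ∞)
    (f := fun x ↦ (⟨φ x, V x⟩ : TangentBundle (𝓡 n) N)) (s := U) ?_).1 hV
  · exact h.2
  · intro x hx
    rw [Trivialization.mem_source]
    exact hq hx

variable [IsContMDiffRiemannianBundle (𝓡 m) ∞ (EuclideanSpace ℝ (Fin m))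
    (fun x : M ↦ TangentSpace (𝓡 m) x)]
  [IsContMDiffRiemannianBundle (𝓡 n) ∞ (EuclideanSpace ℝ (Fin n))
    (fun q : N ↦ TangentSpace (𝓡 n) q)]

theorem triv_eq_sum_onb {q y : N} (hy : y ∈ (chart n q).source) (v : EuclideanSpace ℝ (Fin n)) :
    v = ∑ k, hloc n q (chart n q y) v (triv q y (onb n y k)) • triv q y (onb n y k) := by
  obtain ⟨w, rfl⟩ : ∃ w : TangentSpace (𝓡 n) y, triv q y w = v := ⟨_, triv_trivSymm hy v⟩
  simp_rw [hloc_triv hy]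
  conv_lhs => rw [← (onb n y).sum_repr' w, triv_sum hy]
  simp_rw [triv_smul hy, real_inner_comm]

/-- Passes from traces over pointwise orthonormal bases, which carry no smoothness, to traces in the
constant frame and its smooth dual. -/
theorem sum_onb_eq {q y : N} (hy : y ∈ (chart n q).source) {G : Type*} [AddCommGroup G]
    [Module ℝ G] (B : EuclideanSpace ℝ (Fin n) →ₗ[ℝ] EuclideanSpace ℝ (Fin n) →ₗ[ℝ] G) :
    ∑ k, B (triv q y (onb n y k)) (triv q y (onb n y k))
      = ∑ i, B (stdB n i) (dualVec (hloc n q) (stdB n) i (chart n q y)) :=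
  (sum_dualFrame_eq (fun v w ↦ hloc n q (chart n q y) v w)
    (fun v w ↦ (isMetricOn_hloc q).symm _ ((chart n q).map_source hy) v w)
    (fun v ↦ ((isMetricOn_hloc q).sum_dualVec_smul ((chart n q).map_source hy) v).symm)
    (fun v ↦ triv_eq_sum_onb hy v) B).symm

theorem locMap_id_eventuallyEq {q y : N} (hy : y ∈ (chart n q).source) :
    locMap n n q q (fun y : N ↦ y) =ᶠ[𝓝 (chart n q y)] fun z ↦ z := by
  filter_upwards [(chart n q).open_target.mem_nhds ((chart n q).map_source hy)] with z hz
  exact (chart n q).right_inv hz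

theorem triv_leviCivita {Y : Π y : N, TangentSpace (𝓡 n) y} {q y : N}
    (hy : y ∈ (chart n q).source)
    (hY : DifferentiableAt ℝ (locFun n q (components (fun y ↦ y) Y q)) (chart n q y))
    (u : TangentSpace (𝓡 n) y) :
    triv q y (leviCivita Y y u) = cov (hloc n q) (fun z ↦ z)
      (locFun n q (components (fun y ↦ y) Y q)) (chart n q y) (triv q y u) := by
  have h := triv_covAlong (φ := fun y : N ↦ y) (V := Y) isOpen_univ contMDiffOn_id (mem_univ y) hy
    hy hY u
  rw [leviCivita, h]
  exact cov_congr_of_eventuallyEq (locMap_id_eventuallyEq hy) Filter.EventuallyEq.rfl _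

theorem contDiffOn_coordField {x p : M} (v : TangentSpace (𝓡 m) x) :
    ContDiffOn ℝ ∞ (locFun m p (components (fun y ↦ y) (coordField v) p))
      (locSet m p ((chart m x).source ∩ (chart m p).source)) := by
  refine contDiffOn_components (φ := fun y : M ↦ y) ?_ fun y hy ↦ hy.2
  refine ((contMDiffOn_trivSymm x v).mono inter_subset_left).congr fun y _ ↦ ?_
  rw [coordField_eq_trivSymm]

section Map

variable {φ : M → N} {U : Set M} {p x : M} {q : N}

theorem isOpen_inter_charts (hU : IsOpen U) (hφ : ContMDiffOn (𝓡 m) (𝓡 n) ∞ φ U) (q : N) :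
    IsOpen (U ∩ φ ⁻¹' (chart n q).source) :=
  hφ.continuousOn.isOpen_inter_preimage hU (chart n q).open_source

theorem contDiffOn_locMap_inter (hφ : ContMDiffOn (𝓡 m) (𝓡 n) ∞ φ U) (p : M) (q : N) :
    ContDiffOn ℝ ∞ (locMap m n p q φ) (locSet m p (U ∩ φ ⁻¹' (chart n q).source)) :=
  contDiffOn_locMap (hφ.mono inter_subset_left) fun _ hy ↦ hy.2

theorem triv_mfderiv_of_mem (hU : IsOpen U) (hφ : ContMDiffOn (𝓡 m) (𝓡 n) ∞ φ U) (hxU : x ∈ U)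
    (hx : x ∈ (chart m p).source) (hq : φ x ∈ (chart n q).source) (u : TangentSpace (𝓡 m) x) :
    triv q (φ x) (mfderiv (𝓡 m) (𝓡 n) φ x u)
      = fderiv ℝ (locMap m n p q φ) (chart m p x) (triv p x u) :=
  triv_mfderiv hx hq ((hφ.contMDiffAt (hU.mem_nhds hxU)).mdifferentiableAt (by simp))
    (differentiableAt_of_contDiffOn (isOpen_locSet p (isOpen_inter_charts hU hφ q))
      (contDiffOn_locMap_inter hφ p q) ((mem_locSet hx).2 ⟨hxU, hq⟩)) u

/-- The extension of `v` to a field $Y$ is immaterial: $\nabla_u(df\,Y)=B(u,Y)+df(\nabla_uY)$, and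
the last term is subtracted in the definition. -/
theorem triv_secondFundamentalForm (hU : IsOpen U) (hφ : ContMDiffOn (𝓡 m) (𝓡 n) ∞ φ U)
    (hxU : x ∈ U) (hx : x ∈ (chart m p).source) (hq : φ x ∈ (chart n q).source)
    (u v : TangentSpace (𝓡 m) x) :
    triv q (φ x) (secondFundamentalForm φ x u v)
      = sff (hloc m p) (hloc n q) (locMap m n p q φ) (chart m p x) (triv p x u) (triv p x v) := by
  have hO := isOpen_locSet (m := m) p (isOpen_inter_charts hU hφ q)
  have hz : chart m p x ∈ locSet m p (U ∩ φ ⁻¹' (chart n q).source) := (mem_locSet hx).2 ⟨hxU, hq⟩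
  have hf := contDiffOn_locMap_inter hφ p q
  have hxs : (chart m p).symm (chart m p x) = x := (chart m p).left_inv hx
  have hYc := contDiffOn_coordField (p := p) v
  have hYo := isOpen_locSet (m := m) p ((chart m x).open_source.inter (chart m p).open_source)
  have hYz : chart m p x ∈ locSet m p ((chart m x).source ∩ (chart m p).source) :=
    (mem_locSet hx).2 ⟨mem_chart_source _ x, hx⟩
  have hYd := differentiableAt_of_contDiffOn hYo hYc hYz
  have e : locFun m p (components φ (fun y ↦ mfderiv (𝓡 m) (𝓡 n) φ y (coordField v y)) q)
      =ᶠ[𝓝 (chart m p x)] fun z ↦ fderiv ℝ (locMap m n p q φ) z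
        (locFun m p (components (fun y ↦ y) (coordField v) p) z) := by
    filter_upwards [hO.mem_nhds hz] with z hz'
    have h1 := triv_mfderiv_of_mem (p := p) (q := q) hU hφ hz'.2.1 ((chart m p).map_target hz'.1)
      hz'.2.2 (coordField v ((chart m p).symm z))
    rw [(chart m p).right_inv hz'.1] at h1
    exact h1
  have hd2 : DifferentiableAt ℝ (fderiv ℝ (locMap m n p q φ)) (chart m p x) :=
    differentiableAt_of_contDiffOn hO (hf.fderiv_of_isOpen hO (by simp)) hz
  have hd : DifferentiableAt ℝ (locFun m p (components φ
      (fun y ↦ mfderiv (𝓡 m) (𝓡 n) φ y (coordField v y)) q)) (chart m p x) :=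
    (hd2.clm_apply hYd).congr_of_eventuallyEq e
  rw [secondFundamentalForm, triv_sub hq, triv_covAlong hU hφ hxU hx hq hd,
    cov_congr_of_eventuallyEq Filter.EventuallyEq.rfl e,
    cov_pushforward (g := hloc m p) hO hf hz hYd, triv_mfderiv_of_mem hU hφ hxU hx hq,
    triv_leviCivita hx hYd, add_sub_cancel_right]
  congr 1
  rw [locFun, hxs, components_eq_triv, coordField_eq_trivSymm]
  congr 1
  have := trivSymm_triv (mem_chart_source (EuclideanSpace ℝ (Fin m)) x) v
  rwa [triv_self] at this

theorem triv_tension (hU : IsOpen U) (hφ : ContMDiffOn (𝓡 m) (𝓡 n) ∞ φ U)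
    (hxU : x ∈ U) (hx : x ∈ (chart m p).source) (hq : φ x ∈ (chart n q).source) :
    triv q (φ x) (tension m n φ x)
      = tens (hloc m p) (hloc n q) (stdB m) (locMap m n p q φ) (chart m p x) := by
  rw [tension, triv_sum hq]
  simp_rw [triv_secondFundamentalForm hU hφ hxU hx hq]
  exact sum_onb_eq hx (LinearMap.mk₂ ℝ
    (fun a c ↦ sff (hloc m p) (hloc n q) (locMap m n p q φ) (chart m p x) a c)
    (by simp) (by simp) (by simp) (by simp))

theorem norm_tension_sq (hU : IsOpen U) (hφ : ContMDiffOn (𝓡 m) (𝓡 n) ∞ φ U)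
    (hxU : x ∈ U) (hx : x ∈ (chart m p).source) (hq : φ x ∈ (chart n q).source) :
    ‖tension m n φ x‖ ^ 2 = hloc n q (locMap m n p q φ (chart m p x))
      (tens (hloc m p) (hloc n q) (stdB m) (locMap m n p q φ) (chart m p x))
      (tens (hloc m p) (hloc n q) (stdB m) (locMap m n p q φ) (chart m p x)) := by
  rw [← real_inner_self_eq_norm_sq, ← hloc_triv hq, triv_tension hU hφ hxU hx hq, locMap,
    (chart m p).left_inv hx]

end Map

section Functions

variable {H : M → ℝ} {U : Set M} {p x : M}

theorem triv_grad (hx : x ∈ (chart m p).source)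
    (hH : DifferentiableAt ℝ (locFun m p H) (chart m p x)) :
    triv p x (grad m H x) = sharp (hloc m p) (chart m p x)
      (fderiv ℝ (locFun m p H) (chart m p x)) := by
  have hz := (chart m p).map_source hx
  refine (isMetricOn_hloc p).eq_of_forall hz fun c ↦ ?_
  obtain ⟨w, rfl⟩ : ∃ w : TangentSpace (𝓡 m) x, triv p x w = c := ⟨_, triv_trivSymm hx c⟩
  rw [(isMetricOn_hloc p).sharp_spec hz, hloc_triv hx, grad, InnerProductSpace.toDual_symm_apply,
    mvfderiv_eq_fderiv_locFun hx hH]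

theorem inner_grad (hx : x ∈ (chart m p).source)
    (hH : DifferentiableAt ℝ (locFun m p H) (chart m p x)) (w : TangentSpace (𝓡 m) x) :
    inner ℝ (grad m H x) w = fderiv ℝ (locFun m p H) (chart m p x) (triv p x w) := by
  rw [grad, InnerProductSpace.toDual_symm_apply, mvfderiv_eq_fderiv_locFun hx hH]

/-- By metric compatibility $\langle\nabla_u\operatorname{grad}H,w\rangle$ is the Hessian of $H$,
whose trace is the divergence of the form $dH$. -/
theorem laplacian_eq (hU : IsOpen U) (hL : ContDiffOn ℝ ∞ (locFun m p H) (locSet m p U)) (hxU : x ∈ U)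
    (hx : x ∈ (chart m p).source) :
    laplacian m H x = divForm (hloc m p) (stdB m) (fderiv ℝ (locFun m p H)) (chart m p x) := by
  have hz := (chart m p).map_source hx
  have hg := isMetricOn_hloc (n := m) p
  have hO := isOpen_locSet (m := m) p hU
  have hzO : chart m p x ∈ locSet m p U := (mem_locSet hx).2 hxU
  have hα : ContDiffOn ℝ ∞ (fderiv ℝ (locFun m p H)) (locSet m p U) :=
    hL.fderiv_of_isOpen hO (by simp)
  have hαd := differentiableAt_of_contDiffOn hO hα hzO
  have e : locFun m p (components (fun y : M ↦ y) (grad m H) p) =ᶠ[𝓝 (chart m p x)]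
      fun z ↦ sharp (hloc m p) z (fderiv ℝ (locFun m p H) z) := by
    filter_upwards [hO.mem_nhds hzO] with z hz'
    have h1 := triv_grad (H := H) ((chart m p).map_target hz'.1) (by
      rw [(chart m p).right_inv hz'.1]
      exact differentiableAt_of_contDiffOn hO hL hz')
    rw [(chart m p).right_inv hz'.1] at h1
    exact h1
  have hsd : DifferentiableAt ℝ (fun z ↦ sharp (hloc m p) z (fderiv ℝ (locFun m p H) z))
      (chart m p x) :=
    (differentiableAt_of_contDiffOn hg.isOpen hg.contDiffOn_sharp hz).clm_apply hαd
  have key : ∀ u w : TangentSpace (𝓡 m) x, inner ℝ (leviCivita (grad m H) x u) w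
      = fderiv ℝ (fderiv ℝ (locFun m p H)) (chart m p x) (triv p x u) (triv p x w)
        - fderiv ℝ (locFun m p H) (chart m p x)
          (gam (hloc m p) (chart m p x) (triv p x u) (triv p x w)) := by
    intro u w
    rw [← hloc_triv hx, triv_leviCivita hx (hsd.congr_of_eventuallyEq e),
      cov_congr_of_eventuallyEq Filter.EventuallyEq.rfl e]
    have h1 := fderiv_metric (f := fun z ↦ z) (Z := fun _ ↦ triv p x w) hg hz differentiableAt_id
      hsd (differentiableAt_const _) (triv p x u)
    have h2 : (fun z ↦ hloc m p z (sharp (hloc m p) z (fderiv ℝ (locFun m p H) z)) (triv p x w))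
        =ᶠ[𝓝 (chart m p x)] fun z ↦ fderiv ℝ (locFun m p H) z (triv p x w) := by
      filter_upwards [hg.isOpen.mem_nhds hz] with z hz'
      rw [hg.sharp_spec hz']
    rw [h2.fderiv_eq, (hαd.hasFDerivAt.clm_apply (hasFDerivAt_const _ _)).fderiv, cov_const,
      hg.sharp_spec hz] at h1
    simp at h1
    rw [h1]; ring
  rw [laplacian]
  simp_rw [key]
  exact sum_onb_eq hx (LinearMap.mk₂ ℝ
    (fun a c ↦ fderiv ℝ (fderiv ℝ (locFun m p H)) (chart m p x) a c
      - fderiv ℝ (locFun m p H) (chart m p x) (gam (hloc m p) (chart m p x) a c))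
    (by intros; simp; ring) (by intros; simp; ring) (by intros; simp; ring)
    (by intros; simp; ring))

end Functions

end Dictionary

/-! ## Curvature in charts -/

section CurvatureDictionary

variable {n : ℕ} {N : Type*} [TopologicalSpace N] [ChartedSpace (EuclideanSpace ℝ (Fin n)) N]
  [IsManifold (𝓡 n) ∞ N]
  [RiemannianBundle (fun q : N ↦ TangentSpace (𝓡 n) q)]

theorem mlieBracket_coordField {q : N} (u v : TangentSpace (𝓡 n) q) :
    VectorField.mlieBracket (𝓡 n) (coordField u) (coordField v) q = 0 := by
  have hq := mem_chart_source (EuclideanSpace ℝ (Fin n)) q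
  -- Pulled back to the chart, a coordinate field is constant, so the bracket is that of constant
  -- fields.
  have key : ∀ w : TangentSpace (𝓡 n) q,
      VectorField.mpullbackWithin 𝓘(ℝ, EuclideanSpace ℝ (Fin n)) (𝓡 n) (extChartAt (𝓡 n) q).symm
        (coordField w) (range (𝓡 n)) =ᶠ[𝓝 (chart n q q)]
        fun _ ↦ (show EuclideanSpace ℝ (Fin n) from w) := by
    intro w
    filter_upwards [(chart n q).open_target.mem_nhds ((chart n q).map_source hq)] with z hz
    have hy := (chart n q).map_target hz
    rw [VectorField.mpullbackWithin_apply]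
    have h1 : z ∈ (extChartAt (𝓡 n) q).target := by simpa using hz
    have h2 := isInvertible_mfderivWithin_extChartAt_symm h1
    refine h2.inverse_apply_eq.2 ?_
    have h3 := mfderiv_extChartAt_comp_mfderivWithin_extChartAt_symm h1
    have h4 := congrArg (fun L : EuclideanSpace ℝ (Fin n) →L[ℝ] EuclideanSpace ℝ (Fin n) ↦
      L (show EuclideanSpace ℝ (Fin n) from w)) h3
    refine triv_injective (p := q) hy ?_
    refine (triv_coordField hy w).trans ?_
    exact h4.symm.trans (triv_eq_mfderiv hy _).symm
  have h0 : ∀ (V W : EuclideanSpace ℝ (Fin n) → EuclideanSpace ℝ (Fin n)) (a b z : _) (s : Set _),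
      s = univ → V =ᶠ[𝓝 z] (fun _ ↦ a) → W =ᶠ[𝓝 z] (fun _ ↦ b) →
      VectorField.lieBracketWithin ℝ V W s z = 0 := by
    rintro V W a b z s rfl hV hW
    rw [VectorField.lieBracketWithin_univ, hV.lieBracket_vectorField_eq hW]
    simp [VectorField.lieBracket]
  rw [VectorField.mlieBracket, VectorField.mlieBracketWithin_apply]
  exact (congrArg _ (h0 _ _ _ _ _ _ (by simp) (key u) (key v))).trans (map_zero _)

variable [IsContMDiffRiemannianBundle (𝓡 n) ∞ (EuclideanSpace ℝ (Fin n))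
    (fun q : N ↦ TangentSpace (𝓡 n) q)]

theorem components_coordField {q y : N} (hy : y ∈ (chart n q).source) (v : TangentSpace (𝓡 n) q) :
    locFun n q (components (fun y : N ↦ y) (coordField v) q) =ᶠ[𝓝 (chart n q y)]
      fun _ ↦ (show EuclideanSpace ℝ (Fin n) from v) := by
  filter_upwards [(chart n q).open_target.mem_nhds ((chart n q).map_source hy)] with z hz
  exact triv_coordField ((chart n q).map_target hz) v

theorem triv_curvature_self (q : N) (u v w : TangentSpace (𝓡 n) q) :
    triv q q (curvature q u v w)
      = curv (hloc n q) (chart n q q) (triv q q u) (triv q q v) (triv q q w) := by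
  have hq := mem_chart_source (EuclideanSpace ℝ (Fin n)) q
  have hz := (chart n q).map_source hq
  have hg := isMetricOn_hloc (n := n) q
  have hid : ContDiffOn ℝ ∞ (fun z : EuclideanSpace ℝ (Fin n) ↦ z) (chart n q).target :=
    contDiffOn_id
  have hmid := mapsTo_id (chart n q).target
  have inner : ∀ a b : TangentSpace (𝓡 n) q,
      locFun n q (components (fun y : N ↦ y)
        (fun y ↦ leviCivita (coordField a) y (coordField b y)) q) =ᶠ[𝓝 (chart n q q)]
      fun z ↦ cov (hloc n q) (fun z ↦ z) (fun _ ↦ triv q q a) z (triv q q b) := by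
    intro a b
    filter_upwards [(chart n q).open_target.mem_nhds hz] with z hz'
    have hy := (chart n q).map_target hz'
    have e := components_coordField hy a
    rw [locFun, components_eq_triv, triv_leviCivita hy
      ((differentiableAt_const _).congr_of_eventuallyEq e),
      cov_congr_of_eventuallyEq Filter.EventuallyEq.rfl e, (chart n q).right_inv hz',
      triv_coordField hy, triv_self, triv_self]
  have outer : ∀ a b c : TangentSpace (𝓡 n) q,
      triv q q (leviCivita (fun y ↦ leviCivita (coordField a) y (coordField b y)) q c)
        = cov (hloc n q) (fun z ↦ z)
          (fun z ↦ cov (hloc n q) (fun z ↦ z) (fun _ ↦ triv q q a) z (triv q q b))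
          (chart n q q) (triv q q c) := by
    intro a b c
    have hd := differentiableAt_of_contDiffOn hg.isOpen (contDiffOn_cov hg hg.isOpen hid hmid
      (contDiffOn_const (c := triv q q a)) (contDiffOn_const (c := triv q q b))) hz
    rw [triv_leviCivita hq (hd.congr_of_eventuallyEq (inner a b)),
      cov_congr_of_eventuallyEq Filter.EventuallyEq.rfl (inner a b)]
  have hself : ∀ a : TangentSpace (𝓡 n) q, coordField a q = a := by
    intro a
    rw [coordField_eq_trivSymm]
    have := trivSymm_triv hq a
    rwa [triv_self] at this
  have h0 : leviCivita (coordField w) q 0 = 0 := by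
    have e := components_coordField hq w
    refine triv_injective hq ?_
    rw [triv_leviCivita hq ((differentiableAt_const _).congr_of_eventuallyEq e), triv_zero hq,
      cov_zero_right]
  rw [curvature, curvatureField, mlieBracket_coordField, h0, sub_zero, triv_sub hq, hself, hself,
    outer, outer]
  have := cov_cov_sub hg hg.isOpen hid hmid (contDiffOn_const (c := triv q q w)) hz
    (triv q q u) (triv q q v)
  simpa only [fderiv_fun_id, ContinuousLinearMap.id_apply] using this

theorem triv_curvature {q y : N} (hy : y ∈ (chart n q).source) (u v w : TangentSpace (𝓡 n) y) :
    triv q y (curvature y u v w)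
      = curv (hloc n q) (chart n q y) (triv q y u) (triv q y v) (triv q y w) := by
  have hyy := mem_chart_source (EuclideanSpace ℝ (Fin n)) y
  have hz : chart n y y ∈ overlap n y q := (mem_locSet hyy).2 hy
  have h := curv_transform (isMetricOn_overlap y q) (isMetricOn_hloc q)
    (contDiffOn_transition y q) (mapsTo_transition y q) (fun _ hy ↦ transition_isometry hy)
    (fun _ hy ↦ (fderiv_transition_bijective hy).2) hz (triv y y u) (triv y y v) (triv y y w)
  rw [← triv_curvature_self, ← triv_eq_fderiv hyy hy, ← triv_eq_fderiv hyy hy,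
    ← triv_eq_fderiv hyy hy, ← triv_eq_fderiv hyy hy] at h
  rw [← h]
  simp only [transition, locMap, (chart n y).left_inv hyy]

/-- Arbitrary dual frames are admitted because for a hypersurface the trace is taken in the frame
formed by the unit normal and the images of a basis and of its dual. -/
theorem ricci_eq_sum {q y : N} (hy : y ∈ (chart n q).source) {κ : Type*} [Fintype κ]
    {a b : κ → EuclideanSpace ℝ (Fin n)}
    (hab : ∀ v, v = ∑ i, hloc n q (chart n q y) v (b i) • a i) (z w : TangentSpace (𝓡 n) y) :
    ricci y z w = ∑ i, hloc n q (chart n q y)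
      (curv (hloc n q) (chart n q y) (a i) (triv q y z) (triv q y w)) (b i) := by
  have hz := (chart n q).map_source hy
  rw [ricci]
  simp_rw [← hloc_triv hy, triv_curvature hy]
  exact (sum_dualFrame_eq (fun v w ↦ hloc n q (chart n q y) v w)
    (fun v w ↦ (isMetricOn_hloc q).symm _ hz v w) hab (fun v ↦ triv_eq_sum_onb hy v)
    (LinearMap.mk₂ ℝ (fun c d ↦ hloc n q (chart n q y)
      (curv (hloc n q) (chart n q y) c (triv q y z) (triv q y w)) d)
      (fun _ _ _ ↦ by rw [curv_add_left, map_add, add_apply])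
      (fun _ _ _ ↦ by rw [curv_smul_left, map_smul, smul_apply])
      (fun _ _ _ ↦ by rw [map_add]) (fun _ _ _ ↦ by rw [map_smul]))).symm

theorem inner_ricciOp (q : N) (z w : TangentSpace (𝓡 n) q) :
    inner ℝ (ricciOp q z) w = ricci q z w := by
  have hq := mem_chart_source (EuclideanSpace ℝ (Fin n)) q
  have hadd : ∀ w w', ricci q z (w + w') = ricci q z w + ricci q z w' := by
    intro w w'
    simp only [ricci, ← hloc_triv hq, triv_curvature hq, triv_add hq, curv_add_right, map_add,
      add_apply, Finset.sum_add_distrib]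
  have hsmul : ∀ (c : ℝ) w, ricci q z (c • w) = c • ricci q z w := by
    intro c w
    simp only [ricci, ← hloc_triv hq, triv_curvature hq, triv_smul hq, curv_smul_right, map_smul,
      smul_apply, Finset.smul_sum]
  let L : TangentSpace (𝓡 n) q →ₗ[ℝ] ℝ :=
    { toFun := ricci q z, map_add' := hadd, map_smul' := hsmul }
  have h1 : L w = ∑ k, inner ℝ (onb n q k) w • L (onb n q k) := by
    conv_lhs => rw [← (onb n q).sum_repr' w, map_sum]
    simp_rw [map_smul]
  rw [ricciOp, sum_inner]
  simp_rw [real_inner_smul_left]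
  refine Eq.trans ?_ h1.symm
  refine Finset.sum_congr rfl fun k _ ↦ ?_
  rw [smul_eq_mul, mul_comm]; rfl

end CurvatureDictionary

/-! ## The equations of biharmonic hypersurfaces in charts -/

theorem IsMetricOn.mono {F : Type*} [NormedAddCommGroup F] [NormedSpace ℝ F]
    {h : F → F →L[ℝ] F →L[ℝ] ℝ} {W W' : Set F} (hh : IsMetricOn h W) (hW' : IsOpen W')
    (hs : W' ⊆ W) : IsMetricOn h W' where
  isOpen := hW'
  smooth := hh.smooth.mono hs
  symm z hz := hh.symm z (hs hz)
  pos z hz := hh.pos z (hs hz)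

/-- A hyperplane together with a unit normal spans the space. -/
theorem exists_add_smul_of_finrank {E F : Type*} [AddCommGroup E] [Module ℝ E]
    [FiniteDimensional ℝ E] [AddCommGroup F] [Module ℝ F] [FiniteDimensional ℝ F]
    (hd : Module.finrank ℝ F = Module.finrank ℝ E + 1) (B : F →ₗ[ℝ] F →ₗ[ℝ] ℝ)
    (L : E →ₗ[ℝ] F) (hL : Function.Injective L) {ξ : F} (hξ : B ξ ξ = 1)
    (hn : ∀ a, B (L a) ξ = 0) (v : F) : ∃ a, ∃ s : ℝ, v = L a + s • ξ := by
  let T : E × ℝ →ₗ[ℝ] F := L.coprod (LinearMap.toSpanSingleton ℝ F ξ)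
  have hT : ∀ a s, T (a, s) = L a + s • ξ := fun a s ↦ by simp [T]
  have hinj : Function.Injective T := by
    rw [← LinearMap.ker_eq_bot, LinearMap.ker_eq_bot']
    rintro ⟨a, s⟩ h0
    rw [hT] at h0
    have h1 : s = 0 := by
      have := congrArg (fun w ↦ B w ξ) h0
      simpa [hn, hξ] using this
    subst h1
    have h2 : a = 0 := hL (by simpa using h0)
    rw [h2]; rfl
  have hs : Function.Surjective T :=
    (LinearMap.injective_iff_surjective_of_finrank_eq_finrank (by simp [hd])).1 hinj
  obtain ⟨⟨a, s⟩, h⟩ := hs v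
  exact ⟨a, s, by rw [← h, hT]⟩

section HypersurfaceDictionary

variable {m : ℕ} {M : Type*} [TopologicalSpace M]
  [ChartedSpace (EuclideanSpace ℝ (Fin m)) M] [IsManifold (𝓡 m) ∞ M]
  {N : Type*} [TopologicalSpace N] [ChartedSpace (EuclideanSpace ℝ (Fin (m + 1))) N]
  [IsManifold (𝓡 (m + 1)) ∞ N]
  [RiemannianBundle (fun x : M ↦ TangentSpace (𝓡 m) x)]
  [RiemannianBundle (fun q : N ↦ TangentSpace (𝓡 (m + 1)) q)]
  [IsContMDiffRiemannianBundle (𝓡 m) ∞ (EuclideanSpace ℝ (Fin m))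
    (fun x : M ↦ TangentSpace (𝓡 m) x)]
  [IsContMDiffRiemannianBundle (𝓡 (m + 1)) ∞ (EuclideanSpace ℝ (Fin (m + 1)))
    (fun q : N ↦ TangentSpace (𝓡 (m + 1)) q)]
  {φ : M → N} {U : Set M} {ξ : Π x : M, TangentSpace (𝓡 (m + 1)) (φ x)} {H : M → ℝ}

/-- For `m = 0` the factor `1 / m` is zero, but then the trace is an empty sum. -/
theorem tension_eq_smul (x : M) : tension m (m + 1) φ x = (m : ℝ) • meanCurvatureVector m φ x := by
  rcases Nat.eq_zero_or_pos m with rfl | hm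
  · have : IsEmpty (Fin (Module.finrank ℝ (TangentSpace (𝓡 0) x))) := by
      have h0 : Module.finrank ℝ (TangentSpace (𝓡 0) x) = 0 := finrank_euclideanSpace_fin
      rw [h0]; infer_instance
    simp [tension]
  · rw [meanCurvatureVector, smul_smul, mul_one_div_cancel (by positivity), one_smul, tension]

theorem fderiv_locMap (hφ : ContMDiff (𝓡 m) (𝓡 (m + 1)) ∞ φ) {p : M} {q : N}
    {z : EuclideanSpace ℝ (Fin m)} (hz : z ∈ (chart m p).target)
    (hq : φ ((chart m p).symm z) ∈ (chart (m + 1) q).source) (a : EuclideanSpace ℝ (Fin m)) :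
    fderiv ℝ (locMap m (m + 1) p q φ) z a = triv q (φ ((chart m p).symm z))
      (mfderiv (𝓡 m) (𝓡 (m + 1)) φ ((chart m p).symm z) (trivSymm p ((chart m p).symm z) a)) := by
  have hx := (chart m p).map_target hz
  rw [triv_mfderiv_of_mem (p := p) isOpen_univ hφ.contMDiffOn (mem_univ _) hx hq, triv_trivSymm hx,
    (chart m p).right_inv hz]

theorem hloc_fderiv_locMap (hφ : IsIsometricImmersion m (m + 1) φ) {p : M} {q : N}
    {z : EuclideanSpace ℝ (Fin m)} (hz : z ∈ (chart m p).target)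
    (hq : φ ((chart m p).symm z) ∈ (chart (m + 1) q).source) (a b : EuclideanSpace ℝ (Fin m)) :
    hloc (m + 1) q (locMap m (m + 1) p q φ z) (fderiv ℝ (locMap m (m + 1) p q φ) z a)
      (fderiv ℝ (locMap m (m + 1) p q φ) z b) = hloc m p z a b := by
  have hx := (chart m p).map_target hz
  rw [fderiv_locMap hφ.smooth hz hq, fderiv_locMap hφ.smooth hz hq, locMap, hloc_triv hq,
    hφ.inner_eq, ← hloc_triv hx, (chart m p).right_inv hz, triv_trivSymm hx, triv_trivSymm hx]

theorem isLocalHypersurface_of_normal (hφ : IsIsometricImmersion m (m + 1) φ) (hU : IsOpen U)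
    (hξ : ContMDiffOn (𝓡 m) (𝓡 (m + 1)).tangent ∞
      (fun x ↦ (⟨φ x, ξ x⟩ : TangentBundle (𝓡 (m + 1)) N)) U) (h1 : ∀ x ∈ U, ‖ξ x‖ = 1)
    (h0 : ∀ x ∈ U, ∀ u : TangentSpace (𝓡 m) x,
      inner ℝ (mfderiv (𝓡 m) (𝓡 (m + 1)) φ x u) (ξ x) = 0) (p : M) (q : N) :
    IsLocalHypersurface (hloc m p) (locSet m p (U ∩ φ ⁻¹' (chart (m + 1) q).source))
      (hloc (m + 1) q) (chart (m + 1) q).target (locMap m (m + 1) p q φ)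
      (locFun m p (components φ ξ q)) := by
  have hsm := hφ.smooth.contMDiffOn (s := U)
  have hO := isOpen_locSet (m := m) p (isOpen_inter_charts hU hsm q)
  have hchart : ∀ z ∈ locSet m p (U ∩ φ ⁻¹' (chart (m + 1) q).source),
      chart m p ((chart m p).symm z) = z := fun z hz ↦ (chart m p).right_inv hz.1
  have hd : ∀ z ∈ locSet m p (U ∩ φ ⁻¹' (chart (m + 1) q).source), ∀ a,
      fderiv ℝ (locMap m (m + 1) p q φ) z a = triv q (φ ((chart m p).symm z))
        (mfderiv (𝓡 m) (𝓡 (m + 1)) φ ((chart m p).symm z) (trivSymm p ((chart m p).symm z) a)) :=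
    fun z hz a ↦ fderiv_locMap hφ.smooth hz.1 hz.2.2 a
  have hm1 : ∀ z ∈ locSet m p (U ∩ φ ⁻¹' (chart (m + 1) q).source), ∀ a b,
      hloc (m + 1) q (locMap m (m + 1) p q φ z) (fderiv ℝ (locMap m (m + 1) p q φ) z a)
        (fderiv ℝ (locMap m (m + 1) p q φ) z b) = hloc m p z a b :=
    fun z hz a b ↦ hloc_fderiv_locMap hφ hz.1 hz.2.2 a b
  have hu : ∀ z ∈ locSet m p (U ∩ φ ⁻¹' (chart (m + 1) q).source),
      hloc (m + 1) q (locMap m (m + 1) p q φ z) (locFun m p (components φ ξ q) z)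
        (locFun m p (components φ ξ q) z) = 1 := by
    intro z hz
    rw [locFun, components_eq_triv, locMap, hloc_triv hz.2.2, real_inner_self_eq_norm_sq,
      h1 _ hz.2.1, one_pow]
  have hn : ∀ z ∈ locSet m p (U ∩ φ ⁻¹' (chart (m + 1) q).source), ∀ a,
      hloc (m + 1) q (locMap m (m + 1) p q φ z) (fderiv ℝ (locMap m (m + 1) p q φ) z a)
        (locFun m p (components φ ξ q) z) = 0 := by
    intro z hz a
    rw [hd z hz, locFun, components_eq_triv, locMap, hloc_triv hz.2.2, h0 _ hz.2.1]
  have hg := (isMetricOn_hloc (n := m) p).mono hO inter_subset_left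
  refine ⟨hg, isMetricOn_hloc q, contDiffOn_locMap_inter hsm p q,
    fun z hz ↦ (chart (m + 1) q).map_source hz.2.2, hm1,
    contDiffOn_components (hξ.mono inter_subset_left) fun y hy ↦ hy.2, hu, hn, ?_⟩
  intro z hz v
  refine exists_add_smul_of_finrank (by simp)
    (LinearMap.mk₂ ℝ (fun a b ↦ hloc (m + 1) q (locMap m (m + 1) p q φ z) a b)
      (by simp) (by simp) (by simp) (by simp))
    (fderiv ℝ (locMap m (m + 1) p q φ) z).toLinearMap ?_ (hu z hz) (hn z hz) v
  -- An isometric differential is injective because `g` is positive definite.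
  rw [← LinearMap.ker_eq_bot, LinearMap.ker_eq_bot']
  intro a ha
  by_contra hne
  have h2 := hg.pos z hz a hne
  have ha' : fderiv ℝ (locMap m (m + 1) p q φ) z a = 0 := ha
  rw [← hm1 z hz, ha', map_zero] at h2
  exact lt_irrefl _ h2

namespace IsNormalWithMeanCurvature

variable (hφ : IsIsometricImmersion m (m + 1) φ) (hN : IsNormalWithMeanCurvature m φ U ξ H)
  {p x : M} {q : N}
include hφ hN

theorem isLocalHypersurface (p : M) (q : N) :
    IsLocalHypersurface (hloc m p) (locSet m p (U ∩ φ ⁻¹' (chart (m + 1) q).source))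
      (hloc (m + 1) q) (chart (m + 1) q).target (locMap m (m + 1) p q φ)
      (locFun m p (components φ ξ q)) :=
  isLocalHypersurface_of_normal hφ hN.isOpen hN.smooth hN.norm_eq_one hN.normal p q

theorem tens_eq (p : M) (q : N) {z : EuclideanSpace ℝ (Fin m)}
    (hz : z ∈ locSet m p (U ∩ φ ⁻¹' (chart (m + 1) q).source)) :
    tens (hloc m p) (hloc (m + 1) q) (stdB m) (locMap m (m + 1) p q φ) z
      = ((m : ℝ) • locFun m p H) z • locFun m p (components φ ξ q) z := by
  have hx := (chart m p).map_target hz.1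
  have h := triv_tension (p := p) hN.isOpen hφ.smooth.contMDiffOn hz.2.1 hx hz.2.2
  rw [(chart m p).right_inv hz.1] at h
  rw [← h, tension_eq_smul, hN.meanCurvature _ hz.2.1, smul_smul, triv_smul hz.2.2]
  rfl

/-- Smoothness of `H` is not part of `IsNormalWithMeanCurvature`; it follows from
$H=\langle\eta,\xi\rangle$. -/
theorem contDiffOn_meanCurvature (p : M) (q : N) : ContDiffOn ℝ ∞ (locFun m p H)
    (locSet m p (U ∩ φ ⁻¹' (chart (m + 1) q).source)) := by
  have S := isLocalHypersurface hφ hN p q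
  have h1 : ContDiffOn ℝ ∞ (fun z ↦ (1 / (m : ℝ)) • hloc (m + 1) q (locMap m (m + 1) p q φ z)
      (tens (hloc m p) (hloc (m + 1) q) (stdB m) (locMap m (m + 1) p q φ) z)
      (locFun m p (components φ ξ q) z)) (locSet m p (U ∩ φ ⁻¹' (chart (m + 1) q).source)) :=
    ((((S.metric_right.smooth.comp S.smooth S.mapsTo).clm_apply
      (contDiffOn_tens S.metric_left S.metric_right S.smooth S.mapsTo)).clm_apply
        S.smooth_normal)).const_smul _
  refine h1.congr fun z hz ↦ ?_
  have hx := (chart m p).map_target hz.1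
  have h := triv_tension (p := p) hN.isOpen hφ.smooth.contMDiffOn hz.2.1 hx hz.2.2
  rw [(chart m p).right_inv hz.1] at h
  rw [← h, locMap, locFun, locFun, components_eq_triv, hloc_triv hz.2.2, smul_eq_mul,
    ← real_inner_smul_left]
  have h2 : (1 / (m : ℝ)) • tension m (m + 1) φ ((chart m p).symm z)
      = meanCurvatureVector m φ ((chart m p).symm z) := rfl
  rw [h2, hN.meanCurvature _ hz.2.1, real_inner_smul_left, real_inner_self_eq_norm_sq,
    hN.norm_eq_one _ hz.2.1, one_pow, mul_one]

section AtPoint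

variable (hxU : x ∈ U) (hx : x ∈ (chart m p).source) (hq : φ x ∈ (chart (m + 1) q).source)
include hxU hx hq

theorem triv_cov_normal (u : TangentSpace (𝓡 m) x) : triv q (φ x) (covAlong φ ξ x u)
    = cov (hloc (m + 1) q) (locMap m (m + 1) p q φ) (locFun m p (components φ ξ q)) (chart m p x)
      (triv p x u) := by
  have S := isLocalHypersurface hφ hN p q
  exact triv_covAlong hN.isOpen hφ.smooth.contMDiffOn hxU hx hq
    (S.diff S.smooth_normal ((mem_locSet hx).2 ⟨hxU, hq⟩)) u

theorem exists_covAlong_eq (u : TangentSpace (𝓡 m) x) :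
    ∃ k, covAlong φ ξ x u = mfderiv (𝓡 m) (𝓡 (m + 1)) φ x k := by
  have S := isLocalHypersurface hφ hN p q
  have hz : chart m p x ∈ locSet m p (U ∩ φ ⁻¹' (chart (m + 1) q).source) :=
    (mem_locSet hx).2 ⟨hxU, hq⟩
  obtain ⟨a, s, h⟩ := S.span _ hz (triv q (φ x) (covAlong φ ξ x u))
  have h1 := S.cov_normal_normal hz (triv p x u)
  rw [← triv_cov_normal hφ hN hxU hx hq, h, map_add, map_smul, add_apply, smul_apply,
    S.normal _ hz, S.unit _ hz, zero_add, smul_eq_mul, mul_one] at h1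
  rw [h1, zero_smul, add_zero, ← triv_trivSymm hx a,
    ← triv_mfderiv_of_mem hN.isOpen hφ.smooth.contMDiffOn hxU hx hq] at h
  exact ⟨_, triv_injective hq h⟩

/-- Since $\nabla_u\xi$ is tangential, $|Au|^2=|\nabla_u\xi|^2$. This reduces the double sum to a
single trace. -/
theorem shapeNormSq_eq : shapeNormSq m φ ξ x
    = ∑ i, hloc (m + 1) q (locMap m (m + 1) p q φ (chart m p x))
      (cov (hloc (m + 1) q) (locMap m (m + 1) p q φ) (locFun m p (components φ ξ q))
        (chart m p x) (stdB m i))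
      (cov (hloc (m + 1) q) (locMap m (m + 1) p q φ) (locFun m p (components φ ξ q))
        (chart m p x) (dualVec (hloc m p) (stdB m) i (chart m p x))) := by
  have key : ∀ u : TangentSpace (𝓡 m) x,
      ‖shapeOperator φ ξ x u‖ ^ 2 = inner ℝ (covAlong φ ξ x u) (covAlong φ ξ x u) := by
    intro u
    obtain ⟨k, hk⟩ := exists_covAlong_eq hφ hN hxU hx hq u
    have h1 : tangentialPart φ x (covAlong φ ξ x u) = k := by
      refine ext_inner_right ℝ fun v ↦ ?_
      rw [tangentialPart, ContinuousLinearMap.adjoint_inner_left, hk, hφ.inner_eq]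
    rw [shapeOperator, h1, norm_neg, hk, hφ.inner_eq, real_inner_self_eq_norm_sq]
  rw [shapeNormSq]
  simp_rw [(onb m x).sum_sq_inner_left, key, ← hloc_triv hq, triv_cov_normal hφ hN hxU hx hq]
  have h2 : chart (m + 1) q (φ x) = locMap m (m + 1) p q φ (chart m p x) := by
    rw [locMap, (chart m p).left_inv hx]
  rw [h2]
  exact sum_onb_eq hx (LinearMap.mk₂ ℝ
    (fun a c ↦ hloc (m + 1) q (locMap m (m + 1) p q φ (chart m p x))
      (cov (hloc (m + 1) q) (locMap m (m + 1) p q φ) (locFun m p (components φ ξ q))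
        (chart m p x) a)
      (cov (hloc (m + 1) q) (locMap m (m + 1) p q φ) (locFun m p (components φ ξ q))
        (chart m p x) c))
    (fun _ _ _ ↦ by rw [cov_add_right, map_add, add_apply])
    (fun _ _ _ ↦ by rw [cov_smul_right, map_smul, smul_apply])
    (fun _ _ _ ↦ by rw [cov_add_right, map_add])
    (fun _ _ _ ↦ by rw [cov_smul_right, map_smul]))

/-- The trace runs over tangential directions only, as the normal one contributes $R(\xi,\xi)=0$. -/
theorem ricci_normal_eq (w : TangentSpace (𝓡 (m + 1)) (φ x)) : ricci (φ x) (ξ x) w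
    = ∑ i, hloc (m + 1) q (locMap m (m + 1) p q φ (chart m p x))
      (curv (hloc (m + 1) q) (locMap m (m + 1) p q φ (chart m p x))
        (locFun m p (components φ ξ q) (chart m p x))
        (fderiv ℝ (locMap m (m + 1) p q φ) (chart m p x) (stdB m i))
        (fderiv ℝ (locMap m (m + 1) p q φ) (chart m p x)
          (dualVec (hloc m p) (stdB m) i (chart m p x)))) (triv q (φ x) w) := by
  have S := isLocalHypersurface hφ hN p q
  have hz : chart m p x ∈ locSet m p (U ∩ φ ⁻¹' (chart (m + 1) q).source) :=
    (mem_locSet hx).2 ⟨hxU, hq⟩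
  have h2 : chart (m + 1) q (φ x) = locMap m (m + 1) p q φ (chart m p x) := by
    rw [locMap, (chart m p).left_inv hx]
  have h3 : triv q (φ x) (ξ x) = locFun m p (components φ ξ q) (chart m p x) := by
    rw [locFun, (chart m p).left_inv hx, components_eq_triv]
  have hW := S.mapsTo hz
  rw [ricci_eq_sum hq (κ := Option (Fin m))
    -- In the dual frames `none` indexes the unit normal and `some i` the images of `stdB m i` and
    -- of its dual vector.
    (a := fun o ↦ o.elim (locFun m p (components φ ξ q) (chart m p x))
      fun i ↦ fderiv ℝ (locMap m (m + 1) p q φ) (chart m p x) (stdB m i))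
    (b := fun o ↦ o.elim (locFun m p (components φ ξ q) (chart m p x))
      fun i ↦ fderiv ℝ (locMap m (m + 1) p q φ) (chart m p x)
        (dualVec (hloc m p) (stdB m) i (chart m p x))), Fintype.sum_option]
  · simp only [Option.elim]
    rw [h3, curv_self, map_zero, zero_apply, zero_add, h2]
    refine Finset.sum_congr rfl fun i _ ↦ ?_
    rw [curv_skew_left, map_neg, neg_apply, S.metric_right.curv_skew_right hW, neg_neg]
  · intro v
    rw [Fintype.sum_option, h2]
    simp only [Option.elim]
    obtain ⟨a, s, rfl⟩ := S.span _ hz v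
    simp only [map_add, map_smul, add_apply, smul_apply, S.normal _ hz, S.unit _ hz, S.iso _ hz,
      smul_eq_mul, mul_one, zero_add]
    have h4 : ∀ i, hloc (m + 1) q (locMap m (m + 1) p q φ (chart m p x))
        (locFun m p (components φ ξ q) (chart m p x))
        (fderiv ℝ (locMap m (m + 1) p q φ) (chart m p x)
          (dualVec (hloc m p) (stdB m) i (chart m p x))) = 0 := fun i ↦ by
      rw [S.metric_right.symm _ hW, S.normal _ hz]
    simp only [h4, mul_zero, add_zero]
    refine (add_comm _ _).trans (congrArg (fun y ↦ s • locFun m p (components φ ξ q) (chart m p x) + y) ?_)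
    conv_lhs => rw [← S.metric_left.sum_dualVec_smul (b := stdB m) hz a]
    simp only [map_sum, map_smul]

theorem inner_jac_normal : hloc (m + 1) q (locMap m (m + 1) p q φ (chart m p x))
      (jac (hloc m p) (hloc (m + 1) q) (stdB m) (locMap m (m + 1) p q φ)
        (tens (hloc m p) (hloc (m + 1) q) (stdB m) (locMap m (m + 1) p q φ)) (chart m p x))
      (locFun m p (components φ ξ q) (chart m p x))
    = m * (laplacian m H x - H x * shapeNormSq m φ ξ x + H x * ricci (φ x) (ξ x) (ξ x)) := by
  have S := isLocalHypersurface hφ hN p q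
  have hz : chart m p x ∈ locSet m p (U ∩ φ ⁻¹' (chart (m + 1) q).source) :=
    (mem_locSet hx).2 ⟨hxU, hq⟩
  have hH := contDiffOn_meanCurvature hφ hN p q
  have h3 : triv q (φ x) (ξ x) = locFun m p (components φ ξ q) (chart m p x) := by
    rw [locFun, (chart m p).left_inv hx, components_eq_triv]
  have hHx : locFun m p H (chart m p x) = H x := by rw [locFun, (chart m p).left_inv hx]
  have h1 := S.inner_jac_normal (K := (m : ℝ) • locFun m p H) hz (hH.const_smul (m : ℝ)) (fun y hy ↦ tens_eq hφ hN p q hy)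
  have hdiv : divForm (hloc m p) (stdB m) (fderiv ℝ ((m : ℝ) • locFun m p H)) (chart m p x)
      = m * divForm (hloc m p) (stdB m) (fderiv ℝ (locFun m p H)) (chart m p x) := by
    simp only [divForm, fderiv_const_smul_field, Pi.smul_apply, smul_apply, smul_eq_mul,
      ← mul_sub, Finset.mul_sum]
  rw [h1, hdiv, ← laplacian_eq (isOpen_inter_charts hN.isOpen hφ.smooth.contMDiffOn q) hH
    ⟨hxU, hq⟩ hx, ← shapeNormSq_eq hφ hN hxU hx hq, ← h3, Pi.smul_apply, hHx, smul_eq_mul]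
  rw [ricci_normal_eq hφ hN hxU hx hq, ← h3]
  ring

theorem inner_jac_tangent (w : TangentSpace (𝓡 m) x) :
    hloc (m + 1) q (locMap m (m + 1) p q φ (chart m p x))
      (jac (hloc m p) (hloc (m + 1) q) (stdB m) (locMap m (m + 1) p q φ)
        (tens (hloc m p) (hloc (m + 1) q) (stdB m) (locMap m (m + 1) p q φ)) (chart m p x))
      (fderiv ℝ (locMap m (m + 1) p q φ) (chart m p x) (triv p x w))
    = -m * inner ℝ ((2 : ℝ) • shapeOperator φ ξ x (grad m H x)
      + ((m : ℝ) / 2) • grad m (fun y ↦ H y ^ 2) x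
      - (2 * H x) • tangentialPart φ x (ricciOp (φ x) (ξ x))) w := by
  have S := isLocalHypersurface hφ hN p q
  have hz : chart m p x ∈ locSet m p (U ∩ φ ⁻¹' (chart (m + 1) q).source) :=
    (mem_locSet hx).2 ⟨hxU, hq⟩
  have hH := contDiffOn_meanCurvature hφ hN p q
  have hHd := S.diff hH hz
  have h2 : chart (m + 1) q (φ x) = locMap m (m + 1) p q φ (chart m p x) := by
    rw [locMap, (chart m p).left_inv hx]
  have hHx : locFun m p H (chart m p x) = H x := by rw [locFun, (chart m p).left_inv hx]
  have h1 := S.inner_jac_tangent (K := (m : ℝ) • locFun m p H) hz (hH.const_smul (m : ℝ)) (fun y hy ↦ tens_eq hφ hN p q hy)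
    (triv p x w)
  have hsq : HasFDerivAt (locFun m p (fun y ↦ H y ^ 2))
      ((2 * H x) • fderiv ℝ (locFun m p H) (chart m p x)) (chart m p x) := by
    have := hHd.hasFDerivAt.pow 2
    rw [hHx] at this
    refine this.congr_fderiv ?_
    simp
  have e1 : inner ℝ (shapeOperator φ ξ x (grad m H x)) w
      = -hloc (m + 1) q (locMap m (m + 1) p q φ (chart m p x))
        (cov (hloc (m + 1) q) (locMap m (m + 1) p q φ) (locFun m p (components φ ξ q))
          (chart m p x) (sharp (hloc m p) (chart m p x) (fderiv ℝ (locFun m p H) (chart m p x))))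
        (fderiv ℝ (locMap m (m + 1) p q φ) (chart m p x) (triv p x w)) := by
    rw [shapeOperator, inner_neg_left, tangentialPart, ContinuousLinearMap.adjoint_inner_left,
      ← hloc_triv hq, triv_cov_normal hφ hN hxU hx hq, triv_grad hx hHd,
      triv_mfderiv_of_mem hN.isOpen hφ.smooth.contMDiffOn hxU hx hq, h2]
  have e2 : inner ℝ (grad m (fun y ↦ H y ^ 2) x) w
      = 2 * H x * fderiv ℝ (locFun m p H) (chart m p x) (triv p x w) := by
    rw [inner_grad hx hsq.differentiableAt, hsq.fderiv, smul_apply, smul_eq_mul]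
  have e3 : inner ℝ (tangentialPart φ x (ricciOp (φ x) (ξ x))) w
      = ricci (φ x) (ξ x) (mfderiv (𝓡 m) (𝓡 (m + 1)) φ x w) := by
    rw [tangentialPart, ContinuousLinearMap.adjoint_inner_left, inner_ricciOp]
  rw [inner_sub_left, inner_add_left, real_inner_smul_left, real_inner_smul_left,
    real_inner_smul_left, e1, e2, e3, ricci_normal_eq hφ hN hxU hx hq,
    triv_mfderiv_of_mem hN.isOpen hφ.smooth.contMDiffOn hxU hx hq, h1]
  simp only [fderiv_const_smul_field, Pi.smul_apply, map_smul, cov_smul_right, smul_apply,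
    smul_eq_mul, hHx]
  ring

/-- The left side does not refer to charts, so this lemma also carries the Jacobi equation from one
pair of charts to another. -/
theorem hypersurfaceEquations_iff : HypersurfaceEquations m φ ξ H x ↔
    jac (hloc m p) (hloc (m + 1) q) (stdB m) (locMap m (m + 1) p q φ)
      (tens (hloc m p) (hloc (m + 1) q) (stdB m) (locMap m (m + 1) p q φ)) (chart m p x) = 0 := by
  have S := isLocalHypersurface hφ hN p q
  have hz : chart m p x ∈ locSet m p (U ∩ φ ⁻¹' (chart (m + 1) q).source) :=
    (mem_locSet hx).2 ⟨hxU, hq⟩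
  have hn := inner_jac_normal hφ hN hxU hx hq
  have ht := inner_jac_tangent hφ hN hxU hx hq
  constructor
  · rintro ⟨h1, h2⟩
    refine S.metric_right.eq_of_forall (S.mapsTo hz) fun c ↦ ?_
    obtain ⟨a, s, rfl⟩ := S.span _ hz c
    rw [map_add, map_smul, hn, h1, ← triv_trivSymm hx a, ht, h2, inner_zero_left]
    simp
  · intro h0
    rw [h0] at hn ht
    simp only [map_zero, zero_apply] at hn ht
    -- For `m = 0` the factors $\pm m$ carry no information. In that case tangent spaces are trivial
    -- and $\eta$ is an empty sum, so that $H=0$ and the equations hold.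
    rcases Nat.eq_zero_or_pos m with rfl | hm
    · have hfin : Module.finrank ℝ (TangentSpace (𝓡 0) x) = 0 := finrank_euclideanSpace_fin
      have : IsEmpty (Fin (Module.finrank ℝ (TangentSpace (𝓡 0) x))) := by
        rw [hfin]; infer_instance
      have hsub : Subsingleton (TangentSpace (𝓡 0) x) :=
        Module.finrank_zero_iff.1 hfin
      refine ⟨?_, Subsingleton.elim _ _⟩
      have hη := hN.meanCurvature x hxU
      have hH0 : H x = 0 := by
        have h5 : H x • ξ x = 0 := by rw [← hη, meanCurvatureVector]; simp
        refine (smul_eq_zero.1 h5).resolve_right fun h6 ↦ ?_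
        have := hN.norm_eq_one x hxU
        rw [h6, norm_zero] at this
        exact zero_ne_one this
      simp [hH0, laplacian]
    · have hm' : (m : ℝ) ≠ 0 := by positivity
      refine ⟨(mul_eq_zero.1 hn.symm).resolve_left hm', ext_inner_right ℝ fun w ↦ ?_⟩
      rw [inner_zero_left]
      exact (mul_eq_zero.1 (ht w).symm).resolve_left (neg_ne_zero.2 hm')

end AtPoint

end IsNormalWithMeanCurvature

end HypersurfaceDictionary

/-! ## The Riemannian volume in charts -/

theorem det_gramOf_of_isometry {E ι : Type*} [NormedAddCommGroup E] [NormedSpace ℝ E]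
    [Fintype ι] [DecidableEq ι] {g h : E → E →L[ℝ] E →L[ℝ] ℝ} (b : Module.Basis ι ℝ E) {z w : E}
    (L : E →L[ℝ] E) (hL : ∀ a c, h w (L a) (L c) = g z a c) :
    (gramOf g b z).det = L.det ^ 2 * (gramOf h b w).det := by
  have h1 : gramOf g b z
      = (LinearMap.toMatrix b b L.toLinearMap).transpose * gramOf h b w
        * LinearMap.toMatrix b b L.toLinearMap := by
    ext i j
    have hLb : ∀ k, L (b k) = ∑ l, LinearMap.toMatrix b b L.toLinearMap l k • b l := by
      intro k
      conv_lhs => rw [← b.sum_repr (L (b k))]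
      simp [LinearMap.toMatrix_apply]
    rw [gramOf, Matrix.of_apply, ← hL, hLb, hLb]
    simp only [map_sum, map_smul, sum_apply, smul_apply, smul_eq_mul, Matrix.mul_apply,
      Matrix.transpose_apply, gramOf, Matrix.of_apply, Finset.sum_mul, Finset.mul_sum]
    refine Finset.sum_congr rfl fun k _ ↦ Finset.sum_congr rfl fun l _ ↦ ?_
    ring
  rw [h1, Matrix.det_mul, Matrix.det_mul, Matrix.det_transpose, LinearMap.det_toMatrix]
  change _ = LinearMap.det L.toLinearMap ^ 2 * _
  ring

theorem density_of_isometry {E ι : Type*} [NormedAddCommGroup E] [NormedSpace ℝ E]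
    [Fintype ι] [DecidableEq ι] {g h : E → E →L[ℝ] E →L[ℝ] ℝ} (b : Module.Basis ι ℝ E) {z w : E}
    (L : E →L[ℝ] E) (hL : ∀ a c, h w (L a) (L c) = g z a c) :
    density g b z = |L.det| * density h b w := by
  rw [density, det_gramOf_of_isometry b L hL, Real.sqrt_mul (sq_nonneg _), Real.sqrt_sq_eq_abs,
    density]

/-- A supremum of measures restricts on a set to a member dominating the others there. -/
theorem restrict_iSup_eq {α ι : Type*} [MeasurableSpace α] (μ : ι → Measure α) (i : ι) {s : Set α}
    (hs : MeasurableSet s) (h : ∀ j, (μ j).restrict s ≤ μ i) :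
    (⨆ j, μ j).restrict s = (μ i).restrict s := by
  refine le_antisymm ?_ (Measure.restrict_mono le_rfl (le_iSup μ i))
  -- The measure on the right is `μ i` on `s` and the supremum off `s`; it dominates every `μ j`.
  have h1 : (⨆ j, μ j) ≤ (μ i).restrict s + (⨆ j, μ j).restrict sᶜ := by
    refine iSup_le fun j ↦ ?_
    rw [← Measure.restrict_add_restrict_compl (μ := μ j) hs]
    refine add_le_add ?_ (Measure.restrict_mono le_rfl (le_iSup μ j))
    have := Measure.restrict_mono (le_refl s) (h j)
    rwa [Measure.restrict_restrict hs, inter_self] at this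
  have h2 := Measure.restrict_mono (le_refl s) h1
  rw [Measure.restrict_add, Measure.restrict_restrict hs, Measure.restrict_restrict hs,
    inter_self, inter_compl_self, Measure.restrict_empty, add_zero] at h2
  exact h2

section Volume

variable {m : ℕ} {M : Type*} [TopologicalSpace M]
  [ChartedSpace (EuclideanSpace ℝ (Fin m)) M] [IsManifold (𝓡 m) ∞ M]
  [RiemannianBundle (fun x : M ↦ TangentSpace (𝓡 m) x)]
  [IsContMDiffRiemannianBundle (𝓡 m) ∞ (EuclideanSpace ℝ (Fin m))
    (fun x : M ↦ TangentSpace (𝓡 m) x)]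
  [MeasurableSpace M] [BorelSpace M]

theorem aemeasurable_chart_symm (p : M) {B : Set (EuclideanSpace ℝ (Fin m))}
    (hB : MeasurableSet B) (hBt : B ⊆ (chart m p).target)
    (d : EuclideanSpace ℝ (Fin m) → ENNReal) :
    AEMeasurable (chart m p).symm ((volume.restrict B).withDensity d) :=
  (((chart m p).continuousOn_symm.mono hBt).aemeasurable hB).mono_ac
    (withDensity_absolutelyContinuous _ _)

theorem restrict_chartVolume (p : M) {A : Set M} (hA : MeasurableSet A) :
    (chartVolume m p).restrict A
      = ((volume.restrict ((chart m p).target ∩ (chart m p).symm ⁻¹' A)).withDensity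
        (fun z ↦ ENNReal.ofReal (density (hloc m p) (stdB m) z))).map (chart m p).symm := by
  have ht : MeasurableSet (chart m p).target := (chart m p).open_target.measurableSet
  have hd : (fun z ↦ ENNReal.ofReal (Real.sqrt (gram m p ((chart m p).symm z)).det))
      = fun z ↦ ENNReal.ofReal (density (hloc m p) (stdB m) z) := by
    funext z; rw [density, gramOf_hloc]
  rw [chartVolume, Measure.restrict_map_of_aemeasurable (aemeasurable_chart_symm p ht subset_rfl _)
    hA, restrict_withDensity', Measure.restrict_restrict' ht, hd, inter_comm]

theorem chartVolume_apply (p : M) {A : Set M} (hA : MeasurableSet A) :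
    chartVolume m p A = ∫⁻ z in (chart m p).target ∩ (chart m p).symm ⁻¹' A,
      ENNReal.ofReal (density (hloc m p) (stdB m) z) := by
  have ht : MeasurableSet (chart m p).target := (chart m p).open_target.measurableSet
  have hd : (fun z ↦ ENNReal.ofReal (Real.sqrt (gram m p ((chart m p).symm z)).det))
      = fun z ↦ ENNReal.ofReal (density (hloc m p) (stdB m) z) := by
    funext z; rw [density, gramOf_hloc]
  rw [chartVolume, Measure.map_apply_of_aemeasurable (aemeasurable_chart_symm p ht subset_rfl _) hA,
    withDensity_apply', Measure.restrict_restrict' ht, hd, inter_comm]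

/-- The inverse chart is continuous on its target only, so measurability is obtained on the subtype.
-/
theorem measurableSet_target_inter (p : M) {A : Set M} (hA : MeasurableSet A) :
    MeasurableSet ((chart m p).target ∩ (chart m p).symm ⁻¹' A) := by
  have ht : MeasurableSet (chart m p).target := (chart m p).open_target.measurableSet
  have h1 : Measurable (fun z : (chart m p).target ↦ (chart m p).symm z) :=
    (continuousOn_iff_continuous_domRestrict.1 (chart m p).continuousOn_symm).measurable
  have h2 := ht.subtype_image (h1 hA)
  convert h2 using 1
  ext z
  simp [and_comm]

/-- The change of charts is an isometry of the local metrics, so its Jacobian is the ratio of the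
densities and cancels in the change of variables formula. Domination is all that `restrict_iSup_eq`
asks for. -/
theorem restrict_chartVolume_le (i p : M) :
    (chartVolume m i).restrict (chart m p).source ≤ chartVolume m p := by
  have hsp : MeasurableSet (chart m p).source := (chart m p).open_source.measurableSet
  refine Measure.le_iff.2 fun s hs ↦ ?_
  rw [Measure.restrict_apply hs, chartVolume_apply i (hs.inter hsp), chartVolume_apply p hs]
  set B := (chart m i).target ∩ (chart m i).symm ⁻¹' (s ∩ (chart m p).source) with hB
  have hBm : MeasurableSet B := measurableSet_target_inter i (hs.inter hsp)
  have hBo : B ⊆ overlap m i p := fun z hz ↦ ⟨hz.1, hz.2.2⟩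
  have hder : ∀ z ∈ B, HasFDerivWithinAt (transition m i p) (fderiv ℝ (transition m i p) z) B z :=
    fun z hz ↦ (differentiableAt_of_contDiffOn (isMetricOn_overlap i p).isOpen
      (contDiffOn_transition i p) (hBo hz)).hasFDerivAt.hasFDerivWithinAt
  have hinj : InjOn (transition m i p) B := by
    intro z hz w hw h
    have h1 := (chart m p).injOn hz.2.2 hw.2.2 h
    exact (chart m i).symm.injOn hz.1 hw.1 h1
  calc ∫⁻ z in B, ENNReal.ofReal (density (hloc m i) (stdB m) z)
      = ∫⁻ z in B, ENNReal.ofReal |(fderiv ℝ (transition m i p) z).det|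
          * ENNReal.ofReal (density (hloc m p) (stdB m) (transition m i p z)) := by
        refine setLIntegral_congr_fun hBm fun z hz ↦ ?_
        rw [← ENNReal.ofReal_mul (abs_nonneg _)]
        congr 1
        exact density_of_isometry _ _ (transition_isometry (hBo hz))
    _ = ∫⁻ w in transition m i p '' B, ENNReal.ofReal (density (hloc m p) (stdB m) w) :=
        (lintegral_image_eq_lintegral_abs_det_fderiv_mul volume hBm hder hinj
          (fun w ↦ ENNReal.ofReal (density (hloc m p) (stdB m) w))).symm
    _ ≤ _ := by
        refine lintegral_mono_set ?_
        rintro _ ⟨z, hz, rfl⟩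
        refine ⟨(chart m p).map_source hz.2.2, ?_⟩
        change (chart m p).symm (chart m p ((chart m i).symm z)) ∈ s
        rw [(chart m p).left_inv hz.2.2]
        exact hz.2.1

theorem restrict_riemannianVolume {p : M} {A : Set M} (hA : MeasurableSet A)
    (hs : A ⊆ (chart m p).source) :
    (riemannianVolume m M).restrict A
      = ((volume.restrict (chart m p '' A)).withDensity
        (fun z ↦ ENNReal.ofReal (density (hloc m p) (stdB m) z))).map (chart m p).symm := by
  have h1 := restrict_iSup_eq (fun i : M ↦ chartVolume m i) p
    (chart m p).open_source.measurableSet fun j ↦ restrict_chartVolume_le j p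
  have h2 := congrArg (fun μ : Measure M ↦ μ.restrict A) h1
  simp only [Measure.restrict_restrict_of_subset hs] at h2
  rw [riemannianVolume, h2, restrict_chartVolume p hA,
    ← (chart m p).image_eq_target_inter_inv_preimage hs]

theorem setIntegral_riemannianVolume [T2Space M] [SecondCountableTopology M] {p : M} {A : Set M}
    (hA : IsCompact A) (hs : A ⊆ (chart m p).source) {k : M → ℝ} (hk : ContinuousOn k A) :
    ∫ x in A, k x ∂(riemannianVolume m M)
      = ∫ z in chart m p '' A, density (hloc m p) (stdB m) z * locFun m p k z := by
  have hBt : chart m p '' A ⊆ (chart m p).target := by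
    rintro _ ⟨x, hx, rfl⟩; exact (chart m p).map_source (hs hx)
  have hBm : MeasurableSet (chart m p '' A) :=
    (hA.image_of_continuousOn ((chart m p).continuousOn.mono hs)).measurableSet
  have hkm : AEStronglyMeasurable k ((riemannianVolume m M).restrict A) :=
    hk.aestronglyMeasurable hA.measurableSet
  rw [restrict_riemannianVolume hA.measurableSet hs] at hkm ⊢
  rw [integral_map (aemeasurable_chart_symm p hBm hBt _) hkm,
    integral_withDensity_eq_integral_toReal_smul₀]
  · refine setIntegral_congr_fun hBm fun z hz ↦ ?_
    simp only [smul_eq_mul, locFun]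
    rw [ENNReal.toReal_ofReal (density_pos (isMetricOn_hloc p) (hBt hz)).le]
  · exact (((contDiffOn_density (b := stdB m) (isMetricOn_hloc (n := m) p)).continuousOn.mono
      hBt).aemeasurable hBm).ennreal_ofReal
  · simp

/-- Needed for the integrability of continuous functions with compact support. -/
instance [T2Space M] : IsLocallyFiniteMeasure (riemannianVolume m M) := by
  have : LocallyCompactSpace M := ChartedSpace.locallyCompactSpace (EuclideanSpace ℝ (Fin m)) M
  refine ⟨fun x ↦ ?_⟩
  obtain ⟨K, hK, hxK, hKs⟩ := exists_compact_subset (chart m x).open_source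
    (mem_chart_source (EuclideanSpace ℝ (Fin m)) x)
  refine ⟨K, mem_interior_iff_mem_nhds.1 hxK, ?_⟩
  have hBt : chart m x '' K ⊆ (chart m x).target := by
    rintro _ ⟨y, hy, rfl⟩; exact (chart m x).map_source (hKs hy)
  have hBc := hK.image_of_continuousOn ((chart m x).continuousOn.mono hKs)
  have hm := aemeasurable_chart_symm (m := m) x hBc.measurableSet hBt
    (fun z ↦ ENNReal.ofReal (density (hloc m x) (stdB m) z))
  rw [← Measure.restrict_apply_univ, restrict_riemannianVolume hK.measurableSet hKs,
    Measure.map_apply_of_aemeasurable hm MeasurableSet.univ, preimage_univ,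
    withDensity_apply _ MeasurableSet.univ, Measure.restrict_univ]
  have hint : IntegrableOn (density (hloc m x) (stdB m)) (chart m x '' K) :=
    ((contDiffOn_density (b := stdB m) (isMetricOn_hloc (n := m) x)).continuousOn.mono
      hBt).integrableOn_compact hBc
  exact hint.lintegral_lt_top

end Volume

/-! ## First variation of the bienergy in coordinates -/

section LocalVariation

variable {E F ι : Type*} [NormedAddCommGroup E] [NormedSpace ℝ E] [FiniteDimensional ℝ E]
  [MeasurableSpace E] [BorelSpace E]
  [NormedAddCommGroup F] [NormedSpace ℝ F] [FiniteDimensional ℝ F] [Fintype ι] [DecidableEq ι]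
  {g : E → E →L[ℝ] E →L[ℝ] ℝ} {O : Set E} {h : F → F →L[ℝ] F →L[ℝ] ℝ} {W : Set F}
  {b : Module.Basis ι ℝ E} {Φ : ℝ × E → F} {Q : Set (ℝ × E)}

/-- The tube lemma gives one time interval on which the integrand is smooth near all of `K`; there
the time derivative is bounded by compactness, and dominated differentiation applies. -/
theorem hasDerivAt_setIntegral_of_contDiffOn {μ : Measure E} [IsFiniteMeasureOnCompacts μ]
    (hQ : IsOpen Q) {G : ℝ × E → ℝ} (hG : ContDiffOn ℝ ∞ G Q) {K : Set E} (hK : IsCompact K)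
    (hKQ : ∀ z ∈ K, ((0 : ℝ), z) ∈ Q) :
    HasDerivAt (fun t ↦ ∫ z in K, G (t, z) ∂μ) (∫ z in K, fderiv ℝ G (0, z) (1, 0) ∂μ) 0 := by
  obtain ⟨u, v, hu, -, h0u, hKv, huv⟩ := generalized_tube_lemma (isCompact_singleton (x := (0 : ℝ)))
    hK hQ (by rintro ⟨t, z⟩ ⟨ht, hz⟩; obtain rfl : t = 0 := ht; exact hKQ z hz)
  obtain ⟨δ, hδ, hδu⟩ := Metric.nhds_basis_closedBall.mem_iff.1
    (hu.mem_nhds (h0u (mem_singleton 0)))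
  have hsub : ∀ t ∈ Metric.closedBall (0 : ℝ) δ, ∀ z ∈ K, (t, z) ∈ Q := fun t ht z hz ↦
    huv ⟨hδu ht, hKv hz⟩
  have hdc : ContinuousOn (fun p ↦ fderiv ℝ G p (1, 0)) Q :=
    (contDiffOn_fderiv_apply hQ hG contDiffOn_const).continuousOn
  obtain ⟨C, hC⟩ := ((isCompact_closedBall (0 : ℝ) δ).prod hK).exists_bound_of_continuousOn
    (hdc.mono fun p hp ↦ hsub p.1 hp.1 p.2 hp.2)
  have hslice : ∀ t ∈ Metric.closedBall (0 : ℝ) δ, ContinuousOn (fun z ↦ G (t, z)) K := fun t ht ↦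
    hG.continuousOn.comp (by fun_prop) fun z hz ↦ hsub t ht z hz
  have h0 : (0 : ℝ) ∈ Metric.closedBall (0 : ℝ) δ := Metric.mem_closedBall_self hδ.le
  refine (hasDerivAt_integral_of_dominated_loc_of_deriv_le (bound := fun _ ↦ C)
    (F' := fun t z ↦ fderiv ℝ G (t, z) (1, 0)) (Metric.closedBall_mem_nhds (0 : ℝ) hδ) ?_ ?_ ?_ ?_ ?_ ?_).2
  · filter_upwards [Metric.closedBall_mem_nhds (0 : ℝ) hδ] with t ht
    exact (hslice t ht).aestronglyMeasurable hK.measurableSet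
  · exact (hslice 0 h0).integrableOn_compact hK
  · exact ContinuousOn.aestronglyMeasurable
      (hdc.comp (by fun_prop) fun z hz ↦ hsub 0 h0 z hz) hK.measurableSet
  · filter_upwards [ae_restrict_mem hK.measurableSet] with z hz t ht
    exact hC (t, z) ⟨ht, hz⟩
  · exact integrableOn_const hK.measure_lt_top.ne
  · filter_upwards [ae_restrict_mem hK.measurableSet] with z hz t ht
    have h1 : HasDerivAt (fun s : ℝ ↦ (s, z)) ((1 : ℝ), (0 : E)) t :=
      (hasDerivAt_id t).prodMk (hasDerivAt_const t z)
    exact (differentiableAt_of_contDiffOn hQ hG (hsub t ht z hz)).hasFDerivAt.comp_hasDerivAt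
      (f := fun s : ℝ ↦ (s, z)) t h1

theorem jac_zero (f : E → F) (z : E) : jac g h b f (fun _ ↦ 0) z = 0 := by
  have h1 : covL h f (fun _ : E ↦ (0 : F)) = fun _ ↦ 0 := by
    funext y
    ext u
    simp [covL]
  refine Finset.sum_eq_zero fun i _ ↦ ?_
  rw [hess, h1, covForm_apply]
  have h2 := curv_smul_left (h := h) (f z) 0 (fderiv ℝ f z (b i)) (fderiv ℝ f z (dualVec g b i z)) 0
  rw [zero_smul, zero_smul] at h2
  simp [h2]

theorem jac_eq_zero_of_eventuallyEq {f V : E → F} {z : E} (hV : V =ᶠ[𝓝 z] fun _ ↦ 0) :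
    jac g h b f V z = 0 := by
  obtain ⟨s, hs, hso, hzs⟩ := eventually_nhds_iff.1 hV
  rw [jac_congr hso (V := V) (Z := fun _ ↦ 0) hs hzs, jac_zero]

/-- Differentiation under the integral gives $2\int\rho\langle JV,\tau\rangle$. Self-adjointness up
to a divergence moves $J$ onto $\tau$, and integrating the divergence by parts against `ρ` leaves
the flux term. -/
theorem hasDerivAt_integral_tension_sq (hg : IsMetricOn g O) (hh : IsMetricOn h W)
    (μ : Measure E) [μ.IsAddHaarMeasure] (hQ : IsOpen Q) (hΦ : ContDiffOn ℝ ∞ Φ Q)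
    (hm : MapsTo Φ Q W) (hQO : ∀ p ∈ Q, p.2 ∈ O) (hOQ : ∀ z ∈ O, ((0 : ℝ), z) ∈ Q)
    {ρ : E → ℝ} (hρ : ContDiff ℝ ∞ ρ) (hcs : HasCompactSupport ρ) (hs : tsupport ρ ⊆ O)
    {K : Set E} (hK : IsCompact K) (hKO : K ⊆ O)
    (hV : ∀ z ∈ O, z ∉ K → ρ z = 0 ∨ (fun y ↦ fderiv ℝ Φ (0, y) (1, 0)) =ᶠ[𝓝 z] fun _ ↦ 0) :
    HasDerivAt (fun t ↦ ∫ z in K, density g b z * (ρ z *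
        h (Φ (t, z)) (tensFam g h b Φ (t, z)) (tensFam g h b Φ (t, z))) ∂μ)
      (2 * ((∫ z, ρ z * (density g b z * h (Φ (0, z)) (fderiv ℝ Φ (0, z) (1, 0))
          (jac g h b (fun y ↦ Φ (0, y)) (tens g h b fun y ↦ Φ (0, y)) z)) ∂μ)
        - ∫ z, density g b z * flux h (fun y ↦ Φ (0, y)) (fun y ↦ fderiv ℝ Φ (0, y) (1, 0))
          (tens g h b fun y ↦ Φ (0, y)) z (sharp g z (fderiv ℝ ρ z)) ∂μ)) 0 := by
  set f : E → F := fun y ↦ Φ (0, y) with hf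
  set V : E → F := fun y ↦ fderiv ℝ Φ (0, y) (1, 0) with hVdef
  set τ : E → F := tens g h b f with hτ
  have hO := hg.isOpen
  have hfs : ContDiffOn ℝ ∞ f O := (contDiffOn_slice hΦ 0).mono hOQ
  have hfm : MapsTo f O W := fun z hz ↦ hm (hOQ z hz)
  have hVs : ContDiffOn ℝ ∞ V O :=
    (contDiffOn_slice (V := fun q ↦ fderiv ℝ Φ q (1, 0))
      (contDiffOn_fderiv_apply hQ hΦ contDiffOn_const) 0).mono hOQ
  have hτs : ContDiffOn ℝ ∞ τ O := contDiffOn_tens hg hh hfs hfm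
  have hTs := contDiffOn_tensFam (b := b) hg hh hQ hΦ hm hQO
  have hds := contDiffOn_density (b := b) hg
  have hGs : ContDiffOn ℝ ∞ (fun p : ℝ × E ↦ density g b p.2 * (ρ p.2 *
      h (Φ p) (tensFam g h b Φ p) (tensFam g h b Φ p))) Q :=
    (hds.comp contDiffOn_snd hQO).mul ((hρ.comp contDiff_snd).contDiffOn.mul
      (((hh.smooth.comp hΦ hm).clm_apply hTs).clm_apply hTs))
  have h1 := hasDerivAt_setIntegral_of_contDiffOn (μ := μ) hQ hGs hK fun z hz ↦ hOQ z (hKO hz)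
  refine h1.congr_deriv ?_
  have hder : ∀ z ∈ K, fderiv ℝ (fun p : ℝ × E ↦ density g b p.2 * (ρ p.2 *
      h (Φ p) (tensFam g h b Φ p) (tensFam g h b Φ p))) (0, z) (1, 0)
      = 2 * (ρ z * (density g b z * h (f z) (jac g h b f V z) (τ z))) := by
    intro z hz
    have hzQ := hOQ z (hKO hz)
    have c1 : HasDerivAt (fun s : ℝ ↦ (s, z)) ((1 : ℝ), (0 : E)) 0 :=
      (hasDerivAt_id (0 : ℝ)).prodMk (hasDerivAt_const (0 : ℝ) z)
    have d1 := (differentiableAt_of_contDiffOn hQ hGs hzQ).hasFDerivAt.comp_hasDerivAt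
      (f := fun s : ℝ ↦ (s, z)) 0 c1
    have d2 := ((hasDerivAt_tension_sq (g := g) (b := b) hh hQ hΦ hm hzQ).const_mul
      (ρ z)).const_mul (density g b z)
    have e := d1.unique d2
    rw [e, ← tens_slice hQ hΦ hzQ]
    simp only [hf, hVdef, hτ]
    ring
  rw [setIntegral_congr_fun hK.measurableSet hder, integral_const_mul]
  congr 1
  have hoff : ∀ z, z ∉ O → ρ z = 0 := fun z hz ↦
    image_eq_zero_of_notMem_tsupport fun hz' ↦ hz (hs hz')
  -- Off `K` either `ρ` or $JV$ vanishes, so the integral may be taken over the whole space, where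
  -- integration by parts is available.
  rw [setIntegral_eq_integral_of_forall_compl_eq_zero]
  swap
  · intro z hz
    by_cases hzO : z ∈ O
    · rcases hV z hzO hz with h0 | h0
      · rw [h0, zero_mul]
      · rw [jac_eq_zero_of_eventuallyEq h0, map_zero, zero_apply, mul_zero, mul_zero]
    · rw [hoff z hzO, zero_mul]
  have hαs := contDiffOn_flux hO hh hfs hfm hVs hτs
  have hib := integral_mul_divForm (b := b) hg μ hρ hcs hs hαs
  rw [sub_eq_add_neg, ← hib, ← integral_add]
  · refine integral_congr_ae (Filter.Eventually.of_forall fun z ↦ ?_)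
    by_cases hzO : z ∈ O
    · have := jac_sub_jac (b := b) hg hh hfs hfm hVs hτs hzO
      simp only
      rw [← this]
      ring
    · simp only [hoff z hzO, zero_mul, add_zero]
  · exact integrable_mul_of_tsupport_subset hO hρ.continuous hcs hs (hds.mul
      (((hh.smooth.comp hfs hfm).clm_apply hVs).clm_apply
        (contDiffOn_jac hg hh hfs hfm hτs))).continuousOn
  · have hdiv : ContDiffOn ℝ ∞ (divForm g b (flux h f V τ)) O :=
      ContDiffOn.sum fun i _ ↦ (((hαs.fderiv_of_isOpen hO (by simp)).clm_apply
        contDiffOn_const).clm_apply (hg.contDiffOn_dualVec i)).sub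
        (hαs.clm_apply ((hg.contDiffOn_gam.clm_apply contDiffOn_const).clm_apply
          (hg.contDiffOn_dualVec i)))
    exact integrable_mul_of_tsupport_subset hO hρ.continuous hcs hs (hds.mul hdiv).continuousOn

end LocalVariation

/-! ## Variations in charts -/

section Extension

variable {m : ℕ} {M : Type*} [TopologicalSpace M] [ChartedSpace (EuclideanSpace ℝ (Fin m)) M]

variable (m) in
/-- A function supported in the chart domain at `p`, in this chart, extended by zero. -/
def locExt (p : M) (ρ : M → ℝ) : EuclideanSpace ℝ (Fin m) → ℝ :=
  (chart m p).target.indicator (locFun m p ρ)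

theorem locExt_of_mem {p : M} {ρ : M → ℝ} {z : EuclideanSpace ℝ (Fin m)}
    (hz : z ∈ (chart m p).target) : locExt m p ρ z = ρ ((chart m p).symm z) :=
  indicator_of_mem hz _

variable {p : M} {ρ : M → ℝ} (hcs : HasCompactSupport ρ) (hs : tsupport ρ ⊆ (chart m p).source)
include hcs hs

theorem isCompact_chart_image_tsupport : IsCompact (chart m p '' tsupport ρ) :=
  hcs.isCompact.image_of_continuousOn ((chart m p).continuousOn.mono hs)

theorem locExt_eq_zero {z : EuclideanSpace ℝ (Fin m)} (hz : z ∉ chart m p '' tsupport ρ) :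
    locExt m p ρ z = 0 := by
  by_cases hzt : z ∈ (chart m p).target
  · rw [locExt_of_mem hzt]
    refine image_eq_zero_of_notMem_tsupport fun h ↦ hz ⟨_, h, (chart m p).right_inv hzt⟩
  · exact indicator_of_notMem hzt _

theorem tsupport_locExt : tsupport (locExt m p ρ) ⊆ chart m p '' tsupport ρ :=
  closure_minimal (fun _ hz ↦ by_contra fun h ↦ hz (locExt_eq_zero hcs hs h))
    (isCompact_chart_image_tsupport hcs hs).isClosed

theorem hasCompactSupport_locExt : HasCompactSupport (locExt m p ρ) :=
  (isCompact_chart_image_tsupport hcs hs).of_isClosed_subset (isClosed_tsupport _)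
    (tsupport_locExt hcs hs)

/-- The image of the support is compact, hence closed in the model space, so the extension by zero
stays smooth at the boundary of the chart target. -/
theorem contDiff_locExt [IsManifold (𝓡 m) ∞ M] (hρ : ContMDiff (𝓡 m) 𝓘(ℝ, ℝ) ∞ ρ) :
    ContDiff ℝ ∞ (locExt m p ρ) := by
  refine contDiff_iff_contDiffAt.2 fun z ↦ ?_
  by_cases hz : z ∈ (chart m p).target
  · have h1 : ContDiffOn ℝ ∞ (locFun m p ρ) (locSet m p univ) :=
      contDiffOn_locFun hρ.contMDiffOn
    have hO : IsOpen (locSet m p (univ : Set M)) := isOpen_locSet p isOpen_univ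
    refine (h1.contDiffAt (hO.mem_nhds ⟨hz, mem_univ _⟩)).congr_of_eventuallyEq ?_
    filter_upwards [(chart m p).open_target.mem_nhds hz] with y hy
    exact locExt_of_mem hy
  · refine (contDiffAt_const (c := (0 : ℝ))).congr_of_eventuallyEq ?_
    have hz' : z ∉ chart m p '' tsupport ρ := by
      rintro ⟨x, hx, rfl⟩
      exact hz ((chart m p).map_source (hs hx))
    filter_upwards [(isCompact_chart_image_tsupport hcs hs).isClosed.isOpen_compl.mem_nhds hz']
      with y hy
    exact locExt_eq_zero hcs hs hy

end Extension

/-! ### Additivity of the covariant derivative in the direction. -/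

section Linearity

variable {m n : ℕ} {M : Type*} [TopologicalSpace M]
  [ChartedSpace (EuclideanSpace ℝ (Fin m)) M] [IsManifold (𝓡 m) ∞ M]
  {N : Type*} [TopologicalSpace N] [ChartedSpace (EuclideanSpace ℝ (Fin n)) N]
  [IsManifold (𝓡 n) ∞ N]
  [RiemannianBundle (fun q : N ↦ TangentSpace (𝓡 n) q)]
  [IsContMDiffRiemannianBundle (𝓡 n) ∞ (EuclideanSpace ℝ (Fin n))
    (fun q : N ↦ TangentSpace (𝓡 n) q)]

/-- Both the derivative of the components and the Christoffel term are additive in the direction,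
whatever the regularity of `V`. This lets the fluxes along the gradients of a partition of unity be
added. -/
theorem covAlong_add_right (φ : M → N) (V : Π x : M, TangentSpace (𝓡 n) (φ x)) (x : M)
    (u v : TangentSpace (𝓡 m) x) :
    covAlong φ V x (u + v) = covAlong φ V x u + covAlong φ V x v := by
  have hq := mem_chart_source (EuclideanSpace ℝ (Fin n)) (φ x)
  have h1 : ∀ w w' v : TangentSpace (𝓡 n) (φ x),
      christoffel (φ x) (w + w') v = christoffel (φ x) w v + christoffel (φ x) w' v := by
    intro w w' v
    refine triv_injective hq ?_
    rw [triv_add hq, triv_christoffel, triv_christoffel, triv_christoffel, triv_add hq, map_add,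
      add_apply]
  simp only [covAlong, map_add, h1]
  exact add_add_add_comm _ _ _ _

theorem covAlong_zero_right (φ : M → N) (V : Π x : M, TangentSpace (𝓡 n) (φ x)) (x : M) :
    covAlong φ V x (0 : TangentSpace (𝓡 m) x) = 0 := by
  have := covAlong_add_right (m := m) φ V x 0 0
  simpa using this

theorem covAlong_sum_right (φ : M → N) (V : Π x : M, TangentSpace (𝓡 n) (φ x)) (x : M)
    {κ : Type*} (s : Finset κ) (u : κ → TangentSpace (𝓡 m) x) :
    covAlong φ V x (∑ i ∈ s, u i) = ∑ i ∈ s, covAlong φ V x (u i) :=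
  map_sum (AddMonoidHom.mk' (covAlong φ V x) (covAlong_add_right φ V x)) u s

end Linearity

/-! ### Families of maps read in a pair of charts. -/

section Variations

variable {m n : ℕ} {M : Type*} [TopologicalSpace M]
  [ChartedSpace (EuclideanSpace ℝ (Fin m)) M] [IsManifold (𝓡 m) ∞ M]
  {N : Type*} [TopologicalSpace N] [ChartedSpace (EuclideanSpace ℝ (Fin n)) N]
  [IsManifold (𝓡 n) ∞ N]

variable (m n) in
/-- A smooth family of maps which is constant off `Ω` and takes an open part `O` of the chart domain
at `p` to the chart domain at `q`. -/
structure IsChartVariation (p : M) (q : N) (O Ω : Set M) (ε : ℝ) (Φ : ℝ → M → N) : Prop where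
  pos : 0 < ε
  smooth : ContMDiffOn (𝓘(ℝ, ℝ).prod (𝓡 m)) (𝓡 n) ∞ (fun s : ℝ × M ↦ Φ s.1 s.2)
    (Ioo (-ε) ε ×ˢ univ)
  isOpen : IsOpen O
  subset : O ⊆ (chart m p).source
  mapsTo : ∀ t ∈ Ioo (-ε) ε, ∀ x ∈ O, Φ t x ∈ (chart n q).source
  eq_off : ∀ t ∈ Ioo (-ε) ε, ∀ x ∉ Ω, Φ t x = Φ 0 x

/-- The variation field of a family of maps. -/
def variationField (Φ : ℝ → M → N) (x : M) : TangentSpace (𝓡 n) (Φ 0 x) :=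
  mfderiv 𝓘(ℝ, ℝ) (𝓡 n) (fun t ↦ Φ t x) 0 (1 : ℝ)

variable (m n) in
/-- A family of maps in the charts at `p` and `q`. -/
def locFam (p : M) (q : N) (Φ : ℝ → M → N) (s : ℝ × EuclideanSpace ℝ (Fin m)) :
    EuclideanSpace ℝ (Fin n) :=
  locMap m n p q (Φ s.1) s.2

theorem contMDiff_slice {Φ : ℝ → M → N} {ε : ℝ}
    (h : ContMDiffOn (𝓘(ℝ, ℝ).prod (𝓡 m)) (𝓡 n) ∞ (fun s : ℝ × M ↦ Φ s.1 s.2)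
      (Ioo (-ε) ε ×ˢ univ)) {t : ℝ} (ht : t ∈ Ioo (-ε) ε) : ContMDiff (𝓡 m) (𝓡 n) ∞ (Φ t) := by
  have h1 : ContMDiff (𝓡 m) (𝓘(ℝ, ℝ).prod (𝓡 m)) ∞ (fun x : M ↦ (t, x)) :=
    contMDiff_const.prodMk contMDiff_id
  rw [← contMDiffOn_univ]
  exact h.comp h1.contMDiffOn fun x _ ↦ ⟨ht, mem_univ x⟩

namespace IsChartVariation

variable {p : M} {q : N} {O Ω : Set M} {ε : ℝ} {Φ : ℝ → M → N}
  (S : IsChartVariation m n p q O Ω ε Φ)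
include S

theorem zero_mem : (0 : ℝ) ∈ Ioo (-ε) ε := ⟨neg_lt_zero.2 S.pos, S.pos⟩

theorem contDiffOn_locFam :
    ContDiffOn ℝ ∞ (locFam m n p q Φ) (Ioo (-ε) ε ×ˢ locSet m p O) := by
  have h1 : ContMDiffOn 𝓘(ℝ, ℝ × EuclideanSpace ℝ (Fin m)) (𝓘(ℝ, ℝ).prod (𝓡 m)) ∞
      (fun s : ℝ × EuclideanSpace ℝ (Fin m) ↦ (s.1, (chart m p).symm s.2))
      (Ioo (-ε) ε ×ˢ locSet m p O) := by
    refine (contDiff_fst.contMDiff.contMDiffOn).prodMk ?_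
    exact (contMDiffOn_chart_symm (I := 𝓡 m) (n := ∞) (x := p)).comp
      contDiff_snd.contMDiff.contMDiffOn fun s hs ↦ hs.2.1
  have h2 := S.smooth.comp h1 fun s hs ↦ ⟨hs.1, mem_univ _⟩
  exact contMDiffOn_iff_contDiffOn.1 ((contMDiffOn_chart (I := 𝓡 n) (n := ∞) (x := q)).comp h2
    fun s hs ↦ S.mapsTo _ hs.1 _ hs.2.2)

theorem isOpen_domain : IsOpen (Ioo (-ε) ε ×ˢ locSet m p O) :=
  isOpen_Ioo.prod (isOpen_locSet p S.isOpen)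

theorem mapsTo_locFam :
    MapsTo (locFam m n p q Φ) (Ioo (-ε) ε ×ˢ locSet m p O) (chart n q).target :=
  fun _ hs ↦ (chart n q).map_source (S.mapsTo _ hs.1 _ hs.2.2)

theorem hasDerivAt_locFam {z : EuclideanSpace ℝ (Fin m)} (hz : z ∈ locSet m p O) :
    HasDerivAt (fun t ↦ locFam m n p q Φ (t, z)) (fderiv ℝ (locFam m n p q Φ) (0, z) (1, 0)) 0 :=
  (differentiableAt_of_contDiffOn S.isOpen_domain S.contDiffOn_locFam
    (x := (0, z)) ⟨S.zero_mem, hz⟩).hasFDerivAt.comp_hasDerivAt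
    (f := fun s : ℝ ↦ (s, z)) 0 ((hasDerivAt_id (0 : ℝ)).prodMk (hasDerivAt_const (0 : ℝ) z))

theorem triv_variationField {x : M} (hx : x ∈ O) :
    triv q (Φ 0 x) (variationField Φ x)
      = fderiv ℝ (locFam m n p q Φ) (0, chart m p x) (1, 0) := by
  have hq := S.mapsTo 0 S.zero_mem x hx
  have h1 : ContMDiff 𝓘(ℝ, ℝ) (𝓘(ℝ, ℝ).prod (𝓡 m)) ∞ (fun t : ℝ ↦ (t, x)) :=
    contMDiff_id.prodMk contMDiff_const
  have h2 : MDifferentiableAt 𝓘(ℝ, ℝ) (𝓡 n) (fun t ↦ Φ t x) 0 :=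
    (((S.smooth.contMDiffAt ((isOpen_Ioo.prod isOpen_univ).mem_nhds
      (x := ((0 : ℝ), x)) ⟨S.zero_mem, mem_univ x⟩))).comp (0 : ℝ)
        h1.contMDiffAt).mdifferentiableAt (by simp)
  have h3 : MDifferentiableAt (𝓡 n) (𝓡 n) (chart n q) (Φ 0 x) :=
    mdifferentiableAt_atlas (chart_mem_atlas _ q) hq
  have h4 := mfderiv_comp (0 : ℝ) (g := chart n q) (f := fun t ↦ Φ t x) h3 h2
  have h5 : (chart n q ∘ fun t ↦ Φ t x) = fun t ↦ locFam m n p q Φ (t, chart m p x) := by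
    funext t
    simp only [Function.comp_apply, locFam, locMap, (chart m p).left_inv (S.subset hx)]
  have h6 := S.hasDerivAt_locFam ((mem_locSet (S.subset hx)).2 hx)
  rw [h5, mfderiv_eq_fderiv, h6.hasFDerivAt.fderiv] at h4
  have h7 := congrArg (fun L : ℝ →L[ℝ] EuclideanSpace ℝ (Fin n) ↦ L 1) h4
  rw [triv_eq_mfderiv hq]
  refine h7.symm.trans ?_
  simp

/-- The complement of `Ω` is open and the family is constant in time there; hence the variation
field vanishes near the point and not merely at it. -/
theorem fderiv_locFam_eventuallyEq [T2Space M] (hΩ : IsCompact Ω) {z : EuclideanSpace ℝ (Fin m)}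
    (hz : z ∈ locSet m p O) (hzΩ : (chart m p).symm z ∉ Ω) :
    (fun y ↦ fderiv ℝ (locFam m n p q Φ) (0, y) (1, 0)) =ᶠ[𝓝 z] fun _ ↦ 0 := by
  have hO : IsOpen (locSet m p (O ∩ Ωᶜ)) := isOpen_locSet p
    (S.isOpen.inter hΩ.isClosed.isOpen_compl)
  filter_upwards [hO.mem_nhds ⟨hz.1, hz.2, hzΩ⟩] with y hy
  have h1 := S.hasDerivAt_locFam ⟨hy.1, hy.2.1⟩
  have h2 : (fun t ↦ locFam m n p q Φ (t, y)) =ᶠ[𝓝 0] fun _ ↦ locFam m n p q Φ (0, y) := by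
    filter_upwards [isOpen_Ioo.mem_nhds S.zero_mem] with t ht
    simp only [locFam, locMap, S.eq_off t ht _ hy.2.2]
  exact h1.unique ((hasDerivAt_const (0 : ℝ) _).congr_of_eventuallyEq h2)

end IsChartVariation

end Variations

/-! ## First variation of the bienergy in a chart -/

section ChartFirstVariation

variable {m n : ℕ} {M : Type*} [TopologicalSpace M] [T2Space M] [SecondCountableTopology M]
  [ChartedSpace (EuclideanSpace ℝ (Fin m)) M] [IsManifold (𝓡 m) ∞ M]
  {N : Type*} [TopologicalSpace N] [ChartedSpace (EuclideanSpace ℝ (Fin n)) N]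
  [IsManifold (𝓡 n) ∞ N]
  [RiemannianBundle (fun x : M ↦ TangentSpace (𝓡 m) x)]
  [RiemannianBundle (fun q : N ↦ TangentSpace (𝓡 n) q)]
  [IsContMDiffRiemannianBundle (𝓡 m) ∞ (EuclideanSpace ℝ (Fin m))
    (fun x : M ↦ TangentSpace (𝓡 m) x)]
  [IsContMDiffRiemannianBundle (𝓡 n) ∞ (EuclideanSpace ℝ (Fin n))
    (fun q : N ↦ TangentSpace (𝓡 n) q)]

theorem continuous_norm_tension_sq {φ : M → N} (hφ : ContMDiff (𝓡 m) (𝓡 n) ∞ φ) :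
    Continuous fun x ↦ ‖tension m n φ x‖ ^ 2 := by
  refine continuous_iff_continuousAt.2 fun x ↦ ?_
  have hx := mem_chart_source (EuclideanSpace ℝ (Fin m)) x
  have hq := mem_chart_source (EuclideanSpace ℝ (Fin n)) (φ x)
  have hU := isOpen_inter_charts isOpen_univ hφ.contMDiffOn (φ x)
  set O := locSet m x (univ ∩ φ ⁻¹' (chart n (φ x)).source) with hO
  have hOo : IsOpen O := isOpen_locSet x hU
  have hf : ContDiffOn ℝ ∞ (locMap m n x (φ x) φ) O := contDiffOn_locMap_inter hφ.contMDiffOn x (φ x)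
  have hfm : MapsTo (locMap m n x (φ x) φ) O (chart n (φ x)).target :=
    fun z hz ↦ (chart n (φ x)).map_source hz.2.2
  have hg := (isMetricOn_hloc (n := m) x).mono hOo inter_subset_left
  have hh := isMetricOn_hloc (n := n) (φ x)
  have hτ := contDiffOn_tens (b := stdB m) hg hh hf hfm
  have hc := (((hh.smooth.comp hf hfm).clm_apply hτ).clm_apply hτ).continuousOn
  have hzx : chart m x x ∈ O := (mem_locSet hx).2 ⟨mem_univ _, hq⟩
  have h1 := (hc.continuousAt (hOo.mem_nhds hzx)).comp
    ((chart m x).continuousAt hx)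
  refine h1.congr ?_
  filter_upwards [(hU.inter (chart m x).open_source).mem_nhds ⟨⟨mem_univ _, hq⟩, hx⟩] with y hy
  exact (norm_tension_sq isOpen_univ hφ.contMDiffOn (mem_univ y) hy.2 hy.1.2).symm

variable (m n) in
/-- The function `⟨∇_X V, τ⟩ - ⟨V, ∇_X τ⟩` for `X = grad ρ`, where `V` is the variation field of a
family of maps and `τ` the tension field. -/
def variationFlux (Φ : ℝ → M → N) (ρ : M → ℝ) (x : M) : ℝ :=
  inner ℝ (covAlong (Φ 0) (variationField Φ) x (grad m ρ x)) (tension m n (Φ 0) x)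
    - inner ℝ (variationField Φ x) (covAlong (Φ 0) (tension m n (Φ 0)) x (grad m ρ x))

theorem grad_eq_zero_of_eventuallyEq_const {f : M → ℝ} {x : M} {c : ℝ}
    (h : f =ᶠ[𝓝 x] fun _ ↦ c) : grad m f x = 0 := by
  have h2 : mvfderiv (𝓡 m) f x = 0 := by
    have h3 : mfderiv (𝓡 m) 𝓘(ℝ, ℝ) f x = 0 := by
      rw [h.mfderiv_eq, mfderiv_const]; rfl
    ext u
    exact congrArg (fun L : TangentSpace (𝓡 m) x →L[ℝ] ℝ ↦ L u) h3
  rw [grad, h2, map_zero]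

theorem grad_eq_zero {ρ : M → ℝ} {x : M} (hx : x ∉ tsupport ρ) : grad m ρ x = 0 :=
  grad_eq_zero_of_eventuallyEq_const (notMem_tsupport_iff_eventuallyEq.1 hx)

theorem variationFlux_eq_zero {Φ : ℝ → M → N} {ρ : M → ℝ} {x : M} (hx : x ∉ tsupport ρ) :
    variationFlux m n Φ ρ x = 0 := by
  rw [variationFlux, grad_eq_zero hx, covAlong_zero_right, covAlong_zero_right, inner_zero_left,
    inner_zero_right, sub_zero]

theorem tsupport_variationFlux {Φ : ℝ → M → N} {ρ : M → ℝ} :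
    tsupport (variationFlux m n Φ ρ) ⊆ tsupport ρ :=
  closure_minimal (fun _ hx ↦ by_contra fun h ↦ hx (variationFlux_eq_zero h)) (isClosed_tsupport _)

namespace IsChartVariation

variable {p : M} {q : N} {O Ω : Set M} {ε : ℝ} {Φ : ℝ → M → N}
  (S : IsChartVariation m n p q O Ω ε Φ)
include S

theorem isMetricOn_left : IsMetricOn (hloc m p) (locSet m p O) :=
  (isMetricOn_hloc p).mono (isOpen_locSet p S.isOpen) inter_subset_left

theorem contDiffOn_zero : ContDiffOn ℝ ∞ (locMap m n p q (Φ 0)) (locSet m p O) :=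
  (contDiffOn_slice S.contDiffOn_locFam 0).mono fun _ hz ↦ ⟨S.zero_mem, hz⟩

theorem mapsTo_zero : MapsTo (locMap m n p q (Φ 0)) (locSet m p O) (chart n q).target :=
  fun _ hz ↦ S.mapsTo_locFam (x := (0, _)) ⟨S.zero_mem, hz⟩

theorem contDiffOn_field : ContDiffOn ℝ ∞ (fun z ↦ fderiv ℝ (locFam m n p q Φ) (0, z) (1, 0))
    (locSet m p O) :=
  (contDiffOn_slice (V := fun s ↦ fderiv ℝ (locFam m n p q Φ) s (1, 0))
    (contDiffOn_fderiv_apply S.isOpen_domain S.contDiffOn_locFam contDiffOn_const) 0).mono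
    fun _ hz ↦ ⟨S.zero_mem, hz⟩

theorem contDiffOn_tens_zero : ContDiffOn ℝ ∞
    (tens (hloc m p) (hloc n q) (stdB m) (locMap m n p q (Φ 0))) (locSet m p O) :=
  contDiffOn_tens S.isMetricOn_left (isMetricOn_hloc q) S.contDiffOn_zero S.mapsTo_zero

theorem norm_tension_sq_eq {t : ℝ} (ht : t ∈ Ioo (-ε) ε) {x : M} (hx : x ∈ O) :
    ‖tension m n (Φ t) x‖ ^ 2 = hloc n q (locFam m n p q Φ (t, chart m p x))
      (tensFam (hloc m p) (hloc n q) (stdB m) (locFam m n p q Φ) (t, chart m p x))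
      (tensFam (hloc m p) (hloc n q) (stdB m) (locFam m n p q Φ) (t, chart m p x)) := by
  rw [norm_tension_sq isOpen_univ (contMDiff_slice S.smooth ht).contMDiffOn (mem_univ x)
    (S.subset hx) (S.mapsTo t ht x hx),
    ← tens_slice S.isOpen_domain S.contDiffOn_locFam (p := (t, chart m p x))
      ⟨ht, (mem_locSet (S.subset hx)).2 hx⟩]
  rfl

/-- On the right stands `locExt` and not `locFun`, because the Euclidean integration by parts needs
a cutoff on the whole model space; near the point the two agree. -/
theorem variationFlux_eq {ρ : M → ℝ} (hρ : ContMDiff (𝓡 m) 𝓘(ℝ, ℝ) ∞ ρ) {x : M} (hx : x ∈ O) :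
    variationFlux m n Φ ρ x = flux (hloc n q) (locMap m n p q (Φ 0))
      (fun z ↦ fderiv ℝ (locFam m n p q Φ) (0, z) (1, 0))
      (tens (hloc m p) (hloc n q) (stdB m) (locMap m n p q (Φ 0))) (chart m p x)
      (sharp (hloc m p) (chart m p x) (fderiv ℝ (locExt m p ρ) (chart m p x))) := by
  have hxs := S.subset hx
  have hq := S.mapsTo 0 S.zero_mem x hx
  have hz : chart m p x ∈ locSet m p O := (mem_locSet hxs).2 hx
  have hO : IsOpen (locSet m p O) := isOpen_locSet p S.isOpen
  have hφ := (contMDiff_slice S.smooth S.zero_mem).contMDiffOn (s := univ)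
  have e1 : locFun m p (components (Φ 0) (variationField Φ) q) =ᶠ[𝓝 (chart m p x)]
      fun z ↦ fderiv ℝ (locFam m n p q Φ) (0, z) (1, 0) := by
    filter_upwards [hO.mem_nhds hz] with z hz'
    have := S.triv_variationField hz'.2
    rw [(chart m p).right_inv hz'.1] at this
    exact this
  have e2 : locFun m p (components (Φ 0) (tension m n (Φ 0)) q) =ᶠ[𝓝 (chart m p x)]
      tens (hloc m p) (hloc n q) (stdB m) (locMap m n p q (Φ 0)) := by
    filter_upwards [hO.mem_nhds hz] with z hz'
    have := triv_tension (p := p) isOpen_univ hφ (mem_univ _) (S.subset hz'.2)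
      (S.mapsTo 0 S.zero_mem _ hz'.2)
    rw [(chart m p).right_inv hz'.1] at this
    exact this
  have e3 : locExt m p ρ =ᶠ[𝓝 (chart m p x)] locFun m p ρ := by
    filter_upwards [hO.mem_nhds hz] with z hz'
    exact locExt_of_mem hz'.1
  have d1 := (differentiableAt_of_contDiffOn hO S.contDiffOn_field hz).congr_of_eventuallyEq e1
  have d2 := (differentiableAt_of_contDiffOn hO S.contDiffOn_tens_zero hz).congr_of_eventuallyEq e2
  have hρl : ContDiffOn ℝ ∞ (locFun m p ρ) (locSet m p univ) := contDiffOn_locFun hρ.contMDiffOn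
  have d3 := differentiableAt_of_contDiffOn (isOpen_locSet p isOpen_univ) hρl
    ⟨hz.1, mem_univ _⟩
  have hxx : chart n q (Φ 0 x) = locMap m n p q (Φ 0) (chart m p x) := by
    rw [locMap, (chart m p).left_inv hxs]
  rw [variationFlux, ← hloc_triv hq, ← hloc_triv hq,
    triv_covAlong isOpen_univ hφ (mem_univ x) hxs hq d1,
    triv_covAlong isOpen_univ hφ (mem_univ x) hxs hq d2,
    cov_congr_of_eventuallyEq Filter.EventuallyEq.rfl e1,
    cov_congr_of_eventuallyEq Filter.EventuallyEq.rfl e2, triv_grad hxs d3, e3.fderiv_eq,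
    S.triv_variationField hx, triv_tension isOpen_univ hφ (mem_univ x) hxs hq, hxx, flux_apply]

section Bump

variable {ρ : M → ℝ} (hρ : ContMDiff (𝓡 m) 𝓘(ℝ, ℝ) ∞ ρ) (hcs : HasCompactSupport ρ)
  (hs : tsupport ρ ⊆ O)
include hρ hcs hs

theorem contDiffOn_flux_sharp : ContDiffOn ℝ ∞ (fun z ↦ flux (hloc n q) (locMap m n p q (Φ 0))
      (fun z ↦ fderiv ℝ (locFam m n p q Φ) (0, z) (1, 0))
      (tens (hloc m p) (hloc n q) (stdB m) (locMap m n p q (Φ 0))) z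
      (sharp (hloc m p) z (fderiv ℝ (locExt m p ρ) z))) (locSet m p O) :=
  (contDiffOn_flux (isOpen_locSet p S.isOpen) (isMetricOn_hloc q) S.contDiffOn_zero S.mapsTo_zero
    S.contDiffOn_field S.contDiffOn_tens_zero).clm_apply
    (S.isMetricOn_left.contDiffOn_sharp.clm_apply
      ((contDiff_locExt hcs (hs.trans S.subset) hρ).fderiv_right (m := ∞) (by simp)).contDiffOn)

theorem continuous_variationFlux : Continuous (variationFlux m n Φ ρ) := by
  refine ContinuousOn.continuous_of_tsupport_subset ?_ S.isOpen (tsupport_variationFlux.trans hs)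
  refine ((S.contDiffOn_flux_sharp hρ hcs hs).continuousOn.comp
    ((chart m p).continuousOn.mono S.subset)
    fun x hx ↦ (mem_locSet (S.subset hx)).2 hx).congr fun x hx ↦ S.variationFlux_eq hρ hx

variable [MeasurableSpace M] [BorelSpace M]

theorem integral_variationFlux : ∫ x, variationFlux m n Φ ρ x ∂(riemannianVolume m M)
    = ∫ z, density (hloc m p) (stdB m) z * flux (hloc n q) (locMap m n p q (Φ 0))
      (fun z ↦ fderiv ℝ (locFam m n p q Φ) (0, z) (1, 0))
      (tens (hloc m p) (hloc n q) (stdB m) (locMap m n p q (Φ 0))) z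
      (sharp (hloc m p) z (fderiv ℝ (locExt m p ρ) z)) := by
  have hss := hs.trans S.subset
  rw [← setIntegral_eq_integral_of_forall_compl_eq_zero (s := tsupport ρ)
    fun x hx ↦ variationFlux_eq_zero hx,
    setIntegral_riemannianVolume hcs.isCompact hss
      (S.continuous_variationFlux hρ hcs hs).continuousOn]
  refine Eq.trans ?_ (setIntegral_eq_integral_of_forall_compl_eq_zero
    (s := chart m p '' tsupport ρ) ?_)
  · refine setIntegral_congr_fun (isCompact_chart_image_tsupport hcs hss).measurableSet ?_
    rintro _ ⟨x, hx, rfl⟩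
    simp only [locFun, (chart m p).left_inv (hss hx)]
    rw [S.variationFlux_eq hρ (hs hx)]
  · intro z hz
    have h0 : fderiv ℝ (locExt m p ρ) z = 0 := image_eq_zero_of_notMem_tsupport fun h ↦
      hz (tsupport_locExt hcs hss (tsupport_fderiv_subset ℝ h))
    rw [h0, map_zero, map_zero, mul_zero]

/-- The flux is integrated as an intrinsic function on `M`, since the remainders from different
charts have to be added pointwise. The main term may stay in its chart: it is only ever shown to
vanish or to be positive. -/
theorem hasDerivAt_setIntegral_tension_sq (hΩ : IsCompact Ω) :
    HasDerivAt (fun t ↦ ∫ x in Ω, ρ x * ‖tension m n (Φ t) x‖ ^ 2 ∂(riemannianVolume m M))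
      (2 * ((∫ z, locExt m p ρ z * (density (hloc m p) (stdB m) z
          * hloc n q (locMap m n p q (Φ 0) z) (fderiv ℝ (locFam m n p q Φ) (0, z) (1, 0))
            (jac (hloc m p) (hloc n q) (stdB m) (locMap m n p q (Φ 0))
              (tens (hloc m p) (hloc n q) (stdB m) (locMap m n p q (Φ 0))) z)))
        - ∫ x, variationFlux m n Φ ρ x ∂(riemannianVolume m M))) 0 := by
  have hss := hs.trans S.subset
  -- The set `Ω` need not lie in the chart, but its intersection with the support of `ρ` does.
  have hA : IsCompact (Ω ∩ tsupport ρ) := hΩ.inter_right (isClosed_tsupport ρ)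
  have hAs : Ω ∩ tsupport ρ ⊆ (chart m p).source := inter_subset_right.trans hss
  have hKc := hA.image_of_continuousOn ((chart m p).continuousOn.mono hAs)
  have hKO : chart m p '' (Ω ∩ tsupport ρ) ⊆ locSet m p O := by
    rintro _ ⟨x, hx, rfl⟩
    exact (mem_locSet (hAs hx)).2 (hs hx.2)
  have hsO : tsupport (locExt m p ρ) ⊆ locSet m p O := by
    refine (tsupport_locExt hcs hss).trans ?_
    rintro _ ⟨x, hx, rfl⟩
    exact (mem_locSet (hss hx)).2 (hs hx)
  have main := hasDerivAt_integral_tension_sq (b := stdB m) S.isMetricOn_left (isMetricOn_hloc q)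
    (volume : Measure (EuclideanSpace ℝ (Fin m))) S.isOpen_domain S.contDiffOn_locFam
    S.mapsTo_locFam (fun s hs ↦ hs.2) (fun z hz ↦ ⟨S.zero_mem, hz⟩)
    (contDiff_locExt hcs hss hρ) (hasCompactSupport_locExt hcs hss) hsO hKc hKO (by
      intro z hz hzK
      by_cases hzΩ : (chart m p).symm z ∈ Ω
      · left
        refine locExt_eq_zero hcs hss ?_
        rintro ⟨x, hx, rfl⟩
        rw [(chart m p).left_inv (hss hx)] at hzΩ
        exact hzK ⟨x, ⟨hzΩ, hx⟩, rfl⟩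
      · exact Or.inr (S.fderiv_locFam_eventuallyEq hΩ hz hzΩ))
  rw [S.integral_variationFlux hρ hcs hs]
  refine main.congr_of_eventuallyEq ?_
  filter_upwards [isOpen_Ioo.mem_nhds S.zero_mem] with t ht
  have hc := continuous_norm_tension_sq (contMDiff_slice S.smooth ht)
  rw [setIntegral_eq_of_subset_of_forall_sdiff_eq_zero hΩ.measurableSet
    (inter_subset_left (t := tsupport ρ)),
    setIntegral_riemannianVolume (k := fun x ↦ ρ x * ‖tension m n (Φ t) x‖ ^ 2) hA hAs
      (hρ.continuous.mul hc).continuousOn]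
  · refine setIntegral_congr_fun hKc.measurableSet ?_
    rintro _ ⟨x, hx, rfl⟩
    have h1 : ‖tension m n (Φ t) ((chart m p).symm (chart m p x))‖ ^ 2
        = ‖tension m n (Φ t) x‖ ^ 2 :=
      congrArg (fun y ↦ ‖tension m n (Φ t) y‖ ^ 2) ((chart m p).left_inv (hAs hx))
    simp only [locFun, h1]
    rw [S.norm_tension_sq_eq ht (hs hx.2), locExt_of_mem ((chart m p).map_source (hAs hx)),
      (chart m p).left_inv (hAs hx)]
  · intro x hx
    rw [image_eq_zero_of_notMem_tsupport fun h ↦ hx.2 ⟨hx.1, h⟩, zero_mul]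

theorem variationFlux_eq_zero_of_notMem (hΩ : IsCompact Ω) {x : M} (hx : x ∉ Ω) :
    variationFlux m n Φ ρ x = 0 := by
  by_cases hxt : x ∈ tsupport ρ
  · have hxO := hs hxt
    have hxs := S.subset hxO
    have e := S.fderiv_locFam_eventuallyEq hΩ ((mem_locSet hxs).2 hxO)
      (by rwa [(chart m p).left_inv hxs])
    rw [S.variationFlux_eq hρ hxO, flux_apply,
      cov_congr_of_eventuallyEq Filter.EventuallyEq.rfl e, e.eq_of_nhds, cov]
    simp
  · exact variationFlux_eq_zero hxt

end Bump

end IsChartVariation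

end ChartFirstVariation

/-! ## The first variation of the bienergy -/

section FirstVariation

variable {m n : ℕ} {M : Type*} [TopologicalSpace M]
  [ChartedSpace (EuclideanSpace ℝ (Fin m)) M] [IsManifold (𝓡 m) ∞ M]
  [RiemannianBundle (fun x : M ↦ TangentSpace (𝓡 m) x)]
  {N : Type*} [TopologicalSpace N] [ChartedSpace (EuclideanSpace ℝ (Fin n)) N]
  [IsManifold (𝓡 n) ∞ N]

theorem grad_sum {κ : Type*} (s : Finset κ) (f : κ → M → ℝ) {x : M}
    (hf : ∀ i ∈ s, MDifferentiableAt (𝓡 m) 𝓘(ℝ, ℝ) (f i) x) :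
    MDifferentiableAt (𝓡 m) 𝓘(ℝ, ℝ) (∑ i ∈ s, f i) x ∧
      grad m (∑ i ∈ s, f i) x = ∑ i ∈ s, grad m (f i) x := by
  classical
  induction s using Finset.induction_on with
  | empty =>
    simp only [Finset.sum_empty]
    exact ⟨mdifferentiableAt_const, by rw [grad, mvfderiv_zero, map_zero]⟩
  | insert a s ha ih =>
    obtain ⟨h1, h2⟩ := ih fun i hi ↦ hf i (Finset.mem_insert_of_mem hi)
    have h3 := hf a (Finset.mem_insert_self a s)
    rw [Finset.sum_insert ha, Finset.sum_insert ha, ← h2]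
    exact ⟨h3.add h1, by rw [grad, mvfderiv_add h3 h1, map_add]; rfl⟩

variable (m n) in
-- By joint continuity a product neighbourhood of $(0,x)$ is sent into the chart at `Φ 0 x`; the
-- time interval is shrunk to fit.
theorem exists_isChartVariation {Ω : Set M} {ε : ℝ} {Φ : ℝ → M → N} (hε : 0 < ε)
    (hs : ContMDiffOn (𝓘(ℝ, ℝ).prod (𝓡 m)) (𝓡 n) ∞ (fun s : ℝ × M ↦ Φ s.1 s.2)
      (Ioo (-ε) ε ×ˢ univ))
    (hoff : ∀ t ∈ Ioo (-ε) ε, ∀ x ∉ Ω, Φ t x = Φ 0 x) (x : M) :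
    ∃ (O : Set M) (δ : ℝ), x ∈ O ∧ IsChartVariation m n x (Φ 0 x) O Ω δ Φ := by
  have h0 : (0 : ℝ) ∈ Ioo (-ε) ε := ⟨neg_lt_zero.2 hε, hε⟩
  have hW := hs.continuousOn.isOpen_inter_preimage (isOpen_Ioo.prod isOpen_univ)
    (chart n (Φ 0 x)).open_source
  obtain ⟨u, v, hu, hu0, hv, hxv, huv⟩ := mem_nhds_prod_iff'.1 (hW.mem_nhds (x := ((0 : ℝ), x))
    ⟨⟨h0, mem_univ x⟩, mem_chart_source (EuclideanSpace ℝ (Fin n)) (Φ 0 x)⟩)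
  obtain ⟨δ, hδ, hδu⟩ := Metric.isOpen_iff.1 hu 0 hu0
  rw [Real.ball_eq_Ioo, zero_sub, zero_add] at hδu
  have hδε : Ioo (-δ) δ ⊆ Ioo (-ε) ε := fun t ht ↦ (@huv (t, x) ⟨hδu ht, hxv⟩).1.1
  exact ⟨v ∩ (chart m x).source, δ, ⟨hxv, mem_chart_source _ x⟩,
    { pos := hδ
      smooth := hs.mono (prod_mono hδε Subset.rfl)
      isOpen := hv.inter (chart m x).open_source
      subset := inter_subset_right
      mapsTo := fun t ht y hy ↦ (@huv (t, y) ⟨hδu ht, hy.1⟩).2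
      eq_off := fun t ht y hy ↦ hoff t (hδε ht) y hy }⟩

variable [T2Space M] [SecondCountableTopology M]
  [RiemannianBundle (fun q : N ↦ TangentSpace (𝓡 n) q)]
  [IsContMDiffRiemannianBundle (𝓡 m) ∞ (EuclideanSpace ℝ (Fin m))
    (fun x : M ↦ TangentSpace (𝓡 m) x)]
  [IsContMDiffRiemannianBundle (𝓡 n) ∞ (EuclideanSpace ℝ (Fin n))
    (fun q : N ↦ TangentSpace (𝓡 n) q)]
  [MeasurableSpace M] [BorelSpace M]

/-- A map satisfying the local form of the biharmonic map equation is biharmonic. -/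
theorem isBiharmonic_of_jac_eq_zero {φ : M → N} (hφ : ContMDiff (𝓡 m) (𝓡 n) ∞ φ)
    (J : ∀ (p : M) (q : N) (x : M), x ∈ (chart m p).source → φ x ∈ (chart n q).source →
      jac (hloc m p) (hloc n q) (stdB m) (locMap m n p q φ)
        (tens (hloc m p) (hloc n q) (stdB m) (locMap m n p q φ)) (chart m p x) = 0) :
    IsBiharmonic m n φ := by
  refine ⟨hφ, fun Ω hΩ ε hε Φ hΦ ↦ ?_⟩
  obtain rfl := hΦ.zero
  have h0 : (0 : ℝ) ∈ Ioo (-ε) ε := ⟨neg_lt_zero.2 hε, hε⟩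
  have : LocallyCompactSpace M := ChartedSpace.locallyCompactSpace (EuclideanSpace ℝ (Fin m)) M
  choose O δ hxO S using exists_isChartVariation m n hε hΦ.smooth hΦ.eq_off
  choose K hK hxK using fun x : M ↦ exists_compact_mem_nhds x
  have hU : ∀ x, IsOpen (O x ∩ interior (K x)) := fun x ↦ (S x).isOpen.inter isOpen_interior
  -- Intersecting with the interiors of compact sets makes the supports compact.
  obtain ⟨f, hf⟩ := SmoothPartitionOfUnity.exists_isSubordinate (𝓡 m) isClosed_univ
    (fun x ↦ O x ∩ interior (K x)) hU
    fun x _ ↦ mem_iUnion.2 ⟨x, hxO x, mem_interior_iff_mem_nhds.2 (hxK x)⟩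
  have hsub : ∀ i, tsupport (f i) ⊆ O i := fun i ↦ (hf i).trans inter_subset_left
  have hcs : ∀ i, HasCompactSupport (f i) := fun i ↦
    (hK i).of_isClosed_subset (isClosed_tsupport _)
      ((hf i).trans (inter_subset_right.trans interior_subset))
  have hsm : ∀ i, ContMDiff (𝓡 m) 𝓘(ℝ, ℝ) ∞ (f i) := fun i ↦ (f i).contMDiff
  have hfin := f.locallyFinite.closure.finite_nonempty_inter_compact hΩ
  set T : Finset M := hfin.toFinset with hT
  -- Only finitely many supports meet `Ω`. The sum is 1 on a neighbourhood of each point of `Ω`,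
  -- which is needed to differentiate it.
  have hsum : ∀ x ∈ Ω, ∀ᶠ y in 𝓝 x, ∑ i ∈ T, f i y = 1 := by
    intro x hx
    filter_upwards [f.eventually_finsupport_subset x] with y hy
    rw [← f.sum_finsupport y (mem_univ y)]
    symm
    refine Finset.sum_subset (fun i hi ↦ ?_) fun i _ hi ↦ ?_
    · rw [hT, hfin.mem_toFinset]
      exact ⟨x, (f.mem_fintsupport_iff x i).1 (hy hi), hx⟩
    · by_contra h
      exact hi ((f.mem_finsupport y).2 h)
  -- On `Ω` the gradients add up to $\operatorname{grad}1=0$; off `Ω` each flux vanishes together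
  -- with the variation field.
  have hflux : ∀ x, ∑ i ∈ T, variationFlux m n Φ (f i) x = 0 := by
    intro x
    by_cases hx : x ∈ Ω
    · have hg : ∑ i ∈ T, grad m (f i) x = 0 := by
        rw [← (grad_sum T (fun i ↦ (f i : M → ℝ))
          fun i _ ↦ (hsm i).mdifferentiableAt (by simp)).2]
        refine grad_eq_zero_of_eventuallyEq_const (c := 1) ?_
        filter_upwards [hsum x hx] with y hy
        rw [Finset.sum_apply, hy]
      simp only [variationFlux]
      rw [Finset.sum_sub_distrib, ← sum_inner, ← inner_sum, ← covAlong_sum_right,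
        ← covAlong_sum_right, hg, covAlong_zero_right, covAlong_zero_right, inner_zero_left,
        inner_zero_right, sub_zero]
    · exact Finset.sum_eq_zero fun i _ ↦
        (S i).variationFlux_eq_zero_of_notMem (hsm i) (hcs i) (hsub i) hΩ hx
  have hd := HasDerivAt.fun_sum fun i (_ : i ∈ T) ↦
    (S i).hasDerivAt_setIntegral_tension_sq (hsm i) (hcs i) (hsub i) hΩ
  -- The integrand contains the factor $J\tau$, which vanishes wherever the cutoff does not.
  have hzero : ∀ i ∈ T, (∫ z, locExt m i (f i) z * (density (hloc m i) (stdB m) z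
      * hloc n (Φ 0 i) (locMap m n i (Φ 0 i) (Φ 0) z)
        (fderiv ℝ (locFam m n i (Φ 0 i) Φ) (0, z) (1, 0))
        (jac (hloc m i) (hloc n (Φ 0 i)) (stdB m) (locMap m n i (Φ 0 i) (Φ 0))
          (tens (hloc m i) (hloc n (Φ 0 i)) (stdB m) (locMap m n i (Φ 0 i) (Φ 0))) z))) = 0 := by
    intro i _
    refine integral_eq_zero_of_ae (Filter.Eventually.of_forall fun z ↦ ?_)
    by_cases hz : z ∈ locSet m i (O i)
    · have h1 := J i (Φ 0 i) ((chart m i).symm z) ((chart m i).map_target hz.1)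
        ((S i).mapsTo 0 (S i).zero_mem _ hz.2)
      rw [(chart m i).right_inv hz.1] at h1
      simp only [h1, map_zero, mul_zero, Pi.zero_apply]
    · have h1 : locExt m i (f i) z = 0 := by
        refine locExt_eq_zero (hcs i) ((hsub i).trans (S i).subset) ?_
        rintro ⟨x, hx, rfl⟩
        exact hz ((mem_locSet ((S i).subset (hsub i hx))).2 (hsub i hx))
      simp only [h1, zero_mul, Pi.zero_apply]
  have hint : ∀ i ∈ T, Integrable (variationFlux m n Φ (f i)) (riemannianVolume m M) :=
    fun i _ ↦ ((S i).continuous_variationFlux (hsm i) (hcs i)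
      (hsub i)).integrable_of_hasCompactSupport
      ((hcs i).isCompact.of_isClosed_subset (isClosed_tsupport _) tsupport_variationFlux)
  have hval : ∑ i ∈ T, (2 * ((∫ z, locExt m i (f i) z * (density (hloc m i) (stdB m) z
      * hloc n (Φ 0 i) (locMap m n i (Φ 0 i) (Φ 0) z)
        (fderiv ℝ (locFam m n i (Φ 0 i) Φ) (0, z) (1, 0))
        (jac (hloc m i) (hloc n (Φ 0 i)) (stdB m) (locMap m n i (Φ 0 i) (Φ 0))
          (tens (hloc m i) (hloc n (Φ 0 i)) (stdB m) (locMap m n i (Φ 0 i) (Φ 0))) z)))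
      - ∫ x, variationFlux m n Φ (f i) x ∂(riemannianVolume m M))) = 0 := by
    rw [← Finset.mul_sum, Finset.sum_sub_distrib, Finset.sum_eq_zero hzero,
      ← integral_finsetSum T hint]
    simp only [hflux, integral_zero, sub_zero, mul_zero]
  rw [hval] at hd
  have hd' := hd.const_mul (1 / 2)
  rw [mul_zero] at hd'
  refine hd'.congr_of_eventuallyEq ?_
  filter_upwards [isOpen_Ioo.mem_nhds h0] with t ht
  have hc := continuous_norm_tension_sq (contMDiff_slice hΦ.smooth ht)
  have hs : ∑ i ∈ T, ∫ x in Ω, f i x * ‖tension m n (Φ t) x‖ ^ 2 ∂(riemannianVolume m M)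
      = ∫ x in Ω, ‖tension m n (Φ t) x‖ ^ 2 ∂(riemannianVolume m M) := by
    rw [← integral_finsetSum T fun i _ ↦
      (((hsm i).continuous.mul hc).continuousOn.integrableOn_compact hΩ :
        IntegrableOn (fun x ↦ f i x * ‖tension m n (Φ t) x‖ ^ 2) Ω _)]
    refine setIntegral_congr_fun hΩ.measurableSet fun x hx ↦ ?_
    simp only [← Finset.sum_mul, (hsum x hx).self_of_nhds, one_mul]
  rw [bienergy, hs]

end FirstVariation

/-! ### Construction of variations, and the Jacobi equation from biharmonicity. -/

section Variation

variable {m n : ℕ} {M : Type*} [TopologicalSpace M]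
  [ChartedSpace (EuclideanSpace ℝ (Fin m)) M] [IsManifold (𝓡 m) ∞ M]
  {N : Type*} [TopologicalSpace N] [ChartedSpace (EuclideanSpace ℝ (Fin n)) N]
  [IsManifold (𝓡 n) ∞ N]

/-- A vector field in the charts, cut off by a bump function, is the variation field of a variation
which is affine in the charts. -/
theorem exists_isChartVariation_of_field {φ : M → N} (hφ : ContMDiff (𝓡 m) (𝓡 n) ∞ φ) {p : M} {q : N}
    {O : Set M} (hO : IsOpen O) (hOs : O ⊆ (chart m p).source) (hOq : MapsTo φ O (chart n q).source)
    {P : M → EuclideanSpace ℝ (Fin n)} (hP : ContMDiffOn (𝓡 m) 𝓘(ℝ, EuclideanSpace ℝ (Fin n)) ∞ P O)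
    {β : M → ℝ} (hβ : ContMDiff (𝓡 m) 𝓘(ℝ, ℝ) ∞ β) (hcs : HasCompactSupport β)
    (hβO : tsupport β ⊆ O) :
    ∃ (ε : ℝ) (Φ : ℝ → M → N), Φ 0 = φ ∧ IsChartVariation m n p q O (tsupport β) ε Φ ∧
      ∀ t ∈ Ioo (-ε) ε, ∀ y ∈ O, chart n q (Φ t y) = chart n q (φ y) + (t * β y) • P y := by
  classical
  set G : ℝ × M → EuclideanSpace ℝ (Fin n) :=
    fun s ↦ chart n q (φ s.2) + (s.1 * β s.2) • P s.2 with hG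
  have hGs : ContMDiffOn (𝓘(ℝ, ℝ).prod (𝓡 m)) 𝓘(ℝ, EuclideanSpace ℝ (Fin n)) ∞ G
      (univ ×ˢ O) := by
    have h1 : ContMDiffOn (𝓡 m) 𝓘(ℝ, EuclideanSpace ℝ (Fin n)) ∞ (fun y ↦ chart n q (φ y)) O :=
      (contMDiffOn_chart (I := 𝓡 n) (n := ∞) (x := q)).comp hφ.contMDiffOn hOq
    have h2 : ContMDiff (𝓘(ℝ, ℝ).prod (𝓡 m)) 𝓘(ℝ, ℝ) ∞ (fun s : ℝ × M ↦ s.1 * β s.2) :=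
      contMDiff_fst.mul (hβ.comp contMDiff_snd)
    exact (h1.comp contMDiffOn_snd fun s hs ↦ hs.2).add
      (h2.contMDiffOn.smul (hP.comp contMDiffOn_snd fun s hs ↦ hs.2))
  have hGβ : ∀ t, ∀ y ∉ tsupport β, G (t, y) = chart n q (φ y) := fun t y hy ↦ by
    simp only [hG, image_eq_zero_of_notMem_tsupport hy, mul_zero, zero_smul, add_zero]
  have hG0 : ∀ y, G (0, y) = chart n q (φ y) := fun y ↦ by
    simp only [hG, zero_mul, zero_smul, add_zero]
  have hn := hGs.continuousOn.isOpen_inter_preimage (isOpen_univ.prod hO) (chart n q).open_target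
  -- Compactness of the support of `β` yields one `ε` for which the affine family stays in the chart
  -- target; elsewhere on `O` it does not move.
  obtain ⟨u, v, hu, -, hu0, hv, huv⟩ := generalized_tube_lemma (isCompact_singleton (x := (0 : ℝ)))
    hcs.isCompact hn (by
      rintro ⟨t, y⟩ ⟨rfl, hy⟩
      refine ⟨⟨mem_univ _, hβO hy⟩, ?_⟩
      rw [mem_preimage, hG0]
      exact (chart n q).map_source (hOq (hβO hy)))
  obtain ⟨ε, hε, hεu⟩ := Metric.isOpen_iff.1 hu 0 (hu0 rfl)
  rw [Real.ball_eq_Ioo, zero_sub, zero_add] at hεu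
  have hGt : ∀ t ∈ Ioo (-ε) ε, ∀ y ∈ O, G (t, y) ∈ (chart n q).target := by
    intro t ht y hy
    by_cases hyβ : y ∈ tsupport β
    · exact (@huv (t, y) ⟨hεu ht, hv hyβ⟩).2
    · rw [hGβ t y hyβ]
      exact (chart n q).map_source (hOq hy)
  set Φ : ℝ → M → N := fun t y ↦ if y ∈ O then (chart n q).symm (G (t, y)) else φ y with hΦ
  have hΦO : ∀ t, ∀ y ∈ O, Φ t y = (chart n q).symm (G (t, y)) := fun t y hy ↦ if_pos hy
  have hΦβ : ∀ t, ∀ y ∉ tsupport β, Φ t y = φ y := by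
    intro t y hy
    by_cases hyO : y ∈ O
    · rw [hΦO t y hyO, hGβ t y hy, (chart n q).left_inv (hOq hyO)]
    · exact if_neg hyO
  have hΦ0 : Φ 0 = φ := by
    funext y
    by_cases hyO : y ∈ O
    · rw [hΦO 0 y hyO, hG0, (chart n q).left_inv (hOq hyO)]
    · exact if_neg hyO
  refine ⟨ε, Φ, hΦ0, ⟨hε, ?_, hO, hOs, ?_, ?_⟩, ?_⟩
  -- Smoothness is checked on two open sets that cover: over `O`, where the chart formula holds, and
  -- off the support of `β`, where the family is `φ`.
  · rintro ⟨t, y⟩ ⟨ht, -⟩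
    refine ContMDiffAt.contMDiffWithinAt ?_
    by_cases hy : y ∈ O
    · have h1 : ContMDiffOn (𝓘(ℝ, ℝ).prod (𝓡 m)) (𝓡 n) ∞ (fun s : ℝ × M ↦ (chart n q).symm (G s))
          (Ioo (-ε) ε ×ˢ O) :=
        (contMDiffOn_chart_symm (I := 𝓡 n) (n := ∞) (x := q)).comp
          (hGs.mono (prod_mono (subset_univ _) Subset.rfl)) fun s hs ↦ hGt s.1 hs.1 s.2 hs.2
      have hop : IsOpen (Ioo (-ε) ε ×ˢ O) := isOpen_Ioo.prod hO
      refine (h1.contMDiffAt (hop.mem_nhds (x := (t, y)) ⟨ht, hy⟩)).congr_of_eventuallyEq ?_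
      filter_upwards [hop.mem_nhds (x := (t, y)) ⟨ht, hy⟩] with s hs
      exact hΦO s.1 s.2 hs.2
    · have hop : IsOpen ((univ : Set ℝ) ×ˢ (tsupport β)ᶜ) :=
        isOpen_univ.prod (isClosed_tsupport β).isOpen_compl
      have h1 : ContMDiff (𝓘(ℝ, ℝ).prod (𝓡 m)) (𝓡 n) ∞ (fun s : ℝ × M ↦ φ s.2) :=
        hφ.comp contMDiff_snd
      refine h1.contMDiffAt.congr_of_eventuallyEq ?_
      filter_upwards [hop.mem_nhds (x := (t, y)) ⟨mem_univ _, fun h ↦ hy (hβO h)⟩] with s hs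
      exact hΦβ s.1 s.2 hs.2
  · intro t ht y hy
    rw [hΦO t y hy]
    exact (chart n q).map_target (hGt t ht y hy)
  · intro t _ y hy
    rw [hΦβ t y hy, hΦβ 0 y hy]
  · intro t ht y hy
    rw [hΦO t y hy, (chart n q).right_inv (hGt t ht y hy)]

variable [T2Space M] [SecondCountableTopology M]
  [RiemannianBundle (fun x : M ↦ TangentSpace (𝓡 m) x)]
  [RiemannianBundle (fun q : N ↦ TangentSpace (𝓡 n) q)]
  [IsContMDiffRiemannianBundle (𝓡 m) ∞ (EuclideanSpace ℝ (Fin m))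
    (fun x : M ↦ TangentSpace (𝓡 m) x)]
  [IsContMDiffRiemannianBundle (𝓡 n) ∞ (EuclideanSpace ℝ (Fin n))
    (fun q : N ↦ TangentSpace (𝓡 n) q)]
  [MeasurableSpace M] [BorelSpace M]

/-- A biharmonic map satisfies the local form of the biharmonic map equation. -/
theorem jac_eq_zero_of_isBiharmonic {φ : M → N} (hφ : IsBiharmonic m n φ) (p : M) :
    jac (hloc m p) (hloc n (φ p)) (stdB m) (locMap m n p (φ p) φ)
      (tens (hloc m p) (hloc n (φ p)) (stdB m) (locMap m n p (φ p) φ)) (chart m p p) = 0 := by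
  set q := φ p with hq
  set O : Set M := (chart m p).source ∩ φ ⁻¹' (chart n q).source with hOdef
  have hO : IsOpen O :=
    (chart m p).open_source.inter ((chart n q).open_source.preimage hφ.1.continuous)
  have hpO : p ∈ O := ⟨mem_chart_source _ p, mem_chart_source _ q⟩
  have hOs : O ⊆ (chart m p).source := inter_subset_left
  have hOq : MapsTo φ O (chart n q).source := fun y hy ↦ hy.2
  have hLO : IsOpen (locSet m p O) := isOpen_locSet p hO
  have hg : IsMetricOn (hloc m p) (locSet m p O) := (isMetricOn_hloc p).mono hLO inter_subset_left
  have hh := isMetricOn_hloc (n := n) q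
  have hf : ContDiffOn ℝ ∞ (locMap m n p q φ) (locSet m p O) :=
    contDiffOn_locMap hφ.1.contMDiffOn hOq
  have hfm : MapsTo (locMap m n p q φ) (locSet m p O) (chart n q).target :=
    fun z hz ↦ (chart n q).map_source (hOq hz.2)
  set X := jac (hloc m p) (hloc n q) (stdB m) (locMap m n p q φ)
    (tens (hloc m p) (hloc n q) (stdB m) (locMap m n p q φ)) with hX
  have hXs : ContDiffOn ℝ ∞ X (locSet m p O) :=
    contDiffOn_jac hg hh hf hfm (contDiffOn_tens hg hh hf hfm)
  by_contra hne
  have hP : ContMDiffOn (𝓡 m) 𝓘(ℝ, EuclideanSpace ℝ (Fin n)) ∞ (fun y ↦ X (chart m p y)) O :=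
    hXs.contMDiffOn.comp ((contMDiffOn_chart (I := 𝓡 m) (n := ∞) (x := p)).mono hOs)
      fun y hy ↦ (mem_locSet (hOs hy)).2 hy
  -- Two nested bumps: `β` cuts off the field, and `ρ` equals 1 near the support of `β`, so that
  -- $\operatorname{grad}\rho$ vanishes wherever the field does not.
  obtain ⟨ρ, -, hρO⟩ := (SmoothBumpFunction.nhds_basis_tsupport (I := 𝓡 m) p).mem_iff.1
    (hO.mem_nhds hpO)
  obtain ⟨β, -, hβ1⟩ := (SmoothBumpFunction.nhds_basis_tsupport (I := 𝓡 m) p).mem_iff.1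
    (isOpen_interior.mem_nhds (mem_interior_iff_mem_nhds.2 ρ.eventuallyEq_one))
  have hρ1 : ∀ x ∈ tsupport β, (ρ : M → ℝ) =ᶠ[𝓝 x] fun _ ↦ 1 := fun x hx ↦
    mem_interior_iff_mem_nhds.1 (hβ1 hx)
  have hρs : tsupport ρ ⊆ O := hρO
  have hβO : tsupport β ⊆ O := fun x hx ↦ hρs (subset_tsupport _ (by
    rw [Function.mem_support, (hρ1 x hx).self_of_nhds]; exact one_ne_zero))
  have hρsm : ContMDiff (𝓡 m) 𝓘(ℝ, ℝ) ∞ ρ := ρ.contMDiff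
  have hβsm : ContMDiff (𝓡 m) 𝓘(ℝ, ℝ) ∞ β := β.contMDiff
  have hΩ : IsCompact (tsupport β) := β.hasCompactSupport.isCompact
  obtain ⟨ε, Φ, hΦ0, S, hΦ⟩ := exists_isChartVariation_of_field hφ.1 hO hOs hOq hP hβsm
    β.hasCompactSupport hβO
  have hvar : IsVariation m n φ (tsupport β) ε Φ :=
    ⟨S.smooth, hΦ0, fun t ht x hx ↦ by rw [S.eq_off t ht x hx, hΦ0]⟩
  have hd := S.hasDerivAt_setIntegral_tension_sq hρsm ρ.hasCompactSupport hρs hΩ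
  have hb := (hφ.2 _ hΩ ε S.pos Φ hvar).const_mul 2
  -- On the support of `β` the weight `ρ` is 1, so the weighted integral is twice the bienergy.
  have he : (fun t ↦ ∫ x in tsupport β, ρ x * ‖tension m n (Φ t) x‖ ^ 2 ∂(riemannianVolume m M))
      = fun t ↦ 2 * bienergy m n (Φ t) (tsupport β) := by
    funext t
    rw [bienergy, ← mul_assoc, mul_one_div_cancel two_ne_zero, one_mul]
    refine setIntegral_congr_fun hΩ.measurableSet fun x hx ↦ ?_
    simp only [(hρ1 x hx).self_of_nhds, one_mul]
  rw [he] at hd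
  have hflux : ∀ x, variationFlux m n Φ ρ x = 0 := by
    intro x
    by_cases hx : x ∈ tsupport β
    · rw [variationFlux, grad_eq_zero_of_eventuallyEq_const (hρ1 x hx), covAlong_zero_right,
        covAlong_zero_right, inner_zero_left, inner_zero_right, sub_zero]
    · exact S.variationFlux_eq_zero_of_notMem hρsm ρ.hasCompactSupport hρs hΩ hx
  have hI := hd.unique hb
  simp only [hflux, integral_zero, sub_zero, mul_zero] at hI
  have hI' := (mul_eq_zero.1 hI).resolve_left two_ne_zero
  -- The variation field is $\beta J\tau$, so the integrand below is a nonnegative weight times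
  -- $|J\tau|^2$.
  have hfield : ∀ z ∈ locSet m p O, fderiv ℝ (locFam m n p q Φ) (0, z) (1, 0)
      = β ((chart m p).symm z) • X z := by
    intro z hz
    refine (S.hasDerivAt_locFam hz).unique ?_
    have h1 : HasDerivAt (fun t : ℝ ↦ locMap m n p q φ z + (t * β ((chart m p).symm z)) • X z)
        ((1 * β ((chart m p).symm z)) • X z) 0 :=
      (((hasDerivAt_id (0 : ℝ)).mul_const _).smul_const _).const_add _
    rw [one_mul] at h1
    refine h1.congr_of_eventuallyEq ?_
    filter_upwards [isOpen_Ioo.mem_nhds S.zero_mem] with t ht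
    have h2 := hΦ t ht _ hz.2
    rw [(chart m p).right_inv hz.1] at h2
    exact h2
  set F : EuclideanSpace ℝ (Fin m) → ℝ := fun z ↦ locExt m p ρ z * (density (hloc m p) (stdB m) z
    * hloc n q (locMap m n p q (Φ 0) z) (fderiv ℝ (locFam m n p q Φ) (0, z) (1, 0))
      (jac (hloc m p) (hloc n q) (stdB m) (locMap m n p q (Φ 0))
        (tens (hloc m p) (hloc n q) (stdB m) (locMap m n p q (Φ 0))) z)) with hF
  have hFO : ∀ z ∈ locSet m p O, F z = locExt m p ρ z * (density (hloc m p) (stdB m) z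
      * (β ((chart m p).symm z) * hloc n q (locMap m n p q φ z) (X z) (X z))) := by
    intro z hz
    simp only [hF]
    rw [hfield z hz, hΦ0, map_smul, smul_apply, smul_eq_mul]
  have hss := hρs.trans hOs
  have hts : tsupport (locExt m p ρ) ⊆ locSet m p O := by
    refine (tsupport_locExt ρ.hasCompactSupport hss).trans ?_
    rintro _ ⟨x, hx, rfl⟩
    exact (mem_locSet (hss hx)).2 (hρs hx)
  have hFc : Continuous F := by
    refine ContinuousOn.continuous_of_tsupport_subset (s := locSet m p O) ?_ hLO
      ((tsupport_mul_subset_left).trans hts)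
    have h1 := (contDiff_locExt ρ.hasCompactSupport hss hρsm).continuous.continuousOn
      (s := locSet m p O)
    have h2 := S.contDiffOn_zero
    have h3 := contDiffOn_jac S.isMetricOn_left hh h2 S.mapsTo_zero (b := stdB m)
      S.contDiffOn_tens_zero
    exact h1.mul ((contDiffOn_density hg).continuousOn.mul
      (((hh.smooth.comp h2 S.mapsTo_zero).clm_apply S.contDiffOn_field).clm_apply h3).continuousOn)
  have hρ0 : 0 ≤ locExt m p ρ := fun z ↦ indicator_nonneg (fun _ _ ↦ ρ.nonneg) z
  have hFn : 0 ≤ F := by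
    intro z
    by_cases hz : z ∈ locSet m p O
    · rw [hFO z hz]
      refine mul_nonneg (hρ0 z) (mul_nonneg (density_pos hg hz).le (mul_nonneg β.nonneg ?_))
      by_cases h0 : X z = 0
      · simp only [h0, map_zero, le_refl]
      · exact (hh.pos _ (hfm hz) _ h0).le
    · have h0 : locExt m p ρ z = 0 :=
        image_eq_zero_of_notMem_tsupport fun h ↦ hz (hts h)
      simp only [hF, h0, zero_mul, Pi.zero_apply, le_refl]
  have hzp : chart m p p ∈ locSet m p O := (mem_locSet hpO.1).2 hpO
  have hFp : F (chart m p p) ≠ 0 := by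
    rw [hFO _ hzp, locExt_of_mem hzp.1, (chart m p).left_inv hpO.1, ρ.eq_one, β.eq_one, one_mul,
      one_mul]
    exact mul_ne_zero (density_pos hg hzp).ne' (hh.pos _ (hfm hzp) _ hne).ne'
  -- A continuous nonnegative integrand that is nonzero at the centre has positive integral, whereas
  -- the first variation makes it zero.
  have hpos := hFc.integral_pos_of_hasCompactSupport_nonneg_nonzero
    (μ := (volume : Measure (EuclideanSpace ℝ (Fin m))))
    ((hasCompactSupport_locExt ρ.hasCompactSupport hss).mul_right) hFn hFp
  exact hpos.ne' hI'

end Variation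

/-! ## Local unit normal fields -/

section LocalNormal

variable {E F : Type*} [NormedAddCommGroup E] [NormedSpace ℝ E] [FiniteDimensional ℝ E]
  [NormedAddCommGroup F] [NormedSpace ℝ F] [FiniteDimensional ℝ F]
  {g : E → E →L[ℝ] E →L[ℝ] ℝ} {O : Set E} {h : F → F →L[ℝ] F →L[ℝ] ℝ} {W : Set F} {f : E → F}

theorem exists_notMem_range_of_finrank_lt (hd : Module.finrank ℝ E < Module.finrank ℝ F)
    (L : E →ₗ[ℝ] F) : ∃ w, w ∉ LinearMap.range L := by
  by_contra! hw
  have h1 : LinearMap.range L = ⊤ := eq_top_iff.2 fun w _ ↦ hw w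
  have h2 := LinearMap.finrank_range_le L
  rw [h1, finrank_top] at h2
  omega

/-- Near each point an isometric immersion of positive codimension has a smooth unit normal field,
by orthogonal projection of a constant field. -/
theorem exists_smooth_unit_normal (hg : IsMetricOn g O) (hh : IsMetricOn h W)
    (hf : ContDiffOn ℝ ∞ f O) (hm : MapsTo f O W)
    (hiso : ∀ y ∈ O, ∀ a b, h (f y) (fderiv ℝ f y a) (fderiv ℝ f y b) = g y a b)
    (hd : Module.finrank ℝ E < Module.finrank ℝ F) {z₀ : E} (hz₀ : z₀ ∈ O) :
    ∃ (O' : Set E) (ν : E → F), IsOpen O' ∧ z₀ ∈ O' ∧ O' ⊆ O ∧ ContDiffOn ℝ ∞ ν O' ∧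
      (∀ z ∈ O', h (f z) (ν z) (ν z) = 1) ∧
      ∀ z ∈ O', ∀ a, h (f z) (fderiv ℝ f z a) (ν z) = 0 := by
  obtain ⟨w, hw⟩ := exists_notMem_range_of_finrank_lt hd (fderiv ℝ f z₀).toLinearMap
  set b := Module.finBasis ℝ E
  -- The normal part of the constant field `w`. At `z₀` it is nonzero, since `w` lies outside the
  -- range of the differential.
  set k : E → F := fun z ↦ w - ∑ i, h (f z) w (fderiv ℝ f z (dualVec g b i z)) • fderiv ℝ f z (b i)
    with hk
  have hO := hg.isOpen
  have hks : ContDiffOn ℝ ∞ k O := by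
    refine contDiffOn_const.sub (ContDiffOn.sum fun i _ ↦ ContDiffOn.smul ?_ ?_)
    · exact ((hh.smooth.comp hf hm).clm_apply contDiffOn_const).clm_apply
        (contDiffOn_fderiv_apply hO hf (hg.contDiffOn_dualVec i))
    · exact contDiffOn_fderiv_apply hO hf contDiffOn_const
  have hkn : ∀ z ∈ O, ∀ a, h (f z) (fderiv ℝ f z a) (k z) = 0 := by
    intro z hz a
    have h1 : ∑ i, h (f z) w (fderiv ℝ f z (dualVec g b i z)) • g z a (b i)
        = h (f z) w (fderiv ℝ f z a) := by
      conv_rhs => rw [← hg.sum_smul_dualVec (b := b) hz a]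
      simp only [map_sum, map_smul, smul_eq_mul]
      exact Finset.sum_congr rfl fun i _ ↦ mul_comm _ _
    simp only [hk, map_sub, map_sum, map_smul, hiso z hz]
    rw [h1, hh.symm _ (hm hz), sub_self]
  have hk0 : k z₀ ≠ 0 := by
    intro h0
    refine hw ⟨∑ i, h (f z₀) w (fderiv ℝ f z₀ (dualVec g b i z₀)) • b i, ?_⟩
    simp only [ContinuousLinearMap.coe_coe, map_sum, map_smul]
    exact (sub_eq_zero.1 h0).symm
  have hO' : IsOpen (O ∩ k ⁻¹' {0}ᶜ) :=
    hks.continuousOn.isOpen_inter_preimage hO isOpen_compl_singleton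
  have hpos : ∀ z ∈ O ∩ k ⁻¹' {0}ᶜ, 0 < h (f z) (k z) (k z) :=
    fun z hz ↦ hh.pos _ (hm hz.1) _ hz.2
  have hks' := hks.mono (inter_subset_left (t := k ⁻¹' {0}ᶜ))
  refine ⟨_, fun z ↦ (Real.sqrt (h (f z) (k z) (k z)))⁻¹ • k z, hO', ⟨hz₀, hk0⟩, inter_subset_left,
    ?_, fun z hz ↦ ?_, fun z hz a ↦ ?_⟩
  · refine ContDiffOn.smul (ContDiffOn.inv (ContDiffOn.sqrt ?_ fun z hz ↦ (hpos z hz).ne')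
      fun z hz ↦ (Real.sqrt_pos.2 (hpos z hz)).ne') hks'
    exact (((hh.smooth.comp hf hm).mono inter_subset_left).clm_apply hks').clm_apply hks'
  · have h1 := Real.mul_self_sqrt (hpos z hz).le
    have h2 := (Real.sqrt_pos.2 (hpos z hz)).ne'
    simp only [map_smul, smul_apply, smul_eq_mul]
    field_simp
    rw [sq, h1]
  · rw [map_smul, hkn z hz.1, smul_zero]

end LocalNormal

/-! ### Local unit normals and mean curvature functions of hypersurfaces. -/

section HypersurfaceNormal

variable {m : ℕ} {M : Type*} [TopologicalSpace M]
  [ChartedSpace (EuclideanSpace ℝ (Fin m)) M] [IsManifold (𝓡 m) ∞ M]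
  {N : Type*} [TopologicalSpace N] [ChartedSpace (EuclideanSpace ℝ (Fin (m + 1))) N]
  [IsManifold (𝓡 (m + 1)) ∞ N]
  [RiemannianBundle (fun x : M ↦ TangentSpace (𝓡 m) x)]
  [RiemannianBundle (fun q : N ↦ TangentSpace (𝓡 (m + 1)) q)]
  [IsContMDiffRiemannianBundle (𝓡 m) ∞ (EuclideanSpace ℝ (Fin m))
    (fun x : M ↦ TangentSpace (𝓡 m) x)]
  [IsContMDiffRiemannianBundle (𝓡 (m + 1)) ∞ (EuclideanSpace ℝ (Fin (m + 1)))
    (fun q : N ↦ TangentSpace (𝓡 (m + 1)) q)]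
  {φ : M → N}

theorem contMDiffOn_totalSpace_trivSymm {U : Set M} {q : N} (hφ : ContMDiffOn (𝓡 m) (𝓡 (m + 1)) ∞ φ U)
    (hU : MapsTo φ U (chart (m + 1) q).source) {ν : M → EuclideanSpace ℝ (Fin (m + 1))}
    (hν : ContMDiffOn (𝓡 m) 𝓘(ℝ, EuclideanSpace ℝ (Fin (m + 1))) ∞ ν U) :
    ContMDiffOn (𝓡 m) (𝓡 (m + 1)).tangent ∞
      (fun x ↦ (⟨φ x, trivSymm q (φ x) (ν x)⟩ : TangentBundle (𝓡 (m + 1)) N)) U := by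
  refine ((trivializationAt (EuclideanSpace ℝ (Fin (m + 1))) (TangentSpace (𝓡 (m + 1)))
    q).contMDiffOn_iff (IB := 𝓡 (m + 1)) ?_).2 ⟨hφ, hν.congr fun x hx ↦ triv_trivSymm (hU hx) _⟩
  intro x hx
  rw [Trivialization.mem_source]
  exact hU hx

theorem exists_unit_normal (hφ : IsIsometricImmersion m (m + 1) φ) (p : M) :
    ∃ (U : Set M) (ξ : Π x : M, TangentSpace (𝓡 (m + 1)) (φ x)), p ∈ U ∧ IsOpen U ∧
      ContMDiffOn (𝓡 m) (𝓡 (m + 1)).tangent ∞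
        (fun x ↦ (⟨φ x, ξ x⟩ : TangentBundle (𝓡 (m + 1)) N)) U ∧ (∀ x ∈ U, ‖ξ x‖ = 1) ∧
      ∀ x ∈ U, ∀ u : TangentSpace (𝓡 m) x,
        inner ℝ (mfderiv (𝓡 m) (𝓡 (m + 1)) φ x u) (ξ x) = 0 := by
  set q := φ p with hq
  set O : Set M := (chart m p).source ∩ φ ⁻¹' (chart (m + 1) q).source with hOdef
  have hO : IsOpen O :=
    (chart m p).open_source.inter ((chart (m + 1) q).open_source.preimage hφ.smooth.continuous)
  have hpO : p ∈ O := ⟨mem_chart_source _ p, mem_chart_source _ q⟩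
  have hLO : IsOpen (locSet m p O) := isOpen_locSet p hO
  have hg : IsMetricOn (hloc m p) (locSet m p O) := (isMetricOn_hloc p).mono hLO inter_subset_left
  have hf : ContDiffOn ℝ ∞ (locMap m (m + 1) p q φ) (locSet m p O) :=
    contDiffOn_locMap hφ.smooth.contMDiffOn fun y hy ↦ hy.2
  obtain ⟨O', ν, hO', hpO', hsub, hν, hν1, hν0⟩ := exists_smooth_unit_normal hg
    (isMetricOn_hloc (n := m + 1) q) hf (fun z hz ↦ (chart (m + 1) q).map_source hz.2.2)
    (fun z hz ↦ hloc_fderiv_locMap hφ hz.1 hz.2.2)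
    (by simp) ((mem_locSet hpO.1).2 hpO)
  have hU : IsOpen ((chart m p).source ∩ chart m p ⁻¹' O') :=
    (chart m p).isOpen_inter_preimage hO'
  have hUO : ∀ x ∈ (chart m p).source ∩ chart m p ⁻¹' O', φ x ∈ (chart (m + 1) q).source :=
    fun x hx ↦ ((mem_locSet hx.1).1 (hsub hx.2)).2
  have hxz : ∀ x ∈ (chart m p).source ∩ chart m p ⁻¹' O',
      chart (m + 1) q (φ x) = locMap m (m + 1) p q φ (chart m p x) := fun x hx ↦ by
    rw [locMap, (chart m p).left_inv hx.1]
  refine ⟨(chart m p).source ∩ chart m p ⁻¹' O', fun x ↦ trivSymm q (φ x) (ν (chart m p x)),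
    ⟨hpO.1, hpO'⟩, hU,
    contMDiffOn_totalSpace_trivSymm hφ.smooth.contMDiffOn hUO ?_, fun x hx ↦ ?_, fun x hx u ↦ ?_⟩
  · exact hν.contMDiffOn.comp
      ((contMDiffOn_chart (I := 𝓡 m) (n := ∞) (x := p)).mono inter_subset_left) fun x hx ↦ hx.2
  · have h1 := hν1 _ hx.2
    have h2 := hloc_triv (hUO x hx) (trivSymm q (φ x) (ν (chart m p x)))
      (trivSymm q (φ x) (ν (chart m p x)))
    rw [triv_trivSymm (hUO x hx), hxz x hx, h1, real_inner_self_eq_norm_sq] at h2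
    exact (pow_eq_one_iff_of_nonneg (norm_nonneg _) two_ne_zero).1 h2.symm
  · refine (hloc_triv (hUO x hx) _ _).symm.trans ?_
    rw [triv_trivSymm (hUO x hx), triv_mfderiv_of_mem (p := p) isOpen_univ
      hφ.smooth.contMDiffOn (mem_univ x) hx.1 (hUO x hx), hxz x hx, hν0 _ hx.2]

/-- The tension field of a hypersurface is normal. -/
theorem exists_isNormalWithMeanCurvature (hφ : IsIsometricImmersion m (m + 1) φ) (p : M) :
    ∃ (U : Set M) (ξ : Π x : M, TangentSpace (𝓡 (m + 1)) (φ x)) (H : M → ℝ), p ∈ U ∧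
      IsNormalWithMeanCurvature m φ U ξ H := by
  obtain ⟨U, ξ, hpU, hU, hξ, h1, h0⟩ := exists_unit_normal hφ p
  have key : ∀ x ∈ U, ∃ c : ℝ, meanCurvatureVector m φ x = c • ξ x := by
    intro x hx
    have hxs := mem_chart_source (EuclideanSpace ℝ (Fin m)) x
    have hqs := mem_chart_source (EuclideanSpace ℝ (Fin (m + 1))) (φ x)
    have S := isLocalHypersurface_of_normal hφ hU hξ h1 h0 x (φ x)
    have hz : chart m x x ∈ locSet m x (U ∩ φ ⁻¹' (chart (m + 1) (φ x)).source) :=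
      (mem_locSet hxs).2 ⟨hx, hqs⟩
    -- Split $\tau=df\,a+s\xi$. Pairing with $df\,a$ gives $g(a,a)=0$, because the second
    -- fundamental form is normal; hence $a=0$.
    obtain ⟨a, s, has⟩ := S.span _ hz (tens (hloc m x) (hloc (m + 1) (φ x)) (stdB m)
      (locMap m (m + 1) x (φ x) φ) (chart m x x))
    have h2 : hloc (m + 1) (φ x) (locMap m (m + 1) x (φ x) φ (chart m x x))
        (tens (hloc m x) (hloc (m + 1) (φ x)) (stdB m) (locMap m (m + 1) x (φ x) φ) (chart m x x))
        (fderiv ℝ (locMap m (m + 1) x (φ x) φ) (chart m x x) a) = 0 := by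
      rw [tens, map_sum, sum_apply]
      exact Finset.sum_eq_zero fun i _ ↦ sff_normal S.metric_left S.metric_right S.smooth S.mapsTo
        S.iso hz _ _ _
    have h3 := S.normal _ hz a
    rw [has, map_add, add_apply, map_smul, smul_apply, S.metric_right.symm _ (S.mapsTo hz)
      (locFun m x (components φ ξ (φ x)) (chart m x x))
      (fderiv ℝ (locMap m (m + 1) x (φ x) φ) (chart m x x) a), h3, smul_zero, add_zero,
      S.iso _ hz] at h2
    have ha : a = 0 := by
      by_contra hne
      exact (S.metric_left.pos _ hz a hne).ne' h2
    rw [ha, map_zero, zero_add] at has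
    have h4 := triv_tension (p := x) isOpen_univ hφ.smooth.contMDiffOn (mem_univ x) hxs hqs
    refine ⟨1 / (m : ℝ) * s, ?_⟩
    have h5 : tension m (m + 1) φ x = s • ξ x := by
      refine triv_injective hqs ?_
      rw [h4, has, triv_smul hqs, locFun, components_eq_triv, (chart m x).left_inv hxs]
    rw [mul_smul, ← h5]
    rfl
  classical
  choose! H hH using key
  exact ⟨U, ξ, H, hpU, hU, hξ, h1, h0, hH⟩

end HypersurfaceNormal

end Biharmonic

end

/-! ### The main theorem: reduction to the Jacobi equation in charts. -/

theorem mainTheorem1 {m : ℕ}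
    {M : Type*} [TopologicalSpace M] [T2Space M] [SecondCountableTopology M]
    [ChartedSpace (EuclideanSpace ℝ (Fin m)) M] [IsManifold (𝓡 m) ∞ M]
    [RiemannianBundle (fun x : M ↦ TangentSpace (𝓡 m) x)]
    [IsContMDiffRiemannianBundle (𝓡 m) ∞ (EuclideanSpace ℝ (Fin m))
      (fun x : M ↦ TangentSpace (𝓡 m) x)]
    [MeasurableSpace M] [BorelSpace M]
    {N : Type*} [TopologicalSpace N] [T2Space N] [SecondCountableTopology N]
    [ChartedSpace (EuclideanSpace ℝ (Fin (m + 1))) N] [IsManifold (𝓡 (m + 1)) ∞ N]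
    [RiemannianBundle (fun q : N ↦ TangentSpace (𝓡 (m + 1)) q)]
    [IsContMDiffRiemannianBundle (𝓡 (m + 1)) ∞ (EuclideanSpace ℝ (Fin (m + 1)))
      (fun q : N ↦ TangentSpace (𝓡 (m + 1)) q)]
    (φ : M → N) (hφ : Biharmonic.IsIsometricImmersion m (m + 1) φ) :
    (Biharmonic.IsBiharmonic m (m + 1) φ ↔
      ∀ (U : Set M) (ξ : Π x : M, TangentSpace (𝓡 (m + 1)) (φ x)) (H : M → ℝ),
        Biharmonic.IsNormalWithMeanCurvature m φ U ξ H →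
          ∀ x ∈ U, Biharmonic.HypersurfaceEquations m φ ξ H x) ∧
    (Biharmonic.IsBiharmonic m (m + 1) φ ↔
      ∀ p : M, ∃ (U : Set M) (ξ : Π x : M, TangentSpace (𝓡 (m + 1)) (φ x)) (H : M → ℝ),
        p ∈ U ∧ Biharmonic.IsNormalWithMeanCurvature m φ U ξ H ∧
          ∀ x ∈ U, Biharmonic.HypersurfaceEquations m φ ξ H x) := by
  have key : Biharmonic.IsBiharmonic m (m + 1) φ ↔ ∀ (p : M) (q : N) (x : M),
      x ∈ (Biharmonic.chart m p).source → φ x ∈ (Biharmonic.chart (m + 1) q).source →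
        Biharmonic.jac (Biharmonic.hloc m p) (Biharmonic.hloc (m + 1) q) (Biharmonic.stdB m)
          (Biharmonic.locMap m (m + 1) p q φ) (Biharmonic.tens (Biharmonic.hloc m p)
            (Biharmonic.hloc (m + 1) q) (Biharmonic.stdB m)
            (Biharmonic.locMap m (m + 1) p q φ)) (Biharmonic.chart m p x) = 0 := by
    refine ⟨fun h p q x hx hq ↦ ?_, Biharmonic.isBiharmonic_of_jac_eq_zero hφ.smooth⟩
    -- Biharmonicity yields the equation at `x` only in the preferred charts at `x` and `φ x`. The
    -- chart-free equations for a local unit normal carry it over to the charts at `p` and `q`.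
    obtain ⟨U, ξ, H, hxU, hN⟩ := Biharmonic.exists_isNormalWithMeanCurvature hφ x
    exact (hN.hypersurfaceEquations_iff hφ hxU hx hq).1
      ((hN.hypersurfaceEquations_iff hφ hxU (mem_chart_source _ x) (mem_chart_source _ (φ x))).2
        (Biharmonic.jac_eq_zero_of_isBiharmonic h x))
  have fwd : Biharmonic.IsBiharmonic m (m + 1) φ →
      ∀ (U : Set M) (ξ : Π x : M, TangentSpace (𝓡 (m + 1)) (φ x)) (H : M → ℝ),
        Biharmonic.IsNormalWithMeanCurvature m φ U ξ H →
          ∀ x ∈ U, Biharmonic.HypersurfaceEquations m φ ξ H x := fun h U ξ H hN x hx ↦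
    (hN.hypersurfaceEquations_iff hφ hx (mem_chart_source _ x) (mem_chart_source _ (φ x))).2
      (key.1 h _ _ _ (mem_chart_source _ x) (mem_chart_source _ (φ x)))
  have bwd : (∀ p : M, ∃ (U : Set M) (ξ : Π x : M, TangentSpace (𝓡 (m + 1)) (φ x)) (H : M → ℝ),
      p ∈ U ∧ Biharmonic.IsNormalWithMeanCurvature m φ U ξ H ∧
        ∀ x ∈ U, Biharmonic.HypersurfaceEquations m φ ξ H x) →
      Biharmonic.IsBiharmonic m (m + 1) φ := fun h ↦ key.2 fun p q x hx hq ↦ by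
    obtain ⟨U, ξ, H, hxU, hN, hE⟩ := h x
    exact (hN.hypersurfaceEquations_iff hφ hxU hx hq).1 (hE x hxU)
  -- The universal condition implies the local one because unit normal fields exist near every
  -- point; without this it could hold vacuously.
  have loc : (∀ (U : Set M) (ξ : Π x : M, TangentSpace (𝓡 (m + 1)) (φ x)) (H : M → ℝ),
      Biharmonic.IsNormalWithMeanCurvature m φ U ξ H →
        ∀ x ∈ U, Biharmonic.HypersurfaceEquations m φ ξ H x) →
      ∀ p : M, ∃ (U : Set M) (ξ : Π x : M, TangentSpace (𝓡 (m + 1)) (φ x)) (H : M → ℝ),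
        p ∈ U ∧ Biharmonic.IsNormalWithMeanCurvature m φ U ξ H ∧
          ∀ x ∈ U, Biharmonic.HypersurfaceEquations m φ ξ H x := fun h p ↦ by
    obtain ⟨U, ξ, H, hp, hN⟩ := Biharmonic.exists_isNormalWithMeanCurvature hφ p
    exact ⟨U, ξ, H, hp, hN, h U ξ H hN⟩
  exact ⟨⟨fwd, fun h ↦ bwd (loc h)⟩, ⟨fun h ↦ loc (fwd h), bwd⟩⟩
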